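/- **Theorem 5.1 (Global existence of classical solutions).** Let $d\ge 0$ be an integer, let $\lambda_x,\lambda_v,\lambda_w>0$, and let the communication rate $\phi:\mathbb R\to[0,\infty)$ be smooth, Lipschitz and even, with $(\phi(r)-\phi(s))(r-s)\le 0$ for all $r,s\ge 0$. For a density $f=f(x,v,t)$ on $\mathbb R^d\times\mathbb R^d$ put $$Q(f)(x,v,t)=\int_{\mathbb R^{2d}}\big[\lambda_w(x^*-x)+\lambda_x\phi(|x-x^*|)(x^*-x)+\lambda_v\phi(|x-x^*|)(v^*-v)\big]f(x^*,v^*,t)\,dx^*dv^*$$ and consider the Cauchy problem $$\partial_t f+v\cdot\nabla_x f+\nabla_v\cdot\big(Q(f)f\big)=0,\qquad f(x,v,0)=f_0(x,v).\tag{D-1}$$ A classical solution on $[0,T)$, $0<T\le\infty$, is a function $f\in C^1(\mathbb R^d\times\mathbb R^d\times[0,T))$ which satisfies (D-1) pointwise (with the one-sided time derivative at $t=0$), such that $(1+|x|^2+|v|^2)f(\cdot,\cdot,t)$ is integrable for each $t$ and $\int_{\mathbb R^{2d}}(1+|x|^2+|v|^2)|f(x,v,t)|\,dx\,dv$ is bounded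 on $[0,b]$ for every $b<T$. With $x_c(t)=\int x f\,dx\,dv$ and $v_c(t)=\int v f\,dx\,dv$ let $$X(t)=\int_{\mathbb R^{2d}}|x-x_c(t)|^2f\,dx\,dv,\qquad V(t)=\int_{\mathbb R^{2d}}|v-v_c(t)|^2f\,dx\,dv,$$ $$M(t)=\int_{\mathbb R^{4d}}\Phi(|x-x^*|)f(x,v,t)f(x^*,v^*,t)\,dx\,dv\,dx^*dv^*,\qquad \Phi(r)=\frac12\int_0^{r^2}\phi(\sqrt s)\,ds,$$ and define the herding energy $E(t)=\lambda_wX(t)+V(t)+\lambda_xM(t)$. Let $f_0\in C^1(\mathbb R^d\times\mathbb R^d)$ be compactly supported. (1) For every $T\in(0,\infty]$ the problem (D-1) has a unique classical solution $f$ on $[0,T)$. If moreover $f_0\ge0$ and $\int f_0\,dx\,dv=1$, then $E(t)\le E(0)$ for all $t\in[0,T)$. (2) Suppose in addition that $f_0\ge 0$, $\int f_0\,dx\,dv=1$ and $\phi_m\le\phi\le\phi_M$ for some constants $\phi_m,\phi_M>0$. Then the global solution ($T=\infty$) satisfies $\lim_{t\to\infty}(X(t)+V(t))=0$. (3) Suppose,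 further to the hypotheses of (2), that $$\frac{\phi_M\lambda_x^2}{\phi_m\lambda_w\lambda_v^2}<\frac12\min(1,\phi_M).$$ Then there are constants $\beta>0$, depending only on $\lambda_x,\lambda_v,\lambda_w,\phi_m,\phi_M$, and $C>0$, depending only on $f_0$ and $\lambda_x,\lambda_v,\lambda_w$, such that the global solution satisfies $X(t)+V(t)\le Ce^{-\frac{\beta}{2}t}$ for all $t\ge0$. -/

import Mathlib

open MeasureTheory Set Filter Topology
open scoped ContDiff

noncomputable section

namespace Herding

/-- The space `ℝ^d` with its Euclidean norm; both the subjective price `x` and the favorability `v`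
live here. -/
abbrev Vec (d : ℕ) : Type := EuclideanSpace ℝ (Fin d)

/-- The standing assumptions on the communication rate `φ : ℝ → ℝ⁺`: smooth, Lipschitz,
nonnegative, even, and nonincreasing on `[0, ∞)`. -/
structure IsCommunicationRate (φ : ℝ → ℝ) : Prop where
  smooth : ContDiff ℝ ∞ φ
  lipschitz : ∃ K : NNReal, LipschitzWith K φ
  nonneg : ∀ r, 0 ≤ φ r
  even : ∀ r, φ r = φ (-r)
  monotone_cond : ∀ r s, 0 ≤ r → 0 ≤ s → (φ r - φ s) * (r - s) ≤ 0

/-- `Q₁(g)(x) = ∫ (x* - x) g(x*,v*) dx* dv*`. -/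
def force₁ {d : ℕ} (g : Vec d → Vec d → ℝ) (x : Vec d) : Vec d :=
  ∫ z : Vec d × Vec d, g z.1 z.2 • (z.1 - x)

/-- `Q₂(g)(x) = ∫ φ(|x - x*|) (x* - x) g(x*,v*) dx* dv*`. -/
def force₂ {d : ℕ} (φ : ℝ → ℝ) (g : Vec d → Vec d → ℝ) (x : Vec d) : Vec d :=
  ∫ z : Vec d × Vec d, (φ ‖x - z.1‖ * g z.1 z.2) • (z.1 - x)

/-- `Q₃(g)(x,v) = ∫ φ(|x - x*|) (v* - v) g(x*,v*) dx* dv*`. -/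
def force₃ {d : ℕ} (φ : ℝ → ℝ) (g : Vec d → Vec d → ℝ) (x v : Vec d) : Vec d :=
  ∫ z : Vec d × Vec d, (φ ‖x - z.1‖ * g z.1 z.2) • (z.2 - v)

/-- The nonlocal herding force `Q(g) = λ_w Q₁(g) + λ_x Q₂(g) + λ_v Q₃(g)` of a phase space
density `g`. -/
def force {d : ℕ} (lamX lamV lamW : ℝ) (φ : ℝ → ℝ) (g : Vec d → Vec d → ℝ) (x v : Vec d) :
    Vec d :=
  lamW • force₁ g x + lamX • force₂ φ g x + lamV • force₃ φ g x v

/-- The divergence `∑ i, ∂_i F_i` of a vector field on `ℝ^d`. -/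
def divergence {d : ℕ} (F : Vec d → Vec d) (v : Vec d) : ℝ :=
  ∑ i : Fin d, (fderiv ℝ F v (EuclideanSpace.single i 1)) i

/-- The time interval `[0, T)`, for `T ∈ (0, ∞]`. -/
def timeInterval (T : EReal) : Set ℝ := {t : ℝ | 0 ≤ t ∧ (t : EReal) < T}

/-- `f = f(x,v,t)` is a classical solution on `[0, T)`, `0 < T ≤ ∞`, of the Cauchy problem
`∂ₜ f + v · ∇ₓ f + ∇ᵥ · (Q(f) f) = 0`, `f(·,·,0) = f₀`.
The time derivative is one-sided at `t = 0`. The moments of order at most two, which enter the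
force and all the functionals below, exist and are bounded locally uniformly in time. -/
structure IsClassicalSolution {d : ℕ} (lamX lamV lamW : ℝ) (φ : ℝ → ℝ)
    (f₀ : Vec d → Vec d → ℝ) (T : EReal) (f : Vec d → Vec d → ℝ → ℝ) : Prop where
  contDiffOn : ContDiffOn ℝ 1 (fun p : (Vec d × Vec d) × ℝ => f p.1.1 p.1.2 p.2)
    (univ ×ˢ timeInterval T)
  integrable : ∀ t ∈ timeInterval T,
    Integrable (fun z : Vec d × Vec d => (1 + ‖z.1‖ ^ 2 + ‖z.2‖ ^ 2) * f z.1 z.2 t)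
  moments_bounded : ∀ b ∈ timeInterval T, ∃ B : ℝ, ∀ t ∈ timeInterval T, t ≤ b →
    ∫ z : Vec d × Vec d, (1 + ‖z.1‖ ^ 2 + ‖z.2‖ ^ 2) * |f z.1 z.2 t| ≤ B
  equation : ∀ t ∈ timeInterval T, ∀ x v : Vec d,
    derivWithin (fun s => f x v s) (timeInterval T) t
      + fderiv ℝ (fun y => f y v t) x v
      + divergence (fun w => f x w t • force lamX lamV lamW φ (fun y u => f y u t) x w) v = 0
  initial : ∀ x v : Vec d, f x v 0 = f₀ x v

/-- A nonnegative density of total mass one. -/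
def IsProbDensity {d : ℕ} (g : Vec d → Vec d → ℝ) : Prop :=
  (∀ x v, 0 ≤ g x v) ∧ ∫ z : Vec d × Vec d, g z.1 z.2 = 1

/-- The mean subjective price `x_c = ∫ x g dx dv`. -/
def meanX {d : ℕ} (g : Vec d → Vec d → ℝ) : Vec d :=
  ∫ z : Vec d × Vec d, g z.1 z.2 • z.1

/-- The mean favorability `v_c = ∫ v g dx dv`. -/
def meanV {d : ℕ} (g : Vec d → Vec d → ℝ) : Vec d :=
  ∫ z : Vec d × Vec d, g z.1 z.2 • z.2

/-- `X = ∫ |x - x_c|² g dx dv`. -/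
def varX {d : ℕ} (g : Vec d → Vec d → ℝ) : ℝ :=
  ∫ z : Vec d × Vec d, ‖z.1 - meanX g‖ ^ 2 * g z.1 z.2

/-- `V = ∫ |v - v_c|² g dx dv`. -/
def varV {d : ℕ} (g : Vec d → Vec d → ℝ) : ℝ :=
  ∫ z : Vec d × Vec d, ‖z.2 - meanV g‖ ^ 2 * g z.1 z.2

/-- `Φ(r) = (1/2) ∫_0^{r²} φ̃(s) ds`, where `φ̃(s) = φ(√s)`, that is, `φ̃(r²) = φ(r)`. -/
def potential (φ : ℝ → ℝ) (r : ℝ) : ℝ :=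
  (1 / 2) * ∫ s in (0 : ℝ)..(r ^ 2), φ (Real.sqrt s)

/-- `M = ∫∫ Φ(|x - x*|) g(x,v) g(x*,v*) dx dv dx* dv*`. -/
def potentialEnergy {d : ℕ} (φ : ℝ → ℝ) (g : Vec d → Vec d → ℝ) : ℝ :=
  ∫ p : (Vec d × Vec d) × (Vec d × Vec d),
    potential φ ‖p.1.1 - p.2.1‖ * g p.1.1 p.1.2 * g p.2.1 p.2.2

/-- The herding energy `E = λ_w X + V + λ_x M`. -/
def herdingEnergy {d : ℕ} (lamX lamW : ℝ) (φ : ℝ → ℝ) (g : Vec d → Vec d → ℝ) : ℝ :=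
  lamW * varX g + varV g + lamX * potentialEnergy φ g

/-- The condition on the parameters under which the herding is exponentially fast. -/
def ParameterCondition (lamX lamV lamW φm φM : ℝ) : Prop :=
  φM * lamX ^ 2 / (φm * lamW * lamV ^ 2) < 1 / 2 * min 1 φM

end Herding

end

/-!
The equation transports the density along the characteristics of the field `(v, Q(f))`, and `Q(f)`
is affine in `v`: `Q(f)(x, v) = A(x) - r(x) v`, so the field has divergence `-d r(x)`.

*Existence.* Agents of weight `f₀ a` are labelled by their initial positions `a` in the compact
support of `f₀`, and their motion `t ↦ Z t a` solves an ordinary differential equation in the Banach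
space of continuous maps from the labels to phase space, whose field is locally Lipschitz and of
linear growth (`Model.isGlobalField_meanField`). Averages over the configuration `Z` define
coefficients `A`, `r` which are jointly `C¹`, so their flow is `C¹`
(`Model.exists_isTransportFlow_meanField`). The datum transported along this flow is the
push-forward of `f₀` (`integral_transported_smul`); hence its force is the one that defines the
flow, and it solves the equation (`exists_isLagrangianSolution`).

*Uniqueness.* For a classical solution only the second moments are controlled. Testing `f²` with a
cutoff that is nonincreasing along the characteristics shows that the support stays bounded on
compact time intervals (`IsDensitySolution.exists_eq_zero`). On this support the difference of the
forces of two solutions is bounded by the `L²` distance of the solutions, and Grönwall's inequality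
applies (`IsDensitySolution.eq_of_initial`). Neither step needs the coefficients of the unknown
solution to be differentiable, since the divergence in `v` is explicit
(`integral_fderiv_phase_field`).

*Herding.* The antisymmetry of the interaction turns the derivatives of `X`, `V`, `M` and of the
covariance `P = ∫ ⟨x - x_c, v - v_c⟩ f` into double averages of relative quantities
(`energyBalance`). In particular `E' = -λ_v ∬ φ |v - v*|² f f* ≤ 0`. If `φ` is bounded below by a
positive constant, `E + ε P` is equivalent to `X + V` and decays exponentially for small `ε`
(`exists_rate_of_bounds`). The resulting constant involves `φ_M` through `M(0) ≤ φ_M X(0)`, which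
is harmless if `λ_x φ_M ≤ λ_w`. Otherwise the condition on the parameters makes
`λ_w X + V + 2 (λ_x / λ_v) P` a Lyapunov functional, in which no potential energy appears
(`exists_rate_of_parameterCondition`).
-/

namespace Herding

open Metric

/-! ### Ordinary differential equations: global existence and smooth dependence -/

section Cutoff

variable {E : Type*} [NormedAddCommGroup E]

/-- A Lipschitz cutoff, equal to one on the ball of radius `R` and to zero off the ball of radius
`R + 1`. -/
noncomputable def ballCutoff (R : ℝ) (x : E) : ℝ := max 0 (min 1 (R + 1 - ‖x‖))

lemma ballCutoff_nonneg (R : ℝ) (x : E) : 0 ≤ ballCutoff R x := le_max_left _ _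

lemma ballCutoff_le_one (R : ℝ) (x : E) : ballCutoff R x ≤ 1 := by
  simp [ballCutoff]

lemma ballCutoff_eq_one {R : ℝ} {x : E} (h : ‖x‖ ≤ R) : ballCutoff R x = 1 := by
  have : (1 : ℝ) ≤ R + 1 - ‖x‖ := by linarith
  simp [ballCutoff, min_eq_left this]

lemma ballCutoff_eq_zero {R : ℝ} {x : E} (h : R + 1 ≤ ‖x‖) : ballCutoff R x = 0 := by
  have : R + 1 - ‖x‖ ≤ 0 := by linarith
  simp [ballCutoff, this]

lemma abs_ballCutoff_sub_le (R : ℝ) (x y : E) : |ballCutoff R x - ballCutoff R y| ≤ ‖x - y‖ := by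
  have h1 := abs_max_sub_max_le_abs (min 1 (R + 1 - ‖x‖)) (min 1 (R + 1 - ‖y‖)) 0
  have h2 := abs_min_sub_min_le_max 1 (R + 1 - ‖x‖) 1 (R + 1 - ‖y‖)
  have h3 : |R + 1 - ‖x‖ - (R + 1 - ‖y‖)| ≤ ‖x - y‖ := by
    have := abs_norm_sub_norm_le x y
    rw [show R + 1 - ‖x‖ - (R + 1 - ‖y‖) = -(‖x‖ - ‖y‖) by ring, abs_neg]; exact this
  have h4 : |(1 : ℝ) - 1| ≤ ‖x - y‖ := by simp
  simp only [ballCutoff]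
  rw [max_comm 0, max_comm 0]
  exact h1.trans (h2.trans (max_le h4 h3))

end Cutoff

section ODE

variable {E : Type*} [NormedAddCommGroup E] [NormedSpace ℝ E]

lemma norm_le_mul_exp_of_norm_deriv_le_right {u u' : ℝ → E} {T K ε : ℝ} (hK : 0 ≤ K) (hε : 0 ≤ ε)
    (hu : ∀ t ∈ Icc 0 T, HasDerivAt u (u' t) t)
    (hb : ∀ t ∈ Icc 0 T, ‖u' t‖ ≤ K * ‖u t‖ + ε) {t : ℝ} (ht : t ∈ Icc 0 T) :
    ‖u t‖ ≤ (‖u 0‖ + ε * T) * Real.exp (K * T) := by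
  have h1 := norm_le_gronwallBound_of_norm_deriv_right_le (f := u) (f' := u') (δ := ‖u 0‖)
    (K := K) (ε := ε) (a := 0) (b := T)
    (fun s hs => (hu s hs).continuousAt.continuousWithinAt)
    (fun s hs => (hu s ⟨hs.1, hs.2.le⟩).hasDerivWithinAt) le_rfl
    (fun s hs => hb s ⟨hs.1, hs.2.le⟩) t ht
  have hT : 0 ≤ T := ht.1.trans ht.2
  refine h1.trans ((gronwallBound_mono (norm_nonneg _) hε hK
    (by linarith [ht.2] : t - 0 ≤ T)).trans ?_)
  rcases eq_or_ne K 0 with rfl | hK0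
  · simp [gronwallBound_K0]
  · rw [gronwallBound_of_K_ne_0 hK0]
    have hKp : 0 < K := lt_of_le_of_ne hK (Ne.symm hK0)
    -- `e^y - 1 ≤ y e^y`, which is `1 - y ≤ e^{-y}` multiplied by `e^y`
    have h2 : Real.exp (K * T) - 1 ≤ K * T * Real.exp (K * T) := by
      have h3 := Real.add_one_le_exp (-(K * T))
      have h4 : Real.exp (-(K * T)) * Real.exp (K * T) = 1 := by
        rw [← Real.exp_add]; simp
      nlinarith [Real.exp_pos (K * T)]
    have h3 : ε / K * (Real.exp (K * T) - 1) ≤ ε * T * Real.exp (K * T) := by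
      calc ε / K * (Real.exp (K * T) - 1) ≤ ε / K * (K * T * Real.exp (K * T)) := by gcongr
        _ = ε * T * Real.exp (K * T) := by field_simp
    linarith

/-- Grönwall's inequality on a two-sided interval around `t₀`. -/
lemma norm_le_mul_exp_of_norm_deriv_le {u u' : ℝ → E} {t₀ T K ε : ℝ} (hK : 0 ≤ K) (hε : 0 ≤ ε)
    (hu : ∀ t, |t - t₀| ≤ T → HasDerivAt u (u' t) t)
    (hb : ∀ t, |t - t₀| ≤ T → ‖u' t‖ ≤ K * ‖u t‖ + ε) {t : ℝ} (ht : |t - t₀| ≤ T) :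
    ‖u t‖ ≤ (‖u t₀‖ + ε * T) * Real.exp (K * T) := by
  rcases le_total t₀ t with h | h
  · have := norm_le_mul_exp_of_norm_deriv_le_right (u := fun s => u (s + t₀))
      (u' := fun s => u' (s + t₀)) (T := T) hK hε
      (fun s hs => (hu (s + t₀) (by simpa [abs_of_nonneg hs.1] using hs.2)).comp_add_const s t₀)
      (fun s hs => hb (s + t₀) (by simpa [abs_of_nonneg hs.1] using hs.2))
      (t := t - t₀) ⟨by linarith, (le_abs_self _).trans ht⟩
    simpa using this
  · have := norm_le_mul_exp_of_norm_deriv_le_right (u := fun s => u (t₀ - s))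
      (u' := fun s => - u' (t₀ - s)) (T := T) hK hε
      (fun s hs => by
        have h1 := (hu (t₀ - s) (by simpa [abs_of_nonneg hs.1] using hs.2))
        have h2 := HasDerivAt.scomp s h1 ((hasDerivAt_id s).const_sub t₀)
        rw [neg_one_smul] at h2
        exact h2)
      (fun s hs => by
        rw [norm_neg]; exact hb (t₀ - s) (by simpa [abs_of_nonneg hs.1] using hs.2))
      (t := t₀ - t) ⟨by linarith, by
        have := neg_abs_le (t - t₀); linarith⟩
    simpa using this

/-- A time-dependent vector field which is Lipschitz on bounded sets and grows at most linearly,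
both locally uniformly in time. -/
structure IsGlobalField (F : ℝ → E → E) : Prop where
  continuous_time : ∀ x, Continuous fun t => F t x
  lipschitz : ∀ T R : ℝ, ∃ L : NNReal, ∀ t, |t| ≤ T → LipschitzOnWith L (F t) (closedBall 0 R)
  growth : ∀ T : ℝ, ∃ C : ℝ, 0 ≤ C ∧ ∀ t, |t| ≤ T → ∀ x, ‖F t x‖ ≤ C * (1 + ‖x‖)

lemma exists_norm_le_of_hasDerivAt {α α' : ℝ → E} {t₀ T : ℝ}
    (hα : ∀ t, |t - t₀| ≤ T → HasDerivAt α (α' t) t) :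
    ∃ R, ∀ t, |t - t₀| ≤ T → ‖α t‖ ≤ R := by
  have hs : {t : ℝ | |t - t₀| ≤ T} = closedBall t₀ T := by
    ext t; simp [Real.dist_eq]
  have hc : IsCompact {t : ℝ | |t - t₀| ≤ T} := by
    rw [hs]; exact isCompact_closedBall _ _
  obtain ⟨R, hR⟩ := hc.exists_bound_of_continuousOn (f := α)
    (fun t ht => (hα t ht).continuousAt.continuousWithinAt)
  exact ⟨R, hR⟩

lemma IsGlobalField.unique {F : ℝ → E → E} (hF : IsGlobalField F) {α β : ℝ → E} {t₀ T : ℝ}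
    (hα : ∀ t, |t - t₀| ≤ T → HasDerivAt α (F t (α t)) t)
    (hβ : ∀ t, |t - t₀| ≤ T → HasDerivAt β (F t (β t)) t) (h0 : α t₀ = β t₀)
    {t : ℝ} (ht : |t - t₀| ≤ T) : α t = β t := by
  obtain ⟨R₁, hR₁⟩ := exists_norm_le_of_hasDerivAt hα
  obtain ⟨R₂, hR₂⟩ := exists_norm_le_of_hasDerivAt hβ
  obtain ⟨L, hL⟩ := hF.lipschitz (|t₀| + T) (max R₁ R₂)
  have key := norm_le_mul_exp_of_norm_deriv_le (u := fun t => α t - β t)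
    (u' := fun t => F t (α t) - F t (β t)) (t₀ := t₀) (T := T) (K := L) (ε := 0) L.2 le_rfl
    (fun s hs => (hα s hs).sub (hβ s hs))
    (fun s hs => by
      have hs' : |s| ≤ |t₀| + T := by
        calc |s| = |t₀ + (s - t₀)| := by ring_nf
          _ ≤ |t₀| + |s - t₀| := abs_add_le _ _
          _ ≤ _ := by linarith
      have := (hL s hs').dist_le_mul (α s)
        (by simpa using Or.inl (hR₁ s hs)) (β s)
        (by simpa using Or.inr (hR₂ s hs))
      simpa [dist_eq_norm] using this) ht
  simp only [h0, sub_self, norm_zero, zero_mul, add_zero] at key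
  exact sub_eq_zero.1 (norm_le_zero_iff.1 key)

lemma norm_ballCutoff_smul_sub_le {f : E → E} {R M : ℝ} {L : NNReal} (hM : 0 ≤ M)
    (hL : LipschitzOnWith L f (closedBall 0 (R + 1))) (hb : ∀ x, ‖x‖ ≤ R + 1 → ‖f x‖ ≤ M)
    (x y : E) :
    ‖ballCutoff R x • f x - ballCutoff R y • f y‖ ≤ (M + L) * ‖x - y‖ := by
  -- it suffices to treat the case in which `x` lies in the larger ball
  wlog hx : ‖x‖ ≤ R + 1 generalizing x y
  · by_cases hy : ‖y‖ ≤ R + 1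
    · rw [norm_sub_rev, norm_sub_rev x]; exact this y x hy
    · rw [ballCutoff_eq_zero (not_le.1 hx).le, ballCutoff_eq_zero (not_le.1 hy).le]
      simp only [zero_smul, sub_zero, norm_zero]; positivity
  by_cases hy : ‖y‖ ≤ R + 1
  · have h1 : ballCutoff R x • f x - ballCutoff R y • f y
        = (ballCutoff R x - ballCutoff R y) • f x + ballCutoff R y • (f x - f y) := by
      rw [sub_smul, smul_sub]; abel
    have h2 := hL.dist_le_mul x (by simpa using hx) y (by simpa using hy)
    rw [dist_eq_norm, dist_eq_norm] at h2
    rw [h1]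
    refine (norm_add_le _ _).trans ?_
    rw [norm_smul, norm_smul, Real.norm_eq_abs, Real.norm_eq_abs,
      abs_of_nonneg (ballCutoff_nonneg R y)]
    have h3 := mul_le_mul (abs_ballCutoff_sub_le R x y) (hb x hx) (norm_nonneg _) (norm_nonneg _)
    have h4 := mul_le_mul (ballCutoff_le_one R y) h2 (norm_nonneg _) zero_le_one
    linarith
  · have h0 : ballCutoff R y = 0 := ballCutoff_eq_zero (not_le.1 hy).le
    have h1 := abs_ballCutoff_sub_le R x y
    have h3 := mul_le_mul h1 (hb x hx) (norm_nonneg _) (norm_nonneg _)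
    rw [h0, sub_zero] at h3
    rw [h0, zero_smul, sub_zero, norm_smul, Real.norm_eq_abs]
    have : 0 ≤ L * ‖x - y‖ := by positivity
    linarith

variable [CompleteSpace E]

/-- Solutions exist on every bounded time interval: the field, truncated to a large ball, is
globally Lipschitz, and by the a priori bound from linear growth the truncation is not felt. -/
lemma IsGlobalField.exists_solution_on {F : ℝ → E → E} (hF : IsGlobalField F) (t₀ : ℝ) (x₀ : E)
    {T : ℝ} (hT : 0 ≤ T) :
    ∃ α : ℝ → E, α t₀ = x₀ ∧ ∀ t, |t - t₀| ≤ T → HasDerivAt α (F t (α t)) t := by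
  have habs : ∀ t, |t - t₀| ≤ T + 1 → |t| ≤ |t₀| + (T + 1) := fun t ht => by
    calc |t| = |t₀ + (t - t₀)| := by ring_nf
      _ ≤ |t₀| + |t - t₀| := abs_add_le _ _
      _ ≤ _ := by linarith
  obtain ⟨C, hC, hgr⟩ := hF.growth (|t₀| + (T + 1))
  -- the a priori bound for the solution, from Grönwall's inequality
  set R := (‖x₀‖ + C * T) * Real.exp (C * T) with hR
  have hR0 : 0 ≤ R := by positivity
  obtain ⟨L, hL⟩ := hF.lipschitz (|t₀| + (T + 1)) (R + 1)
  set M := C * (1 + (R + 1)) with hM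
  have hM0 : 0 ≤ M := by positivity
  have hFM : ∀ t, |t - t₀| ≤ T + 1 → ∀ x, ‖x‖ ≤ R + 1 → ‖F t x‖ ≤ M := fun t ht x hx =>
    (hgr t (habs t ht) x).trans (by rw [hM]; gcongr)
  set G : ℝ → E → E := fun t x => ballCutoff R x • F t x with hG
  have hmem : ∀ t ∈ Icc (t₀ - (T + 1)) (t₀ + (T + 1)), |t - t₀| ≤ T + 1 := fun t ht => by
    rw [abs_le]; constructor <;> linarith [ht.1, ht.2]
  have hPL : IsPicardLindelof G (tmin := t₀ - (T + 1)) (tmax := t₀ + (T + 1))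
      ⟨t₀, by constructor <;> linarith⟩ x₀ ⟨M * (T + 1), by positivity⟩ 0 ⟨M, hM0⟩
      (⟨M, hM0⟩ + L) := by
    constructor
    · intro t ht
      refine LipschitzOnWith.of_dist_le_mul fun x _ y _ => ?_
      rw [dist_eq_norm, dist_eq_norm]
      exact norm_ballCutoff_smul_sub_le hM0 (hL t (habs t (hmem t ht))) (hFM t (hmem t ht)) x y
    · intro x _
      exact ((hF.continuous_time x).const_smul _).continuousOn
    · intro t ht x _
      change ‖ballCutoff R x • F t x‖ ≤ M
      rw [norm_smul, Real.norm_eq_abs, abs_of_nonneg (ballCutoff_nonneg R x)]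
      by_cases hx : ‖x‖ ≤ R + 1
      · calc ballCutoff R x * ‖F t x‖ ≤ 1 * M := by
              gcongr
              · exact ballCutoff_le_one R x
              · exact hFM t (hmem t ht) x hx
          _ = M := one_mul _
      · rw [ballCutoff_eq_zero (not_le.1 hx).le, zero_mul]; exact hM0
    · simp only [add_sub_cancel_left, sub_sub_cancel, max_self, NNReal.coe_zero, sub_zero]
      exact le_rfl
  obtain ⟨α, hα0, hα⟩ := hPL.exists_eq_forall_mem_Icc_hasDerivWithinAt₀
  have hα' : ∀ t, |t - t₀| ≤ T → HasDerivAt α (G t (α t)) t := fun t ht => by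
    rw [abs_le] at ht
    exact (hα t ⟨by linarith [ht.1], by linarith [ht.2]⟩).hasDerivAt
      (Icc_mem_nhds (by linarith [ht.1]) (by linarith [ht.2]))
  have hαR : ∀ t, |t - t₀| ≤ T → ‖α t‖ ≤ R := fun t ht => by
    have := norm_le_mul_exp_of_norm_deriv_le (K := C) (ε := C) hC hC hα' (fun s hs => by
      rw [hG, norm_smul, Real.norm_eq_abs, abs_of_nonneg (ballCutoff_nonneg R _)]
      calc ballCutoff R (α s) * ‖F s (α s)‖ ≤ 1 * (C * (1 + ‖α s‖)) := by
            gcongr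
            · exact ballCutoff_le_one R _
            · exact hgr s (habs s (by linarith)) _
        _ = C * ‖α s‖ + C := by ring) ht
    have h0 : α t₀ = x₀ := hα0
    rwa [h0] at this
  refine ⟨α, hα0, fun t ht => ?_⟩
  have := hα' t ht
  simpa only [hG, ballCutoff_eq_one (hαR t ht), one_smul] using this

/-- Global existence for a field that is Lipschitz on bounded sets with linear growth. -/
theorem IsGlobalField.exists_solution {F : ℝ → E → E} (hF : IsGlobalField F) (t₀ : ℝ) (x₀ : E) :
    ∃ α : ℝ → E, α t₀ = x₀ ∧ ∀ t, HasDerivAt α (F t (α t)) t := by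
  choose a ha0 ha using fun n : ℕ => hF.exists_solution_on t₀ x₀ (T := n) n.cast_nonneg
  have hag : ∀ (n m : ℕ) t, |t - t₀| ≤ n → |t - t₀| ≤ m → a n t = a m t := by
    intro n m t hn hm
    refine hF.unique (t₀ := t₀) (T := |t - t₀|) (fun s hs => ha n s (hs.trans hn))
      (fun s hs => ha m s (hs.trans hm)) ?_ le_rfl
    rw [ha0, ha0]
  refine ⟨fun t => a ⌈|t - t₀|⌉₊ t, by simp [ha0], fun t => ?_⟩
  obtain ⟨N, hN⟩ := exists_nat_gt |t - t₀|
  have hev : ∀ᶠ s in 𝓝 t, |s - t₀| < N :=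
    (isOpen_lt (by fun_prop) continuous_const).mem_nhds hN
  have heq : (fun t => a ⌈|t - t₀|⌉₊ t) =ᶠ[𝓝 t] a N := by
    filter_upwards [hev] with s hs
    exact hag _ _ s (Nat.le_ceil _) hs.le
  have h1 : F t (a ⌈|t - t₀|⌉₊ t) = F t (a N t) := congrArg (F t) heq.eq_of_nhds
  change HasDerivAt _ (F t (a ⌈|t - t₀|⌉₊ t)) t
  rw [h1]
  exact (ha N t hN.le).congr_of_eventuallyEq heq

end ODE

section Flow

variable {E : Type*} [NormedAddCommGroup E] [NormedSpace ℝ E]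

/-- `Z` is the complete flow of the autonomous field `F`, and it maps bounded sets to bounded
sets, locally uniformly in time. -/
structure IsCompleteFlow (F : E → E) (Z : ℝ → E → E) : Prop where
  zero : ∀ y, Z 0 y = y
  hasDerivAt : ∀ t y, HasDerivAt (fun s => Z s y) (F (Z t y)) t
  bounded : ∀ T R : ℝ, ∃ R', ∀ t y, |t| ≤ T → ‖y‖ ≤ R → ‖Z t y‖ ≤ R'

variable {F : E → E} {Z : ℝ → E → E}

lemma exists_norm_fderiv_le {G : Type*} [NormedAddCommGroup G] [NormedSpace ℝ G]
    [FiniteDimensional ℝ E] {F : E → G} (hF : ContDiff ℝ 1 F) (R : ℝ) :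
    ∃ K : ℝ, 0 ≤ K ∧ ∀ x, ‖x‖ ≤ R → ‖fderiv ℝ F x‖ ≤ K := by
  have : ProperSpace E := FiniteDimensional.proper ℝ E
  obtain ⟨K, hK⟩ := (isCompact_closedBall (0 : E) R).exists_bound_of_continuousOn
    (hF.continuous_fderiv one_ne_zero).continuousOn
  exact ⟨max K 0, le_max_right _ _, fun x hx => (hK x (by simpa using hx)).trans (le_max_left _ _)⟩

/-- On balls, the derivative of a `C¹` map is uniformly continuous and its Taylor remainder is
uniformly small. -/
lemma exists_fderiv_sub_le [FiniteDimensional ℝ E] (hF : ContDiff ℝ 1 F) (R : ℝ) {ε : ℝ}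
    (hε : 0 < ε) : ∃ δ > 0, ∀ x y, ‖x‖ ≤ R → ‖y‖ ≤ R → ‖x - y‖ < δ →
      ‖fderiv ℝ F x - fderiv ℝ F y‖ ≤ ε ∧
      ‖F x - F y - fderiv ℝ F y (x - y)‖ ≤ ε * ‖x - y‖ := by
  have : ProperSpace E := FiniteDimensional.proper ℝ E
  have huc := (isCompact_closedBall (0 : E) R).uniformContinuousOn_of_continuous
    (hF.continuous_fderiv one_ne_zero).continuousOn
  obtain ⟨δ, hδ, h⟩ := Metric.uniformContinuousOn_iff.1 huc ε hε
  have h' : ∀ x y, ‖x‖ ≤ R → ‖y‖ ≤ R → ‖x - y‖ < δ → ‖fderiv ℝ F x - fderiv ℝ F y‖ ≤ ε := by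
    intro x y hx hy hxy
    have := h x (by simpa using hx) y (by simpa using hy) (by simpa [dist_eq_norm] using hxy)
    rw [dist_eq_norm] at this
    exact this.le
  refine ⟨δ, hδ, fun x y hx hy hxy => ⟨h' x y hx hy hxy, ?_⟩⟩
  refine Convex.norm_image_sub_le_of_norm_hasFDerivWithin_le' (𝕜 := ℝ)
    (s := closedBall 0 R ∩ ball y δ) (f' := fderiv ℝ F)
    (fun z _ => (hF.differentiable one_ne_zero z).hasFDerivAt.hasFDerivWithinAt)
    (fun z hz => h' z y (by simpa using hz.1) hy (by simpa [dist_eq_norm] using hz.2))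
    ((convex_closedBall _ _).inter (convex_ball _ _))
    ⟨by simpa using hy, mem_ball_self hδ⟩ ⟨by simpa using hx, by simpa [dist_eq_norm] using hxy⟩

lemma norm_sub_le_of_norm_fderiv_le {G : Type*} [NormedAddCommGroup G] [NormedSpace ℝ G]
    {F : E → G} (hF : ContDiff ℝ 1 F) {R K : ℝ}
    (hK : ∀ x, ‖x‖ ≤ R → ‖fderiv ℝ F x‖ ≤ K) {x y : E} (hx : ‖x‖ ≤ R) (hy : ‖y‖ ≤ R) :
    ‖F x - F y‖ ≤ K * ‖x - y‖ :=
  Convex.norm_image_sub_le_of_norm_hasFDerivWithin_le (𝕜 := ℝ)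
    (s := closedBall 0 R) (f' := fderiv ℝ F)
    (fun z _ => (hF.differentiable one_ne_zero z).hasFDerivAt.hasFDerivWithinAt)
    (fun z hz => hK z (by simpa using hz)) (convex_closedBall _ _)
    (by simpa using hy) (by simpa using hx)

variable [FiniteDimensional ℝ E]

lemma IsCompleteFlow.exists_lipschitz (hZ : IsCompleteFlow F Z) (hF : ContDiff ℝ 1 F) (T R : ℝ) :
    ∃ C : ℝ, 0 ≤ C ∧ ∀ t y y', |t| ≤ T → ‖y‖ ≤ R → ‖y'‖ ≤ R →
      ‖Z t y - Z t y'‖ ≤ C * ‖y - y'‖ := by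
  obtain ⟨R', hR'⟩ := hZ.bounded T R
  obtain ⟨K, hK0, hK⟩ := exists_norm_fderiv_le hF R'
  refine ⟨Real.exp (K * T), (Real.exp_pos _).le, fun t y y' ht hy hy' => ?_⟩
  have := norm_le_mul_exp_of_norm_deriv_le (u := fun s => Z s y - Z s y') (t₀ := 0) (T := T)
    hK0 le_rfl (fun s _ => (hZ.hasDerivAt s y).sub (hZ.hasDerivAt s y'))
    (fun s hs => by
      rw [sub_zero] at hs
      simpa using norm_sub_le_of_norm_fderiv_le hF hK (hR' s y hs hy) (hR' s y' hs hy'))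
    (t := t) (by simpa using ht)
  simpa [hZ.zero, mul_comm] using this

lemma IsCompleteFlow.continuous (hZ : IsCompleteFlow F Z) (hF : ContDiff ℝ 1 F) :
    Continuous fun p : ℝ × E => Z p.1 p.2 := by
  rw [continuous_iff_continuousAt]
  rintro ⟨t, y⟩
  obtain ⟨C, hC, hL⟩ := hZ.exists_lipschitz hF (|t| + 1) (‖y‖ + 1)
  have h1 : Tendsto (fun p : ℝ × E => Z p.1 y) (𝓝 (t, y)) (𝓝 (Z t y)) :=
    ((hZ.hasDerivAt t y).continuousAt.tendsto).comp continuousAt_fst.tendsto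
  have h2 : Tendsto (fun p : ℝ × E => Z p.1 p.2 - Z p.1 y) (𝓝 (t, y)) (𝓝 0) := by
    have h3 : Tendsto (fun p : ℝ × E => C * ‖p.2 - y‖) (𝓝 (t, y)) (𝓝 0) := by
      have : Continuous fun p : ℝ × E => C * ‖p.2 - y‖ := by fun_prop
      simpa using this.tendsto (t, y)
    refine squeeze_zero_norm' ?_ h3
    have e1 : ∀ᶠ p : ℝ × E in 𝓝 (t, y), |p.1| < |t| + 1 :=
      (isOpen_lt (by fun_prop) continuous_const).mem_nhds (by simp)
    have e2 : ∀ᶠ p : ℝ × E in 𝓝 (t, y), ‖p.2‖ < ‖y‖ + 1 :=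
      (isOpen_lt (by fun_prop) continuous_const).mem_nhds (by simp)
    filter_upwards [e1, e2] with p hp1 hp2
    exact hL p.1 p.2 y hp1.le hp2.le (by linarith)
  have h4 := h2.add h1
  simp only [sub_add_cancel, zero_add] at h4
  exact h4

/-- The field of the equation of variations along a trajectory. -/
lemma isGlobalField_linearized (hZ : IsCompleteFlow F Z) (hF : ContDiff ℝ 1 F) (y : E) :
    IsGlobalField fun (t : ℝ) (A : E →L[ℝ] E) => (fderiv ℝ F (Z t y)).comp A := by
  have hb : ∀ T : ℝ, ∃ K : ℝ, 0 ≤ K ∧ ∀ t, |t| ≤ T → ‖fderiv ℝ F (Z t y)‖ ≤ K := fun T => by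
    obtain ⟨R', hR'⟩ := hZ.bounded T ‖y‖
    obtain ⟨K, hK0, hK⟩ := exists_norm_fderiv_le hF R'
    exact ⟨K, hK0, fun t ht => hK _ (hR' t y ht le_rfl)⟩
  constructor
  · intro A
    have h1 : Continuous fun t => fderiv ℝ F (Z t y) :=
      (hF.continuous_fderiv one_ne_zero).comp
        (continuous_iff_continuousAt.2 fun t => (hZ.hasDerivAt t y).continuousAt)
    exact h1.clm_comp continuous_const
  · intro T R
    obtain ⟨K, hK0, hK⟩ := hb T
    refine ⟨⟨K, hK0⟩, fun t ht => LipschitzOnWith.of_dist_le_mul fun A _ B _ => ?_⟩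
    rw [dist_eq_norm, dist_eq_norm, ← ContinuousLinearMap.comp_sub]
    exact (ContinuousLinearMap.opNorm_comp_le _ _).trans
      (mul_le_mul_of_nonneg_right (hK t ht) (norm_nonneg _))
  · intro T
    obtain ⟨K, hK0, hK⟩ := hb T
    refine ⟨K, hK0, fun t ht A => (ContinuousLinearMap.opNorm_comp_le _ _).trans ?_⟩
    exact mul_le_mul (hK t ht) (by linarith) (norm_nonneg _) hK0

/-- The flow of a `C¹` field is `C¹` in time and initial value together: its derivative in the
initial value solves the linearized equation. -/
theorem IsCompleteFlow.contDiff (hZ : IsCompleteFlow F Z) (hF : ContDiff ℝ 1 F) :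
    ContDiff ℝ 1 fun p : ℝ × E => Z p.1 p.2 := by
  choose A hA0 hA using fun y : E =>
    (isGlobalField_linearized hZ hF y).exists_solution 0 (ContinuousLinearMap.id ℝ E)
  have hAb : ∀ T R : ℝ, 0 ≤ T → ∃ B : ℝ, 0 ≤ B ∧ ∀ t y, |t| ≤ T → ‖y‖ ≤ R → ‖A y t‖ ≤ B := by
    intro T R hT
    obtain ⟨R', hR'⟩ := hZ.bounded T R
    obtain ⟨K, hK0, hK⟩ := exists_norm_fderiv_le hF R'
    refine ⟨(‖ContinuousLinearMap.id ℝ E‖ + 0 * T) * Real.exp (K * T), by positivity,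
      fun t y ht hy => ?_⟩
    have := norm_le_mul_exp_of_norm_deriv_le (u := A y) (t₀ := 0) (T := T) hK0 le_rfl
      (fun s _ => hA y s) (fun s hs => by
        rw [add_zero]
        rw [sub_zero] at hs
        exact (ContinuousLinearMap.opNorm_comp_le _ _).trans
          (mul_le_mul_of_nonneg_right (hK _ (hR' s y hs hy)) (norm_nonneg _)))
      (t := t) (by simpa using ht)
    rwa [hA0] at this
  -- differentiability in the initial value
  have hder : ∀ t y, HasFDerivAt (fun z => Z t z) (A y t) y := by
    intro t y
    obtain ⟨C, hC, hL⟩ := hZ.exists_lipschitz hF |t| (‖y‖ + 1)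
    obtain ⟨R', hR'⟩ := hZ.bounded |t| (‖y‖ + 1)
    obtain ⟨K, hK0, hK⟩ := exists_norm_fderiv_le hF R'
    rw [hasFDerivAt_iff_isLittleO, Asymptotics.isLittleO_iff]
    intro c hc
    set Q := C * |t| * Real.exp (K * |t|) with hQ
    have hQ0 : 0 ≤ Q := by positivity
    obtain ⟨δ, hδ, hδ'⟩ := exists_fderiv_sub_le hF R' (ε := c / (Q + 1)) (by positivity)
    have e1 : ∀ᶠ y' in 𝓝 y, ‖y'‖ < ‖y‖ + 1 :=
      (isOpen_lt (by fun_prop) continuous_const).mem_nhds (by simp)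
    have e2 : ∀ᶠ y' in 𝓝 y, C * ‖y' - y‖ < δ :=
      (isOpen_lt (by fun_prop) continuous_const).mem_nhds (by simpa using hδ)
    filter_upwards [e1, e2] with y' hy1 hy2
    have key := norm_le_mul_exp_of_norm_deriv_le
      (u := fun s => Z s y' - Z s y - A y s (y' - y))
      (u' := fun s => F (Z s y') - F (Z s y) - (fderiv ℝ F (Z s y)).comp (A y s) (y' - y))
      (t₀ := 0) (T := |t|) (K := K) (ε := c / (Q + 1) * (C * ‖y' - y‖)) hK0 (by positivity)
      (fun s _ => ((hZ.hasDerivAt s y').sub (hZ.hasDerivAt s y)).sub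
        ((hA y s).clm_apply (hasDerivAt_const s (y' - y)) |>.congr_deriv (by simp)))
      (fun s hs => by
        rw [sub_zero] at hs
        have b1 := hR' s y hs (by linarith)
        have b2 := hR' s y' hs hy1.le
        have b3 := hL s y' y hs hy1.le (by linarith)
        have b4 := (hδ' _ _ b2 b1 (b3.trans_lt hy2)).2
        have e : F (Z s y') - F (Z s y) - (fderiv ℝ F (Z s y)).comp (A y s) (y' - y)
            = fderiv ℝ F (Z s y) (Z s y' - Z s y - A y s (y' - y))
              + (F (Z s y') - F (Z s y) - fderiv ℝ F (Z s y) (Z s y' - Z s y)) := by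
          rw [map_sub _ (Z s y' - Z s y) (A y s (y' - y))]
          simp only [ContinuousLinearMap.comp_apply]
          abel
        rw [e]
        refine (norm_add_le _ _).trans (add_le_add ?_ (b4.trans ?_))
        · exact (ContinuousLinearMap.le_opNorm _ _).trans
            (mul_le_mul_of_nonneg_right (hK _ b1) (norm_nonneg _))
        · gcongr)
      (t := t) (by simp)
    simp only [hZ.zero, hA0, ContinuousLinearMap.id_apply, sub_self, norm_zero, zero_add] at key
    refine key.trans ?_
    have : c / (Q + 1) * (C * ‖y' - y‖) * |t| * Real.exp (K * |t|)
        = c * (Q / (Q + 1)) * ‖y' - y‖ := by rw [hQ]; ring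
    rw [this]
    have hq : Q / (Q + 1) ≤ 1 := by rw [div_le_one (by positivity)]; linarith
    have : c * (Q / (Q + 1)) ≤ c := by nlinarith
    exact mul_le_mul_of_nonneg_right this (norm_nonneg _)
  -- joint continuity of the derivative
  have hcont : Continuous fun p : ℝ × E => A p.2 p.1 := by
    rw [continuous_iff_continuousAt]
    rintro ⟨t, y⟩
    have h1 : Tendsto (fun p : ℝ × E => A y p.1) (𝓝 (t, y)) (𝓝 (A y t)) :=
      ((hA y t).continuousAt.tendsto).comp continuousAt_fst.tendsto
    have h2 : Tendsto (fun p : ℝ × E => A p.2 p.1 - A y p.1) (𝓝 (t, y)) (𝓝 0) := by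
      rw [tendsto_zero_iff_norm_tendsto_zero, Metric.tendsto_nhds]
      intro c hc
      have hT : 0 ≤ |t| + 1 := by positivity
      obtain ⟨C, hC, hL⟩ := hZ.exists_lipschitz hF (|t| + 1) (‖y‖ + 1)
      obtain ⟨R', hR'⟩ := hZ.bounded (|t| + 1) (‖y‖ + 1)
      obtain ⟨K, hK0, hK⟩ := exists_norm_fderiv_le hF R'
      obtain ⟨B, hB0, hB⟩ := hAb (|t| + 1) (‖y‖ + 1) hT
      set Q := B * (|t| + 1) * Real.exp (K * (|t| + 1)) with hQ
      have hQ0 : 0 ≤ Q := by positivity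
      obtain ⟨δ, hδ, hδ'⟩ := exists_fderiv_sub_le hF R' (ε := c / (Q + 1)) (by positivity)
      have e1 : ∀ᶠ p : ℝ × E in 𝓝 (t, y), |p.1| < |t| + 1 :=
        (isOpen_lt (by fun_prop) continuous_const).mem_nhds (by simp)
      have e2 : ∀ᶠ p : ℝ × E in 𝓝 (t, y), ‖p.2‖ < ‖y‖ + 1 :=
        (isOpen_lt (by fun_prop) continuous_const).mem_nhds (by simp)
      have e3 : ∀ᶠ p : ℝ × E in 𝓝 (t, y), C * ‖p.2 - y‖ < δ :=
        (isOpen_lt (by fun_prop) continuous_const).mem_nhds (by simpa using hδ)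
      filter_upwards [e1, e2, e3] with p hp1 hp2 hp3
      have key := norm_le_mul_exp_of_norm_deriv_le
        (u := fun s => A p.2 s - A y s) (t₀ := 0) (T := |t| + 1) (K := K)
        (ε := c / (Q + 1) * B) hK0 (by positivity)
        (fun s _ => (hA p.2 s).sub (hA y s))
        (fun s hs => by
          rw [sub_zero] at hs
          have b1 := hR' s y hs (by linarith)
          have b2 := hR' s p.2 hs hp2.le
          have b3 := hL s p.2 y hs hp2.le (by linarith)
          have b4 := (hδ' _ _ b2 b1 (b3.trans_lt hp3)).1
          have e : (fderiv ℝ F (Z s p.2)).comp (A p.2 s) - (fderiv ℝ F (Z s y)).comp (A y s)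
              = (fderiv ℝ F (Z s p.2)).comp (A p.2 s - A y s)
                + (fderiv ℝ F (Z s p.2) - fderiv ℝ F (Z s y)).comp (A y s) := by
            rw [ContinuousLinearMap.comp_sub, ContinuousLinearMap.sub_comp]; abel
          rw [e]
          refine (norm_add_le _ _).trans (add_le_add ?_ ?_)
          · exact (ContinuousLinearMap.opNorm_comp_le _ _).trans
              (mul_le_mul_of_nonneg_right (hK _ b2) (norm_nonneg _))
          · exact (ContinuousLinearMap.opNorm_comp_le _ _).trans
              (mul_le_mul b4 (hB s y hs (by linarith)) (norm_nonneg _) (by positivity)))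
        (t := p.1) (by simpa using hp1.le)
      simp only [hA0, sub_self, norm_zero, zero_add] at key
      rw [Real.dist_eq, sub_zero, abs_norm]
      refine key.trans_lt ?_
      have : c / (Q + 1) * B * (|t| + 1) * Real.exp (K * (|t| + 1)) = c * (Q / (Q + 1)) := by
        rw [hQ]; ring
      rw [this]
      have hq : Q / (Q + 1) < 1 := by rw [div_lt_one (by positivity)]; linarith
      nlinarith
    have h4 := h2.add h1
    simp only [sub_add_cancel, zero_add] at h4
    exact h4
  have hZc := hZ.continuous hF
  have hc1 : Continuous fun p : ℝ × E =>
      ContinuousLinearMap.toSpanSingleton ℝ (F (Z p.1 p.2)) :=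
    (ContinuousLinearMap.toSpanSingletonCLE (𝕜 := ℝ) (E := E)).continuous.comp
      (hF.continuous.comp hZc)
  rw [contDiff_one_iff_hasFDerivAt]
  refine ⟨fun p => (ContinuousLinearMap.toSpanSingleton ℝ (F (Z p.1 p.2))).coprod (A p.2 p.1),
    ?_, fun p => ?_⟩
  · have e : (fun p : ℝ × E =>
        (ContinuousLinearMap.toSpanSingleton ℝ (F (Z p.1 p.2))).coprod (A p.2 p.1)) = fun p =>
        (ContinuousLinearMap.toSpanSingleton ℝ (F (Z p.1 p.2))).comp
          (ContinuousLinearMap.fst ℝ ℝ E)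
        + (A p.2 p.1).comp (ContinuousLinearMap.snd ℝ ℝ E) := by
      funext p; ext <;> simp
    rw [e]
    exact (hc1.clm_comp continuous_const).add (hcont.clm_comp continuous_const)
  · have := hasStrictFDerivAt_uncurry_coprod (𝕜 := ℝ) (u := p) (f := Z)
      (f₁ := fun t y => ContinuousLinearMap.toSpanSingleton ℝ (F (Z t y)))
      (f₂ := fun t y => A y t)
      (Eventually.of_forall fun q => (hZ.hasDerivAt q.1 q.2).hasFDerivAt)
      (Eventually.of_forall fun q => hder q.1 q.2)
      hc1.continuousAt hcont.continuousAt
    exact this.hasFDerivAt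

end Flow

/-! ### Integrals depending on a parameter -/

section Parametric

variable {P Ω G : Type*} [NormedAddCommGroup P] [NormedSpace ℝ P] [FiniteDimensional ℝ P]
  [TopologicalSpace Ω] [CompactSpace Ω] [SecondCountableTopology Ω] [MeasurableSpace Ω]
  [OpensMeasurableSpace Ω] [NormedAddCommGroup G] [NormedSpace ℝ G]
  {ν : Measure Ω} [IsFiniteMeasure ν]

lemma integrable_of_continuous {Ω G : Type*} [TopologicalSpace Ω] [CompactSpace Ω]
    [MeasurableSpace Ω] [OpensMeasurableSpace Ω] [NormedAddCommGroup G]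
    [SecondCountableTopologyEither Ω G] {ν : Measure Ω} [IsFiniteMeasure ν] {h : Ω → G}
    (hh : Continuous h) : Integrable h ν := by
  rw [← integrableOn_univ]
  exact hh.continuousOn.integrableOn_compact' isCompact_univ MeasurableSet.univ

lemma continuous_integral_of_compactSpace {X : Type*} [TopologicalSpace X]
    [FirstCountableTopology X] [LocallyCompactSpace X] {h : X → Ω → G}
    (hh : Continuous fun q : X × Ω => h q.1 q.2) : Continuous fun p => ∫ a, h p a ∂ν := by
  have := continuous_parametric_integral_of_continuous (μ := ν) (f := h) hh
    (isCompact_univ (X := Ω))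
  simpa using this

lemma hasFDerivAt_integral_of_compactSpace {h : P → Ω → G} {h' : P → Ω → P →L[ℝ] G}
    (hh : ∀ p, Continuous (h p)) (hh' : Continuous fun q : P × Ω => h' q.1 q.2)
    (hd : ∀ p a, HasFDerivAt (fun p => h p a) (h' p a) p) (p : P) :
    HasFDerivAt (fun p => ∫ a, h p a ∂ν) (∫ a, h' p a ∂ν) p := by
  have : ProperSpace P := FiniteDimensional.proper ℝ P
  obtain ⟨B, hB⟩ := ((isCompact_closedBall p 1).prod
    (isCompact_univ (X := Ω))).exists_bound_of_continuousOn hh'.continuousOn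
  refine hasFDerivAt_integral_of_dominated_of_fderiv_le (closedBall_mem_nhds p one_pos)
    (Eventually.of_forall fun p => (hh p).aestronglyMeasurable) (integrable_of_continuous (hh p))
    (F' := h') (bound := fun _ => B) ?_ ?_ (integrable_const _) ?_
  · exact Continuous.aestronglyMeasurable (by fun_prop)
  · exact Eventually.of_forall fun a q hq => hB (q, a) ⟨hq, mem_univ _⟩
  · exact Eventually.of_forall fun a q _ => hd q a

lemma contDiff_integral_of_compactSpace {h : P → Ω → G} {h' : P → Ω → P →L[ℝ] G}
    (hh : ∀ p, Continuous (h p)) (hh' : Continuous fun q : P × Ω => h' q.1 q.2)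
    (hd : ∀ p a, HasFDerivAt (fun p => h p a) (h' p a) p) :
    ContDiff ℝ 1 fun p => ∫ a, h p a ∂ν := by
  have : ProperSpace P := FiniteDimensional.proper ℝ P
  exact contDiff_one_iff_hasFDerivAt.2 ⟨_, continuous_integral_of_compactSpace hh',
    hasFDerivAt_integral_of_compactSpace hh hh' hd⟩

lemma hasDerivAt_integral_of_compactSpace {h h' : ℝ → Ω → G}
    (hh : ∀ p, Continuous (h p)) (hh' : Continuous fun q : ℝ × Ω => h' q.1 q.2)
    (hd : ∀ p a, HasDerivAt (fun p => h p a) (h' p a) p) (p : ℝ) :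
    HasDerivAt (fun p => ∫ a, h p a ∂ν) (∫ a, h' p a ∂ν) p := by
  obtain ⟨B, hB⟩ := ((isCompact_closedBall p 1).prod
    (isCompact_univ (X := Ω))).exists_bound_of_continuousOn hh'.continuousOn
  refine (hasDerivAt_integral_of_dominated_loc_of_deriv_le (closedBall_mem_nhds p one_pos)
    (Eventually.of_forall fun p => (hh p).aestronglyMeasurable) (integrable_of_continuous (hh p))
    (F' := h') (bound := fun _ => B) ?_ ?_ (integrable_const _) ?_).2
  · exact Continuous.aestronglyMeasurable (by fun_prop)
  · exact Eventually.of_forall fun a q hq => hB (q, a) ⟨hq, mem_univ _⟩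
  · exact Eventually.of_forall fun a q _ => hd q a

end Parametric

/-! ### The interaction kernel and the potential -/

namespace IsCommunicationRate

variable {φ : ℝ → ℝ}

lemma continuous (hφ : IsCommunicationRate φ) : Continuous φ := hφ.smooth.continuous

lemma le_zero_value (hφ : IsCommunicationRate φ) (r : ℝ) : φ r ≤ φ 0 := by
  have key : ∀ s, 0 ≤ s → φ s ≤ φ 0 := fun s hs => by
    rcases hs.eq_or_lt with rfl | h
    · exact le_rfl
    · have := hφ.monotone_cond s 0 hs le_rfl
      nlinarith
  rcases le_total 0 r with h | h
  · exact key r h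
  · rw [hφ.even]; exact key _ (by linarith)

lemma hasDerivAt (hφ : IsCommunicationRate φ) (r : ℝ) : HasDerivAt φ (deriv φ r) r :=
  (hφ.smooth.differentiable (by simp) r).hasDerivAt

lemma continuous_deriv (hφ : IsCommunicationRate φ) : Continuous (deriv φ) :=
  hφ.smooth.continuous_deriv (by exact_mod_cast le_top)

/-- An even function has zero derivative at the origin, which makes `φ ‖·‖` of class `C¹` there. -/
lemma deriv_zero (hφ : IsCommunicationRate φ) : deriv φ 0 = 0 := by
  have h1 := hφ.hasDerivAt 0
  have h2 : HasDerivAt (fun r => φ (-r)) (-deriv φ 0) 0 := by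
    have h3 : HasDerivAt φ (deriv φ 0) (-0) := by simpa using h1
    have h4 := HasDerivAt.scomp (0 : ℝ) h3 (hasDerivAt_neg 0)
    rw [neg_one_smul] at h4
    exact h4
  have h3 : (fun r => φ (-r)) = φ := funext fun r => (hφ.even r).symm
  rw [h3] at h2
  have := h1.unique h2
  linarith

end IsCommunicationRate

section Radial

variable {V : Type*} [NormedAddCommGroup V] [InnerProductSpace ℝ V] {φ : ℝ → ℝ}

/-- A smooth even function of the norm is `C¹`, also at the origin, because the profile has
vanishing derivative there. -/
lemma IsCommunicationRate.contDiff_comp_norm (hφ : IsCommunicationRate φ) :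
    ContDiff ℝ 1 fun y : V => φ ‖y‖ := by
  rw [contDiff_one_iff_hasFDerivAt]
  -- at the origin the formula for the derivative gives the correct value zero, as `0⁻¹ = 0`
  refine ⟨fun y => (deriv φ ‖y‖ * ‖y‖⁻¹) • innerSL ℝ y, ?_, fun y => ?_⟩
  · rw [continuous_iff_continuousAt]
    intro y
    by_cases hy : y = 0
    · subst hy
      have h0 : Tendsto (fun y : V => deriv φ ‖y‖) (𝓝 0) (𝓝 0) := by
        have := (hφ.continuous_deriv.comp (continuous_norm (E := V))).tendsto 0
        simpa [hφ.deriv_zero, Function.comp_def] using this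
      have h1 : Tendsto (fun y : V => |deriv φ ‖y‖|) (𝓝 0) (𝓝 0) := by simpa using h0.abs
      rw [ContinuousAt]
      simp only [map_zero, smul_zero]
      refine squeeze_zero_norm (fun y => ?_) h1
      rw [norm_smul, innerSL_apply_norm, norm_mul, norm_inv, norm_norm, Real.norm_eq_abs]
      rcases eq_or_ne ‖y‖ 0 with h | h
      · simp [h]
      · rw [mul_assoc, inv_mul_cancel₀ h, mul_one]
    · have hn : ‖y‖ ≠ 0 := norm_ne_zero_iff.2 hy
      have h1 : ContinuousAt (fun y : V => deriv φ ‖y‖) y :=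
        (hφ.continuous_deriv.comp continuous_norm).continuousAt
      exact (h1.mul (continuous_norm.continuousAt.inv₀ hn)).smul
        (innerSL ℝ).continuous.continuousAt
  · by_cases hy : y = 0
    · subst hy
      simp only [map_zero, smul_zero]
      rw [hasFDerivAt_iff_isLittleO]
      have h1 := (hasDerivAt_iff_isLittleO.1 (hφ.hasDerivAt 0)).comp_tendsto
        (k := fun y : V => ‖y‖) (l' := 𝓝 0) (by simpa using (continuous_norm (E := V)).tendsto 0)
      refine Asymptotics.isLittleO_norm_right.1 ?_
      simpa [hφ.deriv_zero, Function.comp_def] using h1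
    · have h1 : HasFDerivAt (fun y : V => ‖y‖) (‖y‖⁻¹ • innerSL ℝ y) y := by
        have h2 := (hasStrictFDerivAt_norm_sq y).hasFDerivAt.sqrt
          (by simpa using hy)
        have h3 : (fun y : V => √(‖y‖ ^ 2)) = fun y => ‖y‖ := by
          funext y; exact Real.sqrt_sq (norm_nonneg _)
        rw [h3] at h2
        refine h2.congr_fderiv ?_
        rw [Real.sqrt_sq (norm_nonneg _), ← Nat.cast_smul_eq_nsmul ℝ, smul_smul]
        congr 1
        field_simp
        norm_num
      have := (hφ.hasDerivAt ‖y‖).comp_hasFDerivAt y h1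
      rw [smul_smul] at this
      exact this

lemma hasFDerivAt_potential_norm (hφ : IsCommunicationRate φ) (y : V) :
    HasFDerivAt (fun y : V => potential φ ‖y‖) (φ ‖y‖ • innerSL ℝ y) y := by
  have hc : Continuous fun s => φ √s := hφ.continuous.comp Real.continuous_sqrt
  have h1 : HasDerivAt (fun u : ℝ => ∫ s in (0 : ℝ)..u, φ √s) (φ √(‖y‖ ^ 2)) (‖y‖ ^ 2) :=
    intervalIntegral.integral_hasDerivAt_right (hc.intervalIntegrable _ _)
      hc.aestronglyMeasurable.stronglyMeasurableAtFilter hc.continuousAt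
  have h2 := (h1.comp_hasFDerivAt y (hasStrictFDerivAt_norm_sq y).hasFDerivAt).const_mul (1 / 2)
  refine h2.congr_fderiv ?_
  rw [Real.sqrt_sq (norm_nonneg _), ← Nat.cast_smul_eq_nsmul ℝ, smul_smul, smul_smul]
  congr 1
  push_cast; ring

lemma contDiff_potential_norm (hφ : IsCommunicationRate φ) :
    ContDiff ℝ 1 fun y : V => potential φ ‖y‖ := by
  rw [contDiff_one_iff_hasFDerivAt]
  refine ⟨_, ?_, hasFDerivAt_potential_norm hφ⟩
  exact (hφ.continuous.comp continuous_norm).smul (innerSL ℝ).continuous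

lemma potential_nonneg (hφ : IsCommunicationRate φ) (r : ℝ) : 0 ≤ potential φ r := by
  have := intervalIntegral.integral_nonneg (a := 0) (b := r ^ 2) (μ := volume)
    (f := fun s => φ √s) (sq_nonneg r) (fun s _ => hφ.nonneg _)
  rw [potential]; linarith

lemma potential_le (hφ : IsCommunicationRate φ) {φM : ℝ} (hM : ∀ r, φ r ≤ φM) (r : ℝ) :
    potential φ r ≤ φM / 2 * r ^ 2 := by
  have hc : Continuous fun s => φ √s := hφ.continuous.comp Real.continuous_sqrt
  have := intervalIntegral.integral_mono_on (a := 0) (b := r ^ 2) (μ := volume)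
    (f := fun s => φ √s) (g := fun _ => φM) (sq_nonneg r) (hc.intervalIntegrable _ _)
    (continuous_const.intervalIntegrable _ _) (fun s _ => hM _)
  simp only [intervalIntegral.integral_const, sub_zero, smul_eq_mul] at this
  rw [potential]; linarith

end Radial

/-- Phase space `ℝ^d × ℝ^d`, with points `z = (x, v)`. -/
abbrev Phase (d : ℕ) : Type := Vec d × Vec d

/-- The force which an agent of unit weight at `z'` exerts on an agent at `z`. -/
noncomputable def herdKernel {d : ℕ} (lamX lamV lamW : ℝ) (φ : ℝ → ℝ) (z z' : Phase d) : Vec d :=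
  lamW • (z'.1 - z.1) + (lamX * φ ‖z.1 - z'.1‖) • (z'.1 - z.1)
    + (lamV * φ ‖z.1 - z'.1‖) • (z'.2 - z.2)

section Kernel

variable {d : ℕ} {lamX lamV lamW : ℝ} {φ : ℝ → ℝ}

lemma herdKernel_contDiff (hφ : IsCommunicationRate φ) :
    ContDiff ℝ 1 fun p : Phase d × Phase d => herdKernel lamX lamV lamW φ p.1 p.2 := by
  have h1 : ContDiff ℝ 1 fun p : Phase d × Phase d => φ ‖p.1.1 - p.2.1‖ :=
    (hφ.contDiff_comp_norm (V := Vec d)).comp (by fun_prop)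
  unfold herdKernel
  have h2 : ContDiff ℝ 1 fun p : Phase d × Phase d => p.2.1 - p.1.1 := by fun_prop
  have h3 : ContDiff ℝ 1 fun p : Phase d × Phase d => p.2.2 - p.1.2 := by fun_prop
  exact ((h2.const_smul lamW).add ((contDiff_const.mul h1).smul h2)).add
    ((contDiff_const.mul h1).smul h3)

lemma norm_herdKernel_le (hφ : IsCommunicationRate φ) (hX : 0 < lamX) (hV : 0 < lamV)
    (hW : 0 < lamW) (z z' : Phase d) :
    ‖herdKernel lamX lamV lamW φ z z'‖ ≤
      (lamW + lamX * φ 0 + lamV * φ 0) * (‖z‖ + ‖z'‖) := by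
  have h1 : ‖z'.1 - z.1‖ ≤ ‖z‖ + ‖z'‖ :=
    (norm_sub_le _ _).trans (by linarith [norm_fst_le z, norm_fst_le z'])
  have h2 : ‖z'.2 - z.2‖ ≤ ‖z‖ + ‖z'‖ :=
    (norm_sub_le _ _).trans (by linarith [norm_snd_le z, norm_snd_le z'])
  have h3 := hφ.nonneg ‖z.1 - z'.1‖
  have h4 := hφ.le_zero_value ‖z.1 - z'.1‖
  have h5 := hφ.nonneg 0
  unfold herdKernel
  refine norm_add₃_le.trans ?_
  rw [norm_smul, norm_smul, norm_smul, Real.norm_of_nonneg hW.le,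
    Real.norm_of_nonneg (by positivity), Real.norm_of_nonneg (by positivity), add_mul, add_mul]
  gcongr

lemma herdKernel_antisymm (z z' : Phase d) :
    herdKernel lamX lamV lamW φ z z' = - herdKernel lamX lamV lamW φ z' z := by
  unfold herdKernel
  rw [norm_sub_rev z'.1 z.1, ← neg_sub z.1 z'.1, ← neg_sub z.2 z'.2]
  simp only [smul_neg]
  abel

end Kernel

/-! ### Characteristics of a transport equation -/

section TransportFlow

variable {E : Type*} [NormedAddCommGroup E] [NormedSpace ℝ E] [FiniteDimensional ℝ E]

/-- Every global trajectory belongs to the flow. -/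
lemma IsCompleteFlow.eq_of_hasDerivAt {F : E → E} {Z : ℝ → E → E} (hZ : IsCompleteFlow F Z)
    (hF : ContDiff ℝ 1 F) {β : ℝ → E} (hβ : ∀ t, HasDerivAt β (F (β t)) t) (t : ℝ) :
    β t = Z t (β 0) := by
  obtain ⟨R₁, hR₁⟩ := exists_norm_le_of_hasDerivAt (t₀ := 0) (T := |t|) fun s _ => hβ s
  obtain ⟨R₂, hR₂⟩ := exists_norm_le_of_hasDerivAt (t₀ := 0) (T := |t|)
    fun s _ => hZ.hasDerivAt s (β 0)
  obtain ⟨K, hK0, hK⟩ := exists_norm_fderiv_le hF (max R₁ R₂)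
  have key := norm_le_mul_exp_of_norm_deriv_le (u := fun s => β s - Z s (β 0)) (t₀ := 0)
    (T := |t|) hK0 le_rfl (fun s _ => (hβ s).sub (hZ.hasDerivAt s (β 0)))
    (fun s hs => by
      rw [add_zero]
      exact norm_sub_le_of_norm_fderiv_le hF hK ((hR₁ s hs).trans (le_max_left _ _))
        ((hR₂ s hs).trans (le_max_right _ _))) (t := t) (by simp)
  simp only [hZ.zero, sub_self, norm_zero, zero_mul, add_zero] at key
  exact sub_eq_zero.1 (norm_le_zero_iff.1 key)

lemma isGlobalField_of_contDiff {F : ℝ → E → E} (hF : ContDiff ℝ 1 fun p : ℝ × E => F p.1 p.2)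
    (hg : ∀ T : ℝ, ∃ C : ℝ, 0 ≤ C ∧ ∀ t, |t| ≤ T → ∀ x, ‖F t x‖ ≤ C * (1 + ‖x‖)) :
    IsGlobalField F := by
  refine ⟨fun x => hF.continuous.comp (by fun_prop : Continuous fun t : ℝ => (t, x)),
    fun T R => ?_, hg⟩
  obtain ⟨K, hK0, hK⟩ := exists_norm_fderiv_le hF (max T R)
  refine ⟨⟨K, hK0⟩, fun t ht => LipschitzOnWith.of_dist_le_mul fun x hx y hy => ?_⟩
  have hx' : ‖x‖ ≤ R := by simpa using hx
  have hy' : ‖y‖ ≤ R := by simpa using hy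
  have := norm_sub_le_of_norm_fderiv_le hF hK (x := (t, x)) (y := (t, y))
    (max_le_max ht hx') (max_le_max ht hy')
  have e : ‖((t, x) : ℝ × E) - (t, y)‖ = ‖x - y‖ := by simp [Prod.norm_def]
  rw [e] at this
  rw [dist_eq_norm, dist_eq_norm]
  exact this

/-- A time-dependent `C¹` field with linear growth becomes, with time as an additional variable,
an autonomous field with complete flow. -/
lemma exists_isCompleteFlow {F : ℝ → E → E} (hF : ContDiff ℝ 1 fun p : ℝ × E => F p.1 p.2)
    (hg : ∀ T : ℝ, ∃ C : ℝ, 0 ≤ C ∧ ∀ t, |t| ≤ T → ∀ x, ‖F t x‖ ≤ C * (1 + ‖x‖)) :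
    ∃ Z : ℝ → ℝ × E → ℝ × E, IsCompleteFlow (fun p => (1, F p.1 p.2)) Z ∧
      ∀ t p, (Z t p).1 = p.1 + t := by
  have : CompleteSpace E := FiniteDimensional.complete ℝ E
  choose a ha0 ha using fun p : ℝ × E => (isGlobalField_of_contDiff hF hg).exists_solution p.1 p.2
  refine ⟨fun t p => (p.1 + t, a p (p.1 + t)), ⟨fun p => ?_, fun t p => ?_, fun T R => ?_⟩,
    fun t p => rfl⟩
  · simp [ha0]
  · refine HasDerivAt.prodMk ((hasDerivAt_id t).const_add p.1) ?_
    exact (ha p (p.1 + t)).comp_const_add p.1 t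
  · obtain ⟨C, hC, h⟩ := hg (R + T)
    refine ⟨max (R + T) ((R + C * T) * Real.exp (C * T)), fun t p ht hp => ?_⟩
    have hp1 : |p.1| ≤ R := (norm_fst_le p).trans hp
    have hp2 : ‖p.2‖ ≤ R := (norm_snd_le p).trans hp
    have hsum : ∀ s, |s| ≤ T → |p.1 + s| ≤ R + T := fun s hs =>
      (abs_add_le _ _).trans (add_le_add hp1 hs)
    refine max_le_max (hsum t ht) ?_
    have := norm_le_mul_exp_of_norm_deriv_le (u := a p) (t₀ := p.1) (T := T) hC hC
      (fun s _ => ha p s)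
      (fun s hs => (h s (by simpa using hsum (s - p.1) hs) _).trans (by linarith))
      (t := p.1 + t) (by simpa using ht)
    rw [ha0] at this
    refine this.trans ?_
    have := (Real.exp_pos (C * T)).le
    gcongr

/-- The characteristics of the field `B`: the trajectory which is at `z` at time `s` is at
`X s t z` at time `t`, and `W s t z` is the integral of `R` along it between these times. -/
structure IsTransportFlow (B : ℝ → E → E) (R : ℝ → E → ℝ) (X : ℝ → ℝ → E → E)
    (W : ℝ → ℝ → E → ℝ) : Prop where
  contDiff_X : ContDiff ℝ 1 fun p : ℝ × ℝ × E => X p.1 p.2.1 p.2.2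
  contDiff_W : ContDiff ℝ 1 fun p : ℝ × ℝ × E => W p.1 p.2.1 p.2.2
  self_X : ∀ s z, X s s z = z
  self_W : ∀ s z, W s s z = 0
  comp_X : ∀ s t u z, X t u (X s t z) = X s u z
  comp_W : ∀ s t u z, W s t z + W t u (X s t z) = W s u z
  hasDerivAt_X : ∀ s t z, HasDerivAt (fun t => X s t z) (B t (X s t z)) t
  hasDerivAt_W : ∀ s t z, HasDerivAt (fun t => W s t z) (R t (X s t z)) t
  bounded : ∀ T r : ℝ, ∃ r', ∀ s t z, |s| ≤ T → |t| ≤ T → ‖z‖ ≤ r → ‖X s t z‖ ≤ r'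

/-- The equation for the integral of `R` along the trajectories is adjoined to the equation of the
trajectories; the `C¹` flow of the enlarged system contains `X` and `W`. -/
theorem exists_isTransportFlow {B : ℝ → E → E} {R : ℝ → E → ℝ}
    (hB : ContDiff ℝ 1 fun p : ℝ × E => B p.1 p.2) (hR : ContDiff ℝ 1 fun p : ℝ × E => R p.1 p.2)
    (hgB : ∀ T : ℝ, ∃ C : ℝ, 0 ≤ C ∧ ∀ t, |t| ≤ T → ∀ x, ‖B t x‖ ≤ C * (1 + ‖x‖))
    (hgR : ∀ T : ℝ, ∃ C : ℝ, 0 ≤ C ∧ ∀ t, |t| ≤ T → ∀ x, |R t x| ≤ C * (1 + ‖x‖)) :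
    ∃ X W, IsTransportFlow B R X W := by
  -- the field of the characteristics, extended by the equation for the integral of `R`
  set F : ℝ → E × ℝ → E × ℝ := fun t y => (B t y.1, R t y.1) with hFdef
  have hF : ContDiff ℝ 1 fun p : ℝ × (E × ℝ) => F p.1 p.2 := by
    have h1 : ContDiff ℝ 1 fun p : ℝ × (E × ℝ) => (p.1, p.2.1) := by fun_prop
    exact (hB.comp h1).prodMk (hR.comp h1)
  have hg : ∀ T : ℝ, ∃ C : ℝ, 0 ≤ C ∧ ∀ t, |t| ≤ T → ∀ y, ‖F t y‖ ≤ C * (1 + ‖y‖) := by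
    intro T
    obtain ⟨C₁, hC₁, h₁⟩ := hgB T
    obtain ⟨C₂, hC₂, h₂⟩ := hgR T
    refine ⟨max C₁ C₂, le_max_of_le_left hC₁, fun t ht y => max_le ?_ ?_⟩
    · refine (h₁ t ht y.1).trans ?_
      gcongr
      · exact le_max_left _ _
      · exact norm_fst_le y
    · refine (h₂ t ht y.1).trans ?_
      gcongr
      · exact le_max_right _ _
      · exact norm_fst_le y
  obtain ⟨Z, hZ, hZ1⟩ := exists_isCompleteFlow hF hg
  have hF' : ContDiff ℝ 1 fun p : ℝ × (E × ℝ) => ((1 : ℝ), F p.1 p.2) := contDiff_const.prodMk hF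
  have hZc := hZ.contDiff hF'
  have hgroup : ∀ t s p, Z t (Z s p) = Z (s + t) p := by
    intro t s p
    have := hZ.eq_of_hasDerivAt hF' (β := fun u => Z (s + u) p)
      (fun u => (hZ.hasDerivAt (s + u) p).comp_const_add s u) t
    simpa using this.symm
  -- invariance under translations of the last variable
  have htrans : ∀ t s z w, Z t (s, (z, w)) = Z t (s, (z, 0)) + (0, (0, w)) := by
    intro t s z w
    have := hZ.eq_of_hasDerivAt hF' (β := fun u => Z u (s, (z, 0)) + (0, (0, w)))
      (fun u => by
        have := (hZ.hasDerivAt u (s, (z, 0))).add_const ((0 : ℝ), ((0 : E), w))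
        simpa [hFdef] using this) t
    rw [this, hZ.zero]; simp
  have hdecomp : ∀ s t z, Z (t - s) (s, (z, 0))
      = (t, ((Z (t - s) (s, (z, 0))).2.1, (Z (t - s) (s, (z, 0))).2.2)) := fun s t z => by
    refine Prod.ext ?_ rfl
    rw [hZ1]; ring
  have hcomp : ∀ s t u z, Z (u - t) (t, ((Z (t - s) (s, (z, 0))).2.1, 0))
      + (0, (0, (Z (t - s) (s, (z, 0))).2.2)) = Z (u - s) (s, (z, 0)) := by
    intro s t u z
    rw [← htrans, ← hdecomp, hgroup]; congr 1; ring
  have hmap : ContDiff ℝ 1 fun p : ℝ × ℝ × E => Z (p.2.1 - p.1) (p.1, (p.2.2, 0)) := by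
    have h1 : ContDiff ℝ 1 fun p : ℝ × ℝ × E => (p.2.1 - p.1, (p.1, (p.2.2, (0 : ℝ)))) := by
      fun_prop
    exact hZc.comp h1
  have hdZ : ∀ s t z, HasDerivAt (fun t => Z (t - s) (s, (z, 0)))
      (1, F t (Z (t - s) (s, (z, 0))).2) t := by
    intro s t z
    have := (hZ.hasDerivAt (t - s) (s, (z, 0))).comp_sub_const t s
    rw [hZ1] at this
    simpa using this
  refine ⟨fun s t z => (Z (t - s) (s, (z, 0))).2.1, fun s t z => (Z (t - s) (s, (z, 0))).2.2,
    hmap.snd.fst, hmap.snd.snd, fun s z => by simp [hZ.zero], fun s z => by simp [hZ.zero],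
    fun s t u z => ?_, fun s t u z => ?_, fun s t z => ?_, fun s t z => ?_, fun T r => ?_⟩
  · have := congrArg (fun p => p.2.1) (hcomp s t u z)
    simpa using this
  · have := congrArg (fun p => p.2.2) (hcomp s t u z)
    simpa [add_comm] using this
  · exact (hdZ s t z).snd.fst
  · exact (hdZ s t z).snd.snd
  · obtain ⟨R', hR'⟩ := hZ.bounded (T + T) (max T r)
    refine ⟨R', fun s t z hs ht hz => ?_⟩
    have h1 : |t - s| ≤ T + T := (abs_sub _ _).trans (add_le_add ht hs)
    have h2 : ‖(s, (z, (0 : ℝ)))‖ ≤ max T r := max_le_max hs (by simpa [Prod.norm_def] using hz)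
    exact (norm_fst_le _).trans ((norm_snd_le _).trans (hR' (t - s) _ h1 h2))

end TransportFlow

/-! ### Transport identities in phase space -/

section PhaseIntegration

variable {d : ℕ} {F : Type*} [NormedAddCommGroup F] [NormedSpace ℝ F]

lemma sum_smul_single (v : Vec d) : ∑ i, v i • EuclideanSpace.single i (1 : ℝ) = v := by
  ext j
  simp [Finset.sum_apply, Pi.single_apply]

lemma apply_phase_eq_sum (L : Phase d →L[ℝ] F) (v u : Vec d) :
    L (v, u) = ∑ i, v i • L (EuclideanSpace.single i 1, 0)
      + ∑ i, u i • L (0, EuclideanSpace.single i 1) := by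
  have h : ((v, u) : Phase d) = ∑ i, v i • ((EuclideanSpace.single i (1 : ℝ), 0) : Phase d)
      + ∑ i, u i • ((0, EuclideanSpace.single i (1 : ℝ)) : Phase d) := by
    refine Prod.ext ?_ ?_
    · simp [Prod.fst_sum, sum_smul_single]
    · simp [Prod.snd_sum, sum_smul_single]
  conv_lhs => rw [h]
  simp only [map_add, map_sum, map_smul]

instance isAddHaarMeasure_phase : (volume : Measure (Phase d)).IsAddHaarMeasure :=
  inferInstanceAs ((volume : Measure (Vec d)).prod (volume : Measure (Vec d))).IsAddHaarMeasure

lemma integral_smul_fderiv_eq_of_hasLineDerivAt {G : Phase d → F} (hG : ContDiff ℝ 1 G)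
    (hGs : HasCompactSupport G) {f f' : Phase d → ℝ} (hf : Continuous f) (hf' : Continuous f')
    {ξ : Phase d} (hd : ∀ z, HasLineDerivAt ℝ f (f' z) z ξ) :
    ∫ z, f z • fderiv ℝ G z ξ = - ∫ z, f' z • G z := by
  have hc : Continuous fun z => fderiv ℝ G z ξ :=
    (hG.continuous_fderiv one_ne_zero).clm_apply continuous_const
  exact integral_bilinear_hasLineDerivAt_right_eq_neg_left_of_integrable (μ := volume)
    (B := ContinuousLinearMap.lsmul ℝ ℝ) (f := f) (f' := f') (g := G)
    (g' := fun z => fderiv ℝ G z ξ) (v := ξ)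
    ((hf'.smul hG.continuous).integrable_of_hasCompactSupport hGs.smul_left)
    ((hf.smul hc).integrable_of_hasCompactSupport (hGs.fderiv_apply (𝕜 := ℝ) ξ).smul_left)
    ((hf.smul hG.continuous).integrable_of_hasCompactSupport hGs.smul_left)
    (fun z _ => hd z)
    (fun z _ => (hG.differentiable one_ne_zero z).hasFDerivAt.hasLineDerivAt ξ)

/-- Integration by parts against the phase space field `(v, A(x) - r(x) v)`, whose divergence is
`-d r(x)`. The coefficients `A` and `r` need not be differentiable. -/
lemma integral_fderiv_phase_field {G : Phase d → F} (hG : ContDiff ℝ 1 G)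
    (hGs : HasCompactSupport G) {A : Vec d → Vec d} {r : Vec d → ℝ} (hA : Continuous A)
    (hr : Continuous r) :
    ∫ z, fderiv ℝ G z (z.2, A z.1 - r z.1 • z.2) = ∫ z, ((d : ℝ) * r z.1) • G z := by
  have hc : ∀ ξ : Phase d, Continuous fun z => fderiv ℝ G z ξ := fun ξ =>
    (hG.continuous_fderiv one_ne_zero).clm_apply continuous_const
  have hint : ∀ (f : Phase d → ℝ), Continuous f → ∀ ξ : Phase d,
      Integrable fun z => f z • fderiv ℝ G z ξ := fun f hf ξ =>
    (hf.smul (hc ξ)).integrable_of_hasCompactSupport (hGs.fderiv_apply (𝕜 := ℝ) ξ).smul_left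
  have hf1 : ∀ i, Continuous fun z : Phase d => z.2 i := fun i => by fun_prop
  have hf2 : ∀ i, Continuous fun z : Phase d => (A z.1 - r z.1 • z.2) i := fun i => by
    have : Continuous fun z : Phase d => A z.1 - r z.1 • z.2 := by fun_prop
    exact (EuclideanSpace.proj (𝕜 := ℝ) i).continuous.comp this
  have h1 : ∀ i, ∫ z : Phase d, z.2 i • fderiv ℝ G z (EuclideanSpace.single i 1, 0) = 0 := by
    intro i
    rw [integral_smul_fderiv_eq_of_hasLineDerivAt hG hGs (hf1 i) (f' := fun _ => 0)
      continuous_const]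
    · simp
    · intro z
      simpa [HasLineDerivAt] using hasDerivAt_const (0 : ℝ) (z.2 i)
  have h2 : ∀ i, ∫ z : Phase d, (A z.1 - r z.1 • z.2) i •
      fderiv ℝ G z (0, EuclideanSpace.single i 1) = ∫ z, r z.1 • G z := by
    intro i
    rw [integral_smul_fderiv_eq_of_hasLineDerivAt hG hGs (hf2 i) (f' := fun z => - r z.1)
      (by fun_prop)]
    · simp [integral_neg]
    · intro z
      have : HasDerivAt (fun t : ℝ => A z.1 i - r z.1 * (z.2 i + t)) (-(r z.1)) 0 := by
        have := (((hasDerivAt_id (0 : ℝ)).const_add (z.2 i)).const_mul (r z.1)).const_sub (A z.1 i)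
        rw [mul_one] at this
        exact this
      simpa [HasLineDerivAt, mul_add] using this
  simp only [fun z : Phase d => apply_phase_eq_sum (fderiv ℝ G z) z.2 (A z.1 - r z.1 • z.2)]
  rw [integral_add (integrable_finsetSum _ fun i _ => hint _ (hf1 i) _)
    (integrable_finsetSum _ fun i _ => hint _ (hf2 i) _),
    integral_finsetSum _ fun i _ => hint _ (hf1 i) _,
    integral_finsetSum _ fun i _ => hint _ (hf2 i) _]
  simp only [h1, h2, Finset.sum_const_zero, zero_add, Finset.sum_const, Finset.card_univ,
    Fintype.card_fin]
  simp_rw [mul_smul]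
  rw [integral_smul, Nat.cast_smul_eq_nsmul]

/-- Differentiation of the integral of a time-dependent density of compact support. -/
lemma hasDerivAt_integral_phase {G : Phase d × ℝ → F} {U : Set ℝ} (hU : IsOpen U)
    (hG : ContDiffOn ℝ 1 G (univ ×ˢ U)) {r : ℝ} (hs : ∀ t ∈ U, ∀ z, r < ‖z‖ → G (z, t) = 0)
    {t₀ : ℝ} (ht₀ : t₀ ∈ U) :
    HasDerivAt (fun t => ∫ z, G (z, t)) (∫ z, fderiv ℝ G (z, t₀) (0, 1)) t₀ := by
  have hO : IsOpen ((univ : Set (Phase d)) ×ˢ U) := isOpen_univ.prod hU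
  have hcd : ContinuousOn (fun p => fderiv ℝ G p (0, 1)) (univ ×ˢ U) :=
    (hG.continuousOn_fderiv_of_isOpen hO le_rfl).clm_apply continuousOn_const
  have hslice : ∀ t ∈ U, Continuous fun z => G (z, t) := fun t ht =>
    hG.continuousOn.comp_continuous (by fun_prop) fun z => ⟨mem_univ _, ht⟩
  have hcs : ∀ t ∈ U, HasCompactSupport fun z => G (z, t) := fun t ht =>
    HasCompactSupport.of_support_subset_isCompact (isCompact_closedBall (0 : Phase d) r)
      fun z hz => by
        by_contra h
        exact hz (hs t ht z (by simpa using h))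
  have hderiv : ∀ t ∈ U, ∀ z, HasDerivAt (fun s => G (z, s)) (fderiv ℝ G (z, t) (0, 1)) t := by
    intro t ht z
    have h1 := ((hG.differentiableOn one_ne_zero).differentiableAt
      (hO.mem_nhds (⟨mem_univ z, ht⟩ : (z, t) ∈ univ ×ˢ U))).hasFDerivAt
    have h2 : HasDerivAt (fun s : ℝ => (z, s)) (0, 1) t :=
      (hasDerivAt_const t z).prodMk (hasDerivAt_id t)
    exact h1.comp_hasDerivAt t h2
  obtain ⟨ε, hε, hεU⟩ := Metric.nhds_basis_closedBall.mem_iff.1 (hU.mem_nhds ht₀)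
  obtain ⟨M, hM⟩ := ((isCompact_closedBall (0 : Phase d) r).prod
    (isCompact_closedBall t₀ ε)).exists_bound_of_continuousOn
    (hcd.mono fun p hp => ⟨mem_univ _, hεU hp.2⟩)
  refine (hasDerivAt_integral_of_dominated_loc_of_deriv_le (ball_mem_nhds t₀ hε)
    (F := fun t z => G (z, t)) (F' := fun t z => fderiv ℝ G (z, t) (0, 1))
    (bound := (closedBall (0 : Phase d) r).indicator fun _ => M) ?_ ?_ ?_ ?_ ?_ ?_).2
  · filter_upwards [hU.mem_nhds ht₀] with t ht using (hslice t ht).aestronglyMeasurable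
  · exact (hslice t₀ ht₀).integrable_of_hasCompactSupport (hcs t₀ ht₀)
  · exact (hcd.comp_continuous (by fun_prop) fun z =>
      ⟨mem_univ _, ht₀⟩ : Continuous fun z => fderiv ℝ G (z, t₀) (0, 1)).aestronglyMeasurable
  · refine Eventually.of_forall fun z t ht => ?_
    by_cases hz : z ∈ closedBall (0 : Phase d) r
    · rw [indicator_of_mem hz]
      exact hM (z, t) ⟨hz, ball_subset_closedBall ht⟩
    · have hz' : r < ‖z‖ := by simpa using hz
      have htU : t ∈ U := hεU (ball_subset_closedBall ht)
      have h0 : HasDerivAt (fun s => G (z, s)) 0 t := by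
        refine (hasDerivAt_const t (0 : F)).congr_of_eventuallyEq ?_
        filter_upwards [hU.mem_nhds htU] with s hs' using hs s hs' z hz'
      rw [indicator_of_notMem hz, (hderiv t htU z).unique h0, norm_zero]
  · rw [integrable_indicator_iff measurableSet_closedBall]
    exact integrableOn_const (measure_closedBall_lt_top.ne)
  · exact Eventually.of_forall fun z t ht => hderiv t (hεU (ball_subset_closedBall ht)) z

/-- The rate of change of the integral of a density, in terms of its derivative along the
characteristics of `(v, A(x) - r(x) v)`. -/
lemma hasDerivAt_integral_transport {G : Phase d × ℝ → F} {U : Set ℝ} (hU : IsOpen U)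
    (hG : ContDiffOn ℝ 1 G (univ ×ˢ U)) {ρ : ℝ} (hs : ∀ t ∈ U, ∀ z, ρ < ‖z‖ → G (z, t) = 0)
    {t₀ : ℝ} (ht₀ : t₀ ∈ U) {A : Vec d → Vec d} {r : Vec d → ℝ} (hA : Continuous A)
    (hr : Continuous r) :
    HasDerivAt (fun t => ∫ z, G (z, t))
      (∫ z, (fderiv ℝ G (z, t₀) ((z.2, A z.1 - r z.1 • z.2), 1)
        - ((d : ℝ) * r z.1) • G (z, t₀))) t₀ := by
  have hO : IsOpen ((univ : Set (Phase d)) ×ˢ U) := isOpen_univ.prod hU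
  have hslice : ContDiff ℝ 1 fun z => G (z, t₀) := by
    rw [← contDiffOn_univ]
    exact hG.comp (contDiff_prodMk_left t₀).contDiffOn fun z _ => ⟨mem_univ _, ht₀⟩
  have hcs : HasCompactSupport fun z => G (z, t₀) :=
    HasCompactSupport.of_support_subset_isCompact (isCompact_closedBall (0 : Phase d) ρ)
      fun z hz => by
        by_contra h
        exact hz (hs t₀ ht₀ z (by simpa using h))
  have hfd : ∀ z ξ, fderiv ℝ (fun z => G (z, t₀)) z ξ = fderiv ℝ G (z, t₀) (ξ, 0) := by
    intro z ξ
    have h1 := ((hG.differentiableOn one_ne_zero).differentiableAt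
      (hO.mem_nhds (⟨mem_univ z, ht₀⟩ : (z, t₀) ∈ univ ×ˢ U))).hasFDerivAt
    have h2 : HasFDerivAt (fun z : Phase d => (z, t₀)) (ContinuousLinearMap.inl ℝ (Phase d) ℝ) z :=
      hasFDerivAt_prodMk_left z t₀
    have h3 : HasFDerivAt (fun z => G (z, t₀)) _ z := h1.comp z h2
    rw [h3.fderiv]
    simp
  refine (hasDerivAt_integral_phase hU hG hs ht₀).congr_deriv ?_
  have e1 : ∀ z : Phase d, fderiv ℝ G (z, t₀) ((z.2, A z.1 - r z.1 • z.2), 1)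
      - ((d : ℝ) * r z.1) • G (z, t₀) = fderiv ℝ G (z, t₀) (0, 1)
        + (fderiv ℝ (fun z => G (z, t₀)) z (z.2, A z.1 - r z.1 • z.2)
          - ((d : ℝ) * r z.1) • G (z, t₀)) := by
    intro z
    rw [hfd, add_sub_assoc', ← map_add]; simp
  have hcd : Continuous fun z => fderiv ℝ G (z, t₀) (0, 1) :=
    ((hG.continuousOn_fderiv_of_isOpen hO le_rfl).comp_continuous
      (f := fun z : Phase d => (z, t₀)) (by fun_prop) fun z => ⟨mem_univ _, ht₀⟩).clm_apply
      continuous_const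
  have hI0 : Integrable fun z => fderiv ℝ G (z, t₀) (0, 1) := by
    refine hcd.integrable_of_hasCompactSupport
      (HasCompactSupport.of_support_subset_isCompact (isCompact_closedBall (0 : Phase d) ρ)
        fun z hz => ?_)
    by_contra h
    have hz' : ρ < ‖z‖ := by simpa using h
    refine hz ?_
    have h1 := ((hG.differentiableOn one_ne_zero).differentiableAt
      (hO.mem_nhds (⟨mem_univ z, ht₀⟩ : (z, t₀) ∈ univ ×ˢ U))).hasFDerivAt
    have h2 := h1.comp_hasDerivAt t₀ ((hasDerivAt_const t₀ z).prodMk (hasDerivAt_id t₀))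
    refine h2.unique ((hasDerivAt_const t₀ (0 : F)).congr_of_eventuallyEq ?_)
    filter_upwards [hU.mem_nhds ht₀] with s hs' using hs s hs' z hz'
  have hI1 : Integrable fun z : Phase d =>
      fderiv ℝ (fun z => G (z, t₀)) z (z.2, A z.1 - r z.1 • z.2) := by
    refine (((hslice.continuous_fderiv one_ne_zero).clm_apply
      (by fun_prop))).integrable_of_hasCompactSupport ?_
    exact (hcs.fderiv (𝕜 := ℝ)).mono fun z hz h0 => hz (by simp only [h0]; rfl)
  have hI2 : Integrable fun z : Phase d => ((d : ℝ) * r z.1) • G (z, t₀) :=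
    Continuous.integrable_of_hasCompactSupport
      (((continuous_const.mul (hr.comp continuous_fst)).smul hslice.continuous)) hcs.smul_left
  simp_rw [e1]
  have e2 := integral_add hI0 (hI1.sub hI2)
  have e3 := integral_sub hI1 hI2
  rw [integral_fderiv_phase_field hslice hcs hA hr, sub_self] at e3
  simp only [Pi.sub_apply] at e2
  rw [e2, e3, add_zero]

/-- A density transported by `(v, A(x) - r(x) v)` has constant integral. -/
lemma integral_eq_of_transport {G : Phase d × ℝ → F} (hG : ContDiff ℝ 1 G)
    (hs : ∀ T : ℝ, ∃ ρ : ℝ, ∀ t z, |t| ≤ T → ρ < ‖z‖ → G (z, t) = 0)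
    {A : ℝ → Vec d → Vec d} {r : ℝ → Vec d → ℝ} (hA : ∀ t, Continuous (A t))
    (hr : ∀ t, Continuous (r t))
    (heq : ∀ t z, fderiv ℝ G (z, t) ((z.2, A t z.1 - r t z.1 • z.2), 1)
      = ((d : ℝ) * r t z.1) • G (z, t)) (t : ℝ) :
    ∫ z, G (z, t) = ∫ z, G (z, 0) := by
  have hd : ∀ t, HasDerivAt (fun t => ∫ z, G (z, t)) 0 t := by
    intro t
    obtain ⟨ρ, hρ⟩ := hs (|t| + 1)
    have := hasDerivAt_integral_transport (G := G) (U := {s | |s| < |t| + 1})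
      (isOpen_lt (by fun_prop) continuous_const) hG.contDiffOn (ρ := ρ)
      (fun s hs z hz => hρ s z (le_of_lt hs) hz) (t₀ := t) (by simp) (hA t) (hr t)
    refine this.congr_deriv ?_
    simp [heq]
  exact is_const_of_deriv_eq_zero (fun s => (hd s).differentiableAt) (fun s => (hd s).deriv) t 0

end PhaseIntegration

section TransportedDensity

variable {d : ℕ}

/-- The phase space field `(v, A(t,x) - r(t,x) v)`. -/
noncomputable def phaseField (A : ℝ → Vec d → Vec d) (r : ℝ → Vec d → ℝ) (t : ℝ)
    (z : Phase d) : Phase d :=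
  (z.2, A t z.1 - r t z.1 • z.2)

/-- The density at time `t` which arises from `f₀` by transport along the characteristics, with
the exponential factor that accounts for the divergence of the field. -/
noncomputable def transported (f₀ : Phase d → ℝ) (X : ℝ → ℝ → Phase d → Phase d)
    (W : ℝ → ℝ → Phase d → ℝ) (p : Phase d × ℝ) : ℝ :=
  f₀ (X p.2 0 p.1) * Real.exp (-(W p.2 0 p.1))

variable {F : Type*} [NormedAddCommGroup F] [NormedSpace ℝ F]
  {A : ℝ → Vec d → Vec d} {r : ℝ → Vec d → ℝ} {X : ℝ → ℝ → Phase d → Phase d}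
  {W : ℝ → ℝ → Phase d → ℝ} {f₀ : Phase d → ℝ}

lemma transported_zero (hX : IsTransportFlow (phaseField A r) (fun t z => d * r t z.1) X W)
    (z : Phase d) : transported f₀ X W (z, 0) = f₀ z := by
  simp [transported, hX.self_X, hX.self_W]

lemma transported_contDiff (hX : IsTransportFlow (phaseField A r) (fun t z => d * r t z.1) X W)
    (hf₀ : ContDiff ℝ 1 f₀) : ContDiff ℝ 1 (transported f₀ X W) := by
  have h1 : ContDiff ℝ 1 fun p : Phase d × ℝ => (p.2, ((0 : ℝ), p.1)) := by fun_prop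
  exact (hf₀.comp (hX.contDiff_X.comp h1)).mul
    (Real.contDiff_exp.comp (hX.contDiff_W.comp h1).neg)

lemma exists_transported_eq_zero
    (hX : IsTransportFlow (phaseField A r) (fun t z => d * r t z.1) X W)
    (hs : HasCompactSupport f₀) (T : ℝ) :
    ∃ ρ : ℝ, ∀ t z, |t| ≤ T → ρ < ‖z‖ → transported f₀ X W (z, t) = 0 := by
  obtain ⟨R, hR⟩ := hs.isBounded.exists_norm_le
  obtain ⟨ρ, hρ⟩ := hX.bounded (max T 0) R
  refine ⟨ρ, fun t z ht hz => ?_⟩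
  by_contra h
  have h1 : f₀ (X t 0 z) ≠ 0 := fun h0 => h (by simp [transported, h0])
  have h2 := hρ 0 t (X t 0 z) (by simp) (ht.trans (le_max_left _ _))
    (hR _ (subset_tsupport _ h1))
  rw [hX.comp_X, hX.self_X] at h2
  linarith

/-- The transported density, multiplied by a function which is constant along characteristics,
solves the continuity equation. -/
lemma fderiv_transported_smul
    (hX : IsTransportFlow (phaseField A r) (fun t z => d * r t z.1) X W)
    (hf₀ : ContDiff ℝ 1 f₀) {h : Phase d → F} (hh : ContDiff ℝ 1 h) (t s : ℝ) (z : Phase d) :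
    fderiv ℝ (fun p => transported f₀ X W p • h (X p.2 t p.1)) (z, s)
      (phaseField A r s z, 1) = ((d : ℝ) * r s z.1) • transported f₀ X W (z, s) • h (X s t z) := by
  have h1 : ContDiff ℝ 1 fun p : Phase d × ℝ => (p.2, (t, p.1)) := by fun_prop
  have hG : ContDiff ℝ 1 fun p : Phase d × ℝ => transported f₀ X W p • h (X p.2 t p.1) :=
    (transported_contDiff hX hf₀).smul (hh.comp (hX.contDiff_X.comp h1))
  have hc : HasDerivAt (fun u => (X s u z, u)) (phaseField A r s z, 1) s := by
    have := (hX.hasDerivAt_X s s z).prodMk (hasDerivAt_id s)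
    rwa [hX.self_X] at this
  have hL : HasFDerivAt (fun p : Phase d × ℝ => transported f₀ X W p • h (X p.2 t p.1))
      (fderiv ℝ (fun p => transported f₀ X W p • h (X p.2 t p.1)) (z, s)) (X s s z, s) := by
    rw [hX.self_X]
    exact (hG.differentiable one_ne_zero _).hasFDerivAt
  have h2 := HasFDerivAt.comp_hasDerivAt (f := fun u => (X s u z, u)) s hL hc
  -- the same function of `u`, computed from the cocycle identities of the flow
  have h3 : ((fun p : Phase d × ℝ => transported f₀ X W p • h (X p.2 t p.1)) ∘
      fun u => (X s u z, u)) = fun u =>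
        (f₀ (X s 0 z) * Real.exp (W s u z - W s 0 z)) • h (X s t z) := by
    funext u
    have := hX.comp_W s u 0 z
    simp only [Function.comp, transported, hX.comp_X]
    congr 3
    linarith
  rw [h3] at h2
  have h4 : HasDerivAt (fun u => (f₀ (X s 0 z) * Real.exp (W s u z - W s 0 z)) • h (X s t z))
      ((f₀ (X s 0 z) * (Real.exp (W s s z - W s 0 z) * (d * r s z.1))) • h (X s t z)) s := by
    have := (hX.hasDerivAt_W s s z)
    rw [hX.self_X] at this
    exact (((this.sub_const _).exp).const_mul _).smul_const _
  rw [h2.unique h4, hX.self_W, smul_smul]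
  congr 1
  simp only [transported, zero_sub]
  ring

/-- The transported density is the push-forward of `f₀` under the flow. -/
theorem integral_transported_smul
    (hX : IsTransportFlow (phaseField A r) (fun t z => d * r t z.1) X W)
    (hA : ∀ t, Continuous (A t)) (hr : ∀ t, Continuous (r t))
    (hf₀ : ContDiff ℝ 1 f₀) (hs : HasCompactSupport f₀) {h : Phase d → F} (hh : ContDiff ℝ 1 h)
    (t : ℝ) :
    ∫ z, transported f₀ X W (z, t) • h z = ∫ z, f₀ z • h (X 0 t z) := by
  have h1 : ContDiff ℝ 1 fun p : Phase d × ℝ => (p.2, (t, p.1)) := by fun_prop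
  have key := integral_eq_of_transport
    (G := fun p => transported f₀ X W p • h (X p.2 t p.1))
    ((transported_contDiff hX hf₀).smul (hh.comp (hX.contDiff_X.comp h1)))
    (fun T => by
      obtain ⟨ρ, hρ⟩ := exists_transported_eq_zero hX hs T
      exact ⟨ρ, fun t z ht hz => by simp [hρ t z ht hz]⟩)
    hA hr (fun s z => fderiv_transported_smul hX hf₀ hh t s z) t
  simpa [hX.self_X, transported_zero hX] using key

end TransportedDensity

/-! ### The force of a density -/

/-- The data of the model: positive parameters and a communication rate. -/
structure Model where
  lamX : ℝ
  lamV : ℝ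
  lamW : ℝ
  φ : ℝ → ℝ
  lamX_pos : 0 < lamX
  lamV_pos : 0 < lamV
  lamW_pos : 0 < lamW
  rate : IsCommunicationRate φ

namespace Model

variable {d : ℕ} (S : Model)

/-- The interaction kernel of the model. -/
noncomputable def kernel (z z' : Phase d) : Vec d := herdKernel S.lamX S.lamV S.lamW S.φ z z'

/-- A bound for the growth of the interaction kernel. -/
noncomputable def growth : ℝ := S.lamW + S.lamX * S.φ 0 + S.lamV * S.φ 0

lemma growth_nonneg : 0 ≤ S.growth := by
  have := S.rate.nonneg 0
  have := S.lamX_pos; have := S.lamV_pos; have := S.lamW_pos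
  unfold growth; positivity

lemma norm_kernel_le (z z' : Phase d) : ‖S.kernel z z'‖ ≤ S.growth * (‖z‖ + ‖z'‖) :=
  norm_herdKernel_le S.rate S.lamX_pos S.lamV_pos S.lamW_pos z z'

lemma kernel_contDiff : ContDiff ℝ 1 fun p : Phase d × Phase d => S.kernel p.1 p.2 :=
  herdKernel_contDiff S.rate

lemma continuous_kernel_right (z : Phase d) : Continuous fun z' : Phase d => S.kernel z z' := by
  have h := (S.kernel_contDiff (d := d)).continuous
  fun_prop

/-- The kernel is affine in the velocity. -/
lemma kernel_eq (x v : Vec d) (z' : Phase d) :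
    S.kernel (x, v) z' = S.kernel (x, 0) z' - (S.lamV * S.φ ‖x - z'.1‖) • v := by
  simp only [kernel, herdKernel, sub_zero, smul_sub]
  abel

lemma rate_contDiff : ContDiff ℝ 1 fun p : Phase d × Phase d => S.φ ‖p.1.1 - p.2.1‖ :=
  (S.rate.contDiff_comp_norm (V := Vec d)).comp (by fun_prop)

end Model

/-- The weight `1 + |x|² + |v|²`. -/
noncomputable def weight {d : ℕ} (z : Phase d) : ℝ := 1 + ‖z.1‖ ^ 2 + ‖z.2‖ ^ 2

section Weight

variable {d : ℕ}

lemma weight_pos (z : Phase d) : 0 < weight z := by unfold weight; positivity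

lemma one_le_weight (z : Phase d) : 1 ≤ weight z := by
  unfold weight; nlinarith [sq_nonneg ‖z.1‖, sq_nonneg ‖z.2‖]

lemma norm_le_weight (z : Phase d) : ‖z‖ ≤ weight z := by
  refine max_le ?_ ?_ <;> unfold weight <;>
  nlinarith [sq_nonneg (‖z.1‖ - 1), sq_nonneg (‖z.2‖ - 1), sq_nonneg ‖z.1‖, sq_nonneg ‖z.2‖]

lemma weight_contDiff : ContDiff ℝ 1 (weight (d := d)) := by
  unfold weight
  exact (contDiff_const.add (contDiff_fst.norm_sq ℝ)).add (contDiff_snd.norm_sq ℝ)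

/-- A density whose moments of order at most two exist. -/
def HasMoments (g : Phase d → ℝ) : Prop := Integrable fun z => weight z * g z

variable {g : Phase d → ℝ}

lemma HasMoments.aestronglyMeasurable (hg : HasMoments g) : AEStronglyMeasurable g := by
  have h1 : Continuous fun z : Phase d => (weight z)⁻¹ :=
    weight_contDiff.continuous.inv₀ fun z => (weight_pos z).ne'
  have h2 := h1.aestronglyMeasurable.mul (Integrable.aestronglyMeasurable hg)
  refine h2.congr (Eventually.of_forall fun z => ?_)
  have := (weight_pos z).ne'
  simp only [Pi.mul_apply]
  field_simp

lemma HasMoments.integrable_smul {G : Type*} [NormedAddCommGroup G] [NormedSpace ℝ G]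
    (hg : HasMoments g) {h : Phase d → G} (hh : Continuous h) {C : ℝ}
    (hC : ∀ z, ‖h z‖ ≤ C * weight z) : Integrable fun z => g z • h z := by
  have : SecondCountableTopologyEither (Phase d) G := inferInstance
  refine (hg.norm.const_mul C).mono' (hg.aestronglyMeasurable.smul hh.aestronglyMeasurable)
    (Eventually.of_forall fun z => ?_)
  rw [norm_smul, norm_mul, Real.norm_of_nonneg (weight_pos z).le]
  nlinarith [hC z, norm_nonneg (g z)]

lemma HasMoments.norm_integral_smul_le {G : Type*} [NormedAddCommGroup G] [NormedSpace ℝ G]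
    (hg : HasMoments g) {h : Phase d → G} {C : ℝ}
    (hC : ∀ z, ‖h z‖ ≤ C * weight z) :
    ‖∫ z, g z • h z‖ ≤ C * ∫ z, weight z * |g z| := by
  rw [← integral_const_mul]
  refine norm_integral_le_of_norm_le ?_ (Eventually.of_forall fun z => ?_)
  · have := hg.norm
    refine (this.const_mul C).congr (Eventually.of_forall fun z => ?_)
    simp only [norm_mul, Real.norm_of_nonneg (weight_pos z).le, Real.norm_eq_abs]
  · rw [norm_smul, Real.norm_eq_abs]
    nlinarith [hC z, abs_nonneg (g z)]

/-- For a family of functions bounded by the weight, uniformly near each parameter, the integral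
against a density with moments is continuous in the parameter. -/
lemma HasMoments.continuous_integral_smul {G Y : Type*} [NormedAddCommGroup G] [NormedSpace ℝ G]
    [NormedAddCommGroup Y] (hg : HasMoments g) {h : Y → Phase d → G}
    (hh : Continuous fun p : Y × Phase d => h p.1 p.2) {C : ℝ}
    (hC : ∀ y z, ‖h y z‖ ≤ C * (1 + ‖y‖) * weight z) :
    Continuous fun y => ∫ z, g z • h y z := by
  rw [continuous_iff_continuousAt]
  intro y
  have hcz : ∀ y, Continuous (h y) := fun y => by fun_prop
  have e : ∀ᶠ y' in 𝓝 y, ‖y'‖ < ‖y‖ + 1 :=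
    (isOpen_lt (by fun_prop) continuous_const).mem_nhds (by simp)
  have hC0 : 0 ≤ C := by
    have h0 := (norm_nonneg _).trans (hC 0 0)
    have := weight_pos (0 : Phase d)
    simp only [norm_zero, add_zero, mul_one] at h0
    exact nonneg_of_mul_nonneg_left h0 this
  refine continuousAt_of_dominated (bound := fun z => C * (1 + (‖y‖ + 1)) * ‖weight z * g z‖)
    (Eventually.of_forall fun y' =>
      hg.aestronglyMeasurable.smul (hcz y').aestronglyMeasurable) ?_
    ((Integrable.norm hg).const_mul _) (Eventually.of_forall fun z => ?_)
  · filter_upwards [e] with y' hy'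
    refine Eventually.of_forall fun z => ?_
    rw [norm_smul, norm_mul, Real.norm_of_nonneg (weight_pos z).le]
    have h1 := hC y' z
    have h2 : C * (1 + ‖y'‖) * weight z ≤ C * (1 + (‖y‖ + 1)) * weight z := by
      have := (weight_pos z).le
      gcongr
    nlinarith [norm_nonneg (g z)]
  · have : Continuous fun y => h y z := by fun_prop
    exact (this.const_smul (g z)).continuousAt

end Weight

namespace Model

variable {d : ℕ} (S : Model) {g : Phase d → ℝ}

/-- The coefficient `r` of `-v` in the force of a density. -/
noncomputable def drag (g : Phase d → ℝ) (x : Vec d) : ℝ := ∫ z, g z • (S.lamV * S.φ ‖x - z.1‖)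

/-- The force of a density, as a function on phase space. -/
noncomputable def totalForce (g : Phase d → ℝ) (z : Phase d) : Vec d := ∫ z', g z' • S.kernel z z'

lemma norm_kernel_le_weight (z z' : Phase d) :
    ‖S.kernel z z'‖ ≤ S.growth * (1 + ‖z‖) * weight z' := by
  refine (S.norm_kernel_le z z').trans ?_
  rw [mul_assoc]
  refine mul_le_mul_of_nonneg_left ?_ S.growth_nonneg
  nlinarith [norm_le_weight z', one_le_weight z', norm_nonneg z, norm_nonneg z']

lemma abs_drag_kernel_le_weight (x : Vec d) (z' : Phase d) :
    ‖S.lamV * S.φ ‖x - z'.1‖‖ ≤ S.lamV * S.φ 0 * weight z' := by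
  have h1 := S.rate.nonneg ‖x - z'.1‖
  have h2 := S.rate.le_zero_value ‖x - z'.1‖
  have h3 := S.lamV_pos
  rw [Real.norm_of_nonneg (by positivity)]
  have h4 : S.lamV * S.φ ‖x - z'.1‖ ≤ S.lamV * S.φ 0 := by gcongr
  have h5 : 0 ≤ S.lamV * S.φ 0 := by have := S.rate.nonneg 0; positivity
  nlinarith [one_le_weight z']

lemma continuous_drag_kernel :
    Continuous fun p : Vec d × Phase d => S.lamV * S.φ ‖p.1 - p.2.1‖ := by
  have := S.rate.continuous
  fun_prop

lemma integrable_drag (hg : HasMoments g) (x : Vec d) :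
    Integrable fun z => g z • (S.lamV * S.φ ‖x - z.1‖) :=
  hg.integrable_smul (by have := S.rate.continuous; fun_prop) (S.abs_drag_kernel_le_weight x)

lemma integrable_kernel (hg : HasMoments g) (z : Phase d) :
    Integrable fun z' => g z' • S.kernel z z' :=
  hg.integrable_smul (h := fun z' => S.kernel z z') (S.continuous_kernel_right z)
    (S.norm_kernel_le_weight z)

/-- The force is affine in the velocity. -/
lemma totalForce_eq (hg : HasMoments g) (x v : Vec d) :
    S.totalForce g (x, v) = S.totalForce g (x, 0) - S.drag g x • v := by
  unfold totalForce drag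
  rw [← integral_smul_const, ← integral_sub (S.integrable_kernel hg _)
    ((S.integrable_drag hg x).smul_const v)]
  refine integral_congr_ae (Eventually.of_forall fun z => ?_)
  simp only [S.kernel_eq x v z, smul_sub, smul_smul, smul_eq_mul]

lemma continuous_drag (hg : HasMoments g) : Continuous (S.drag g) := by
  refine hg.continuous_integral_smul (Y := Vec d) (C := S.lamV * S.φ 0)
    S.continuous_drag_kernel fun x z => ?_
  refine (S.abs_drag_kernel_le_weight x z).trans ?_
  have h0 := S.rate.nonneg 0
  have h1 := S.lamV_pos
  have h2 := (weight_pos z).le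
  have h3 : S.lamV * S.φ 0 ≤ S.lamV * S.φ 0 * (1 + ‖x‖) :=
    le_mul_of_one_le_right (by positivity) (by linarith [norm_nonneg x])
  gcongr

lemma continuous_totalForce (hg : HasMoments g) : Continuous (S.totalForce g) :=
  hg.continuous_integral_smul S.kernel_contDiff.continuous S.norm_kernel_le_weight

lemma norm_totalForce_le (hg : HasMoments g) (z : Phase d) :
    ‖S.totalForce g z‖ ≤ S.growth * (1 + ‖z‖) * ∫ z', weight z' * |g z'| :=
  hg.norm_integral_smul_le (S.norm_kernel_le_weight z)

lemma abs_drag_le (hg : HasMoments g) (x : Vec d) :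
    |S.drag g x| ≤ S.lamV * S.φ 0 * ∫ z', weight z' * |g z'| :=
  hg.norm_integral_smul_le (S.abs_drag_kernel_le_weight x)

lemma force_eq_totalForce {g : Vec d → Vec d → ℝ} (hg : HasMoments fun z => g z.1 z.2)
    (x v : Vec d) :
    force S.lamX S.lamV S.lamW S.φ g x v = S.totalForce (fun z => g z.1 z.2) (x, v) := by
  have hφ := S.rate.continuous
  have hb : ∀ z : Phase d, 1 + ‖z‖ ≤ 2 * weight z := fun z => by
    linarith [norm_le_weight z, one_le_weight z]
  have hxb : ∀ (y : Vec d) (u : Phase d → Vec d), (∀ z, ‖u z‖ ≤ ‖z‖) → ∀ z,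
      ‖u z - y‖ ≤ ((1 + ‖y‖) * 2) * weight z := fun y u hu z => by
    refine (norm_sub_le _ _).trans ?_
    nlinarith [hb z, hu z, norm_nonneg y, norm_nonneg z, one_le_weight z]
  have hφb : ∀ z : Phase d, |S.φ ‖x - z.1‖| ≤ S.φ 0 := fun z => by
    rw [abs_of_nonneg (S.rate.nonneg _)]; exact S.rate.le_zero_value _
  have hxb' : ∀ (y : Vec d) (u : Phase d → Vec d), (∀ z, ‖u z‖ ≤ ‖z‖) → ∀ z,
      ‖S.φ ‖x - z.1‖ • (u z - y)‖ ≤ (S.φ 0 * ((1 + ‖y‖) * 2)) * weight z := fun y u hu z => by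
    rw [norm_smul, Real.norm_eq_abs, mul_assoc]
    exact mul_le_mul (hφb z) (hxb y u hu z) (norm_nonneg _) (S.rate.nonneg 0)
  have i1 : Integrable fun z : Phase d => g z.1 z.2 • (z.1 - x) :=
    hg.integrable_smul (by fun_prop) (hxb x _ norm_fst_le)
  have i2 : Integrable fun z : Phase d => g z.1 z.2 • S.φ ‖x - z.1‖ • (z.1 - x) :=
    hg.integrable_smul (by fun_prop) (hxb' x _ norm_fst_le)
  have i3 : Integrable fun z : Phase d => g z.1 z.2 • S.φ ‖x - z.1‖ • (z.2 - v) :=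
    hg.integrable_smul (by fun_prop) (hxb' v _ norm_snd_le)
  have e : ∀ z : Phase d, g z.1 z.2 • S.kernel (x, v) z
      = S.lamW • (g z.1 z.2 • (z.1 - x)) + S.lamX • (g z.1 z.2 • S.φ ‖x - z.1‖ • (z.1 - x))
        + S.lamV • (g z.1 z.2 • S.φ ‖x - z.1‖ • (z.2 - v)) := fun z => by
    simp only [kernel, herdKernel]
    module
  unfold totalForce force force₁ force₂ force₃
  simp only [e]
  have j12 := (i1.smul S.lamW).add (i2.smul S.lamX)
  have e1 := integral_add j12 (i3.smul S.lamV)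
  have e2 := integral_add (i1.smul S.lamW) (i2.smul S.lamX)
  simp only [Pi.add_apply, Pi.smul_apply, integral_smul] at e1 e2
  rw [e1, e2]
  simp only [smul_smul, mul_comm]

end Model

/-- The terms of the kinetic equation, expressed through the derivative along the phase space
field; the remaining term comes from the divergence of the force. -/
lemma kinetic_terms_eq {d : ℕ} {g : Vec d → Vec d → ℝ → ℝ} {I : Set ℝ} {t : ℝ} {x v : Vec d}
    (hI : UniqueDiffWithinAt ℝ I t)
    (hg : DifferentiableAt ℝ (fun p : Phase d × ℝ => g p.1.1 p.1.2 p.2) ((x, v), t))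
    {Q : Vec d → Vec d} {A : Vec d} {r : ℝ} (hQ : ∀ w, Q w = A - r • w) :
    derivWithin (fun s => g x v s) I t + fderiv ℝ (fun y => g y v t) x v
      + divergence (fun w => g x w t • Q w) v
      = fderiv ℝ (fun p : Phase d × ℝ => g p.1.1 p.1.2 p.2) ((x, v), t) ((v, A - r • v), 1)
        - (d * r) * g x v t := by
  set L := fderiv ℝ (fun p : Phase d × ℝ => g p.1.1 p.1.2 p.2) ((x, v), t) with hL
  have hd : HasFDerivAt (fun p : Phase d × ℝ => g p.1.1 p.1.2 p.2) L ((x, v), t) := hg.hasFDerivAt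
  have h1 : derivWithin (fun s => g x v s) I t = L ((0, 0), 1) := by
    have : HasDerivAt (fun s : ℝ => ((x, v), s)) (((0 : Vec d), (0 : Vec d)), (1 : ℝ)) t :=
      ((hasDerivAt_const t (x, v))).prodMk (hasDerivAt_id t)
    exact (hd.comp_hasDerivAt t this).hasDerivWithinAt.derivWithin hI
  have h2 : ∀ ξ, fderiv ℝ (fun y => g y v t) x ξ = L ((ξ, 0), 0) := by
    intro ξ
    have h3 : HasFDerivAt (fun y : Vec d => ((y, v), t))
        (((ContinuousLinearMap.id ℝ (Vec d)).prod 0).prod 0) x :=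
      ((hasFDerivAt_id x).prodMk (hasFDerivAt_const v x)).prodMk (hasFDerivAt_const t x)
    have h4 := HasFDerivAt.comp (f := fun y : Vec d => ((y, v), t)) x hd h3
    change HasFDerivAt (fun y => g y v t) _ x at h4
    rw [h4.fderiv]; simp
  have h3 : HasFDerivAt (fun w : Vec d => ((x, w), t))
      ((ContinuousLinearMap.prod 0 (ContinuousLinearMap.id ℝ (Vec d))).prod 0) v :=
    ((hasFDerivAt_const x v).prodMk (hasFDerivAt_id v)).prodMk (hasFDerivAt_const t v)
  have h4 := HasFDerivAt.comp (f := fun w : Vec d => ((x, w), t)) v hd h3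
  change HasFDerivAt (fun w => g x w t) _ v at h4
  have h5 : HasFDerivAt Q (-(r • ContinuousLinearMap.id ℝ (Vec d))) v := by
    have : Q = fun w => A - r • w := funext hQ
    rw [this]
    simpa using ((hasFDerivAt_id v).const_smul r).const_sub A
  have h6 := h4.smul h5
  have h7 : divergence (fun w => g x w t • Q w) v
      = ∑ i, ((A - r • v) i • L ((0, EuclideanSpace.single i 1), 0) - r * g x v t) := by
    unfold divergence
    refine Finset.sum_congr rfl fun i _ => ?_
    have : fderiv ℝ (fun w => g x w t • Q w) v = _ := h6.fderiv
    rw [this, hQ v]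
    simp
    ring
  have h8 := apply_phase_eq_sum (L.comp (ContinuousLinearMap.inl ℝ (Phase d) ℝ)) 0 (A - r • v)
  simp only [ContinuousLinearMap.comp_apply, ContinuousLinearMap.inl_apply, PiLp.zero_apply,
    zero_smul, Finset.sum_const_zero, zero_add] at h8
  rw [h1, h2, h7, Finset.sum_sub_distrib, ← h8]
  have h9 : (((v, A - r • v), 1) : Phase d × ℝ)
      = ((0, 0), 1) + ((v, 0), 0) + ((0, A - r • v), 0) := by simp
  rw [h9, map_add, map_add]
  simp
  ring

/-! ### The mean-field system for the characteristics -/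

namespace Model

section MeanField

set_option linter.unusedSectionVars false

variable {d : ℕ} (S : Model) {Ω : Type*} [TopologicalSpace Ω] [CompactSpace Ω] [T2Space Ω]
  [SecondCountableTopology Ω] [MeasurableSpace Ω] [OpensMeasurableSpace Ω] (ν : Measure Ω)
  [IsFiniteMeasure ν] (w : C(Ω, ℝ))

/-- The force exerted at `z` by agents of weight `w a` at the positions `Z a`. -/
noncomputable def meanForce (Z : C(Ω, Phase d)) (z : Phase d) : Vec d :=
  ∫ a, w a • S.kernel z (Z a) ∂ν

/-- The coefficient of `-v` in `meanForce`. -/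
noncomputable def meanDrag (Z : C(Ω, Phase d)) (x : Vec d) : ℝ :=
  ∫ a, w a • (S.lamV * S.φ ‖x - (Z a).1‖) ∂ν

variable {S ν w}

lemma continuous_kernel : Continuous fun p : Phase d × Phase d => S.kernel p.1 p.2 :=
  S.kernel_contDiff.continuous

lemma continuous_meanForce_integrand {Ω : Type*} [TopologicalSpace Ω] {w : C(Ω, ℝ)}
    (Z : C(Ω, Phase d)) :
    Continuous fun p : Phase d × Ω => w p.2 • S.kernel p.1 (Z p.2) := by
  have h := continuous_kernel (S := S) (d := d)
  fun_prop

lemma continuous_meanForce (Z : C(Ω, Phase d)) : Continuous (S.meanForce ν w Z) :=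
  continuous_integral_of_compactSpace (h := fun z a => w a • S.kernel z (Z a))
    (continuous_meanForce_integrand Z)

lemma continuous_meanDrag (Z : C(Ω, Phase d)) : Continuous (S.meanDrag ν w Z) := by
  have h := S.rate.continuous
  exact continuous_integral_of_compactSpace
    (h := fun x a => w a • (S.lamV * S.φ ‖x - (Z a).1‖)) (by fun_prop)

lemma integrable_meanForce (Z : C(Ω, Phase d)) (z : Phase d) :
    Integrable (fun a => w a • S.kernel z (Z a)) ν := by
  have h := continuous_meanForce_integrand (S := S) (w := w) Z
  exact integrable_of_continuous
    (h.comp (f := fun a : Ω => (z, a)) (by fun_prop))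

lemma integrable_norm_weight {Ω : Type*} [TopologicalSpace Ω] [CompactSpace Ω]
    [MeasurableSpace Ω] [OpensMeasurableSpace Ω] {ν : Measure Ω} [IsFiniteMeasure ν]
    {w : C(Ω, ℝ)} : Integrable (fun a => ‖w a‖) ν :=
  integrable_of_continuous (by fun_prop)

lemma norm_meanForce_le (Z : C(Ω, Phase d)) (z : Phase d) :
    ‖S.meanForce ν w Z z‖ ≤ (∫ a, ‖w a‖ ∂ν) * (S.growth * (‖z‖ + ‖Z‖)) := by
  rw [← integral_mul_const]
  refine norm_integral_le_of_norm_le (integrable_norm_weight.mul_const _)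
    (Eventually.of_forall fun a => ?_)
  rw [norm_smul]
  gcongr
  refine (S.norm_kernel_le z (Z a)).trans ?_
  have := S.growth_nonneg
  gcongr
  exact Z.norm_coe_le_norm a

lemma norm_meanForce_sub_le {R K : ℝ} (hK : 0 ≤ K)
    (hL : ∀ p q : Phase d × Phase d, ‖p‖ ≤ R → ‖q‖ ≤ R →
      ‖S.kernel p.1 p.2 - S.kernel q.1 q.2‖ ≤ K * ‖p - q‖)
    {Z Z' : C(Ω, Phase d)} {z z' : Phase d} (hZ : ‖Z‖ ≤ R) (hZ' : ‖Z'‖ ≤ R) (hz : ‖z‖ ≤ R)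
    (hz' : ‖z'‖ ≤ R) :
    ‖S.meanForce ν w Z z - S.meanForce ν w Z' z'‖
      ≤ (∫ a, ‖w a‖ ∂ν) * (K * max ‖z - z'‖ ‖Z - Z'‖) := by
  unfold meanForce
  rw [← integral_sub (integrable_meanForce Z z) (integrable_meanForce Z' z'), ← integral_mul_const]
  refine norm_integral_le_of_norm_le (integrable_norm_weight.mul_const _)
    (Eventually.of_forall fun a => ?_)
  rw [← smul_sub, norm_smul]
  gcongr
  refine (hL (z, Z a) (z', Z' a) (max_le hz ((Z.norm_coe_le_norm a).trans hZ))
    (max_le hz' ((Z'.norm_coe_le_norm a).trans hZ'))).trans ?_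
  gcongr
  exact max_le_max le_rfl ((Z - Z').norm_coe_le_norm a)

variable (S ν w) in
/-- The velocity field of the mean-field system, on the space of all configurations. -/
noncomputable def meanField (Z : C(Ω, Phase d)) : C(Ω, Phase d) where
  toFun a := ((Z a).2, S.meanForce ν w Z (Z a))
  continuous_toFun :=
    (continuous_snd.comp Z.continuous).prodMk ((continuous_meanForce Z).comp Z.continuous)

lemma meanField_apply (Z : C(Ω, Phase d)) (a : Ω) :
    S.meanField ν w Z a = ((Z a).2, S.meanForce ν w Z (Z a)) := rfl

/-- The mean-field system is globally solvable in the space of configurations, as the kernel is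
locally Lipschitz and of linear growth. -/
lemma isGlobalField_meanField :
    IsGlobalField fun (_ : ℝ) (Z : C(Ω, Phase d)) => S.meanField ν w Z := by
  set m := ∫ a, ‖w a‖ ∂ν with hm
  have hm0 : 0 ≤ m := integral_nonneg fun a => norm_nonneg _
  refine ⟨fun _ => continuous_const, fun T R => ?_, fun T => ?_⟩
  · obtain ⟨K, hK0, hK⟩ := exists_norm_fderiv_le (S.kernel_contDiff (d := d)) R
    have hL : ∀ p q : Phase d × Phase d, ‖p‖ ≤ R → ‖q‖ ≤ R →
        ‖S.kernel p.1 p.2 - S.kernel q.1 q.2‖ ≤ K * ‖p - q‖ := fun p q hp hq =>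
      norm_sub_le_of_norm_fderiv_le (S.kernel_contDiff (d := d)) hK hp hq
    refine ⟨⟨max 1 (m * K), le_max_of_le_left zero_le_one⟩, fun t _ =>
      LipschitzOnWith.of_dist_le_mul fun Z hZ Z' hZ' => ?_⟩
    have hZR : ‖Z‖ ≤ R := by simpa using hZ
    have hZR' : ‖Z'‖ ≤ R := by simpa using hZ'
    rw [dist_eq_norm, dist_eq_norm]
    change _ ≤ max 1 (m * K) * ‖Z - Z'‖
    refine (ContinuousMap.norm_le _ (by positivity)).2 fun a => ?_
    have ha : ‖Z a - Z' a‖ ≤ ‖Z - Z'‖ := (Z - Z').norm_coe_le_norm a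
    refine max_le ?_ ?_
    · have h1 : ‖(Z a).2 - (Z' a).2‖ ≤ ‖Z - Z'‖ := (norm_snd_le (Z a - Z' a)).trans ha
      refine h1.trans (le_mul_of_one_le_left (norm_nonneg _) (le_max_left _ _))
    · have h1 := norm_meanForce_sub_le (ν := ν) (w := w) hK0 hL hZR hZR'
        ((Z.norm_coe_le_norm a).trans hZR) ((Z'.norm_coe_le_norm a).trans hZR')
      rw [max_eq_right ha, ← hm, ← mul_assoc] at h1
      exact h1.trans (mul_le_mul_of_nonneg_right (le_max_right _ _) (norm_nonneg _))
  · have hg := S.growth_nonneg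
    refine ⟨max 1 (m * (S.growth * 2)), le_max_of_le_left zero_le_one, fun t _ Z => ?_⟩
    refine (ContinuousMap.norm_le _ (by positivity)).2 fun a => max_le ?_ ?_
    · have h1 : ‖(Z a).2‖ ≤ 1 + ‖Z‖ :=
        (norm_snd_le _).trans ((Z.norm_coe_le_norm a).trans (by linarith))
      exact h1.trans (le_mul_of_one_le_left (by positivity) (le_max_left _ _))
    · refine (norm_meanForce_le Z (Z a)).trans ?_
      calc m * (S.growth * (‖Z a‖ + ‖Z‖)) ≤ m * (S.growth * ((1 + ‖Z‖) + (1 + ‖Z‖))) := by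
            gcongr
            · exact (Z.norm_coe_le_norm a).trans (by linarith)
            · linarith
        _ = m * (S.growth * 2) * (1 + ‖Z‖) := by ring
        _ ≤ _ := by gcongr; exact le_max_right _ _

variable {Z : ℝ → C(Ω, Phase d)}

lemma continuous_eval_configuration (hZ : ∀ t, HasDerivAt Z (S.meanField ν w (Z t)) t) :
    Continuous fun q : ℝ × Ω => Z q.1 q.2 := by
  have hc : Continuous Z := continuous_iff_continuousAt.2 fun t => (hZ t).continuousAt
  fun_prop

lemma hasDerivAt_configuration (hZ : ∀ t, HasDerivAt Z (S.meanField ν w (Z t)) t) (t : ℝ) (a : Ω) :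
    HasDerivAt (fun t => Z t a) ((Z t a).2, S.meanForce ν w (Z t) (Z t a)) t :=
  (ContinuousMap.evalCLM ℝ a : C(Ω, Phase d) →L[ℝ] Phase d).hasFDerivAt.comp_hasDerivAt t (hZ t)

lemma continuous_meanField : Continuous (S.meanField (d := d) ν w) := by
  rw [continuous_iff_continuousAt]
  intro Z
  obtain ⟨L, hL⟩ := (isGlobalField_meanField (S := S) (d := d) (ν := ν) (w := w)).lipschitz 0
    (‖Z‖ + 1)
  exact (hL 0 (by simp)).continuousOn.continuousAt
    (mem_of_superset (ball_mem_nhds Z one_pos) fun Y hY => by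
      have h1 : ‖Y - Z‖ < 1 := by simpa [dist_eq_norm] using hY
      have h2 := norm_le_insert' Y Z
      simp only [mem_closedBall, dist_zero_right]
      linarith)

/-- Averages of a `C¹` interaction over the mean-field configuration are `C¹` in time and in the
point at which they are evaluated. -/
lemma contDiff_integral_configuration (hZ : ∀ t, HasDerivAt Z (S.meanField ν w (Z t)) t)
    {G : Type*} [NormedAddCommGroup G] [NormedSpace ℝ G] {K : Phase d → Phase d → G}
    (hK : ContDiff ℝ 1 fun p : Phase d × Phase d => K p.1 p.2) :
    ContDiff ℝ 1 fun p : ℝ × Phase d => ∫ a, w a • K p.2 (Z p.1 a) ∂ν := by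
  have hZc : Continuous Z := continuous_iff_continuousAt.2 fun t => (hZ t).continuousAt
  have hZe := continuous_eval_configuration hZ
  have hZ'e : Continuous fun q : ℝ × Ω => S.meanField ν w (Z q.1) q.2 := by
    have hY := (continuous_meanField (S := S) (d := d) (ν := ν) (w := w)).comp hZc
    exact ContinuousEval.continuous_eval.comp
      ((hY.comp continuous_fst).prodMk continuous_snd)
  have hKc := hK.continuous
  refine contDiff_integral_of_compactSpace (ν := ν) (h := fun p a => w a • K p.2 (Z p.1 a))
    (h' := fun p a => w a • (fderiv ℝ (fun p : Phase d × Phase d => K p.1 p.2) (p.2, Z p.1 a)).comp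
      ((ContinuousLinearMap.snd ℝ ℝ (Phase d)).prod
        ((ContinuousLinearMap.toSpanSingleton ℝ (S.meanField ν w (Z p.1) a)).comp
          (ContinuousLinearMap.fst ℝ ℝ (Phase d))))) ?_ ?_ ?_
  · intro p
    have : Continuous fun a => (p.2, Z p.1 a) := by fun_prop
    exact w.continuous.smul (hKc.comp this)
  · have h1 : Continuous fun q : (ℝ × Phase d) × Ω => (q.1.2, Z q.1.1 q.2) := by
      have : Continuous fun q : (ℝ × Phase d) × Ω => Z q.1.1 q.2 :=
        hZe.comp (f := fun q : (ℝ × Phase d) × Ω => (q.1.1, q.2)) (by fun_prop)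
      fun_prop
    have h2 : Continuous fun q : (ℝ × Phase d) × Ω => S.meanField ν w (Z q.1.1) q.2 :=
      hZ'e.comp (f := fun q : (ℝ × Phase d) × Ω => (q.1.1, q.2)) (by fun_prop)
    have h3 := (hK.continuous_fderiv one_ne_zero).comp h1
    have h4 : Continuous fun q : (ℝ × Phase d) × Ω =>
        ContinuousLinearMap.toSpanSingleton ℝ (S.meanField ν w (Z q.1.1) q.2) :=
      (ContinuousLinearMap.toSpanSingletonCLE (𝕜 := ℝ) (E := Phase d)).continuous.comp h2
    have h5 : Continuous fun q : (ℝ × Phase d) × Ω =>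
        (ContinuousLinearMap.snd ℝ ℝ (Phase d)).prod
        ((ContinuousLinearMap.toSpanSingleton ℝ (S.meanField ν w (Z q.1.1) q.2)).comp
          (ContinuousLinearMap.fst ℝ ℝ (Phase d))) := by
      have e : ∀ (L M : ℝ × Phase d →L[ℝ] Phase d), L.prod M
          = (ContinuousLinearMap.inl ℝ (Phase d) (Phase d)).comp L
            + (ContinuousLinearMap.inr ℝ (Phase d) (Phase d)).comp M := fun L M => by
        ext <;> simp
      simp only [e]
      exact continuous_const.add (continuous_const.clm_comp (h4.clm_comp continuous_const))
    exact (w.continuous.comp continuous_snd).smul (h3.clm_comp h5)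
  · intro p a
    have h1 : HasFDerivAt (fun p : ℝ × Phase d => Z p.1 a)
        ((ContinuousLinearMap.toSpanSingleton ℝ (S.meanField ν w (Z p.1) a)).comp
          (ContinuousLinearMap.fst ℝ ℝ (Phase d))) p :=
      HasFDerivAt.comp (f := fun p : ℝ × Phase d => p.1) (g := fun t => Z t a) p
        (hasDerivAt_configuration hZ p.1 a).hasFDerivAt hasFDerivAt_fst
    have h2 : HasFDerivAt (fun p : ℝ × Phase d => (p.2, Z p.1 a)) _ p := hasFDerivAt_snd.prodMk h1
    exact (HasFDerivAt.comp (f := fun p : ℝ × Phase d => (p.2, Z p.1 a))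
      (g := fun p : Phase d × Phase d => K p.1 p.2) p
      (hK.differentiable one_ne_zero _).hasFDerivAt h2).const_smul (w a)

lemma meanForce_eq (Z : C(Ω, Phase d)) (x v : Vec d) :
    S.meanForce ν w Z (x, v) = S.meanForce ν w Z (x, 0) - S.meanDrag ν w Z x • v := by
  have h0 : Continuous fun a => w a • (S.lamV * S.φ ‖x - (Z a).1‖) := by
    have := S.rate.continuous
    fun_prop
  unfold meanForce meanDrag
  rw [← integral_smul_const, ← integral_sub (integrable_meanForce Z _)
    ((integrable_of_continuous h0).smul_const v)]
  refine integral_congr_ae (Eventually.of_forall fun a => ?_)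
  simp only [S.kernel_eq x v, smul_sub, smul_smul, smul_eq_mul]

lemma abs_meanDrag_le (Z : C(Ω, Phase d)) (x : Vec d) :
    |S.meanDrag ν w Z x| ≤ (∫ a, ‖w a‖ ∂ν) * (S.lamV * S.φ 0) := by
  rw [← Real.norm_eq_abs, ← integral_mul_const]
  refine norm_integral_le_of_norm_le (integrable_norm_weight.mul_const _)
    (Eventually.of_forall fun a => ?_)
  have h1 := S.rate.nonneg ‖x - (Z a).1‖
  have h2 := S.rate.le_zero_value ‖x - (Z a).1‖
  have h3 := S.lamV_pos
  rw [norm_smul, Real.norm_of_nonneg (by positivity : 0 ≤ S.lamV * S.φ ‖x - (Z a).1‖)]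
  gcongr

/-- The characteristics of the mean-field force, together with the fact that the members of the
configuration themselves move along characteristics. -/
theorem exists_isTransportFlow_meanField (hZ : ∀ t, HasDerivAt Z (S.meanField ν w (Z t)) t) :
    ∃ X W, IsTransportFlow
      (phaseField (fun t x => S.meanForce ν w (Z t) (x, 0)) fun t x => S.meanDrag ν w (Z t) x)
      (fun t z => d * S.meanDrag ν w (Z t) z.1) X W ∧ ∀ t a, X 0 t (Z 0 a) = Z t a := by
  set m := ∫ a, ‖w a‖ ∂ν with hm
  have hm0 : 0 ≤ m := integral_nonneg fun a => norm_nonneg _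
  have hφ0 := S.rate.nonneg 0
  have hV := S.lamV_pos
  have hB : phaseField (fun t x => S.meanForce ν w (Z t) (x, 0))
      (fun t x => S.meanDrag ν w (Z t) x) = fun t z => (z.2, S.meanForce ν w (Z t) z) := by
    funext t z
    exact Prod.ext rfl (meanForce_eq (Z t) z.1 z.2).symm
  have hB1 : ContDiff ℝ 1 fun p : ℝ × Phase d => (p.2.2, S.meanForce ν w (Z p.1) p.2) :=
    contDiff_snd.snd.prodMk (contDiff_integral_configuration (ν := ν) (w := w) hZ S.kernel_contDiff)
  have hR1 : ContDiff ℝ 1 fun p : ℝ × Phase d => (d : ℝ) * S.meanDrag ν w (Z p.1) p.2.1 :=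
    contDiff_const.mul (contDiff_integral_configuration (ν := ν) (w := w) hZ
      (K := fun z z' => S.lamV * S.φ ‖z.1 - z'.1‖) (contDiff_const.mul S.rate_contDiff))
  have hgB : ∀ T : ℝ, ∃ C : ℝ, 0 ≤ C ∧ ∀ t, |t| ≤ T → ∀ z : Phase d,
      ‖((z.2, S.meanForce ν w (Z t) z) : Phase d)‖ ≤ C * (1 + ‖z‖) := by
    intro T
    obtain ⟨R, hR⟩ := exists_norm_le_of_hasDerivAt (t₀ := 0) (T := T) fun t _ => hZ t
    have hg := S.growth_nonneg
    have hR0 : 0 ≤ max R 0 := le_max_right _ _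
    refine ⟨1 + m * (S.growth * (1 + max R 0)), by positivity, fun t ht z => max_le ?_ ?_⟩
    · have h1 := norm_snd_le z
      have h2 : 1 * (1 + ‖z‖) ≤ (1 + m * (S.growth * (1 + max R 0))) * (1 + ‖z‖) := by
        gcongr
        have : 0 ≤ m * (S.growth * (1 + max R 0)) := by positivity
        linarith
      exact (by linarith : ‖z.2‖ ≤ 1 * (1 + ‖z‖)).trans h2
    · have h1 := hR t (by simpa using ht)
      refine (norm_meanForce_le (Z t) z).trans ?_
      calc m * (S.growth * (‖z‖ + ‖Z t‖))
          ≤ m * (S.growth * ((1 + max R 0) * (1 + ‖z‖))) := by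
            gcongr
            nlinarith [le_max_left R 0, norm_nonneg z]
        _ ≤ (1 + m * (S.growth * (1 + max R 0))) * (1 + ‖z‖) := by
            nlinarith [norm_nonneg z]
  have hgR : ∀ T : ℝ, ∃ C : ℝ, 0 ≤ C ∧ ∀ t, |t| ≤ T → ∀ z : Phase d,
      |(d : ℝ) * S.meanDrag ν w (Z t) z.1| ≤ C * (1 + ‖z‖) := by
    intro T
    refine ⟨d * (m * (S.lamV * S.φ 0)), by positivity, fun t _ z => ?_⟩
    rw [abs_mul, abs_of_nonneg (Nat.cast_nonneg d)]
    have h1 := abs_meanDrag_le (S := S) (ν := ν) (w := w) (Z t) z.1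
    have h2 : (d : ℝ) * (m * (S.lamV * S.φ 0)) ≤ d * (m * (S.lamV * S.φ 0)) * (1 + ‖z‖) :=
      le_mul_of_one_le_right (by positivity) (by linarith [norm_nonneg z])
    exact (mul_le_mul_of_nonneg_left h1 (Nat.cast_nonneg d)).trans h2
  rw [hB]
  obtain ⟨X, W, hX⟩ := exists_isTransportFlow hB1 hR1 hgB hgR
  refine ⟨X, W, hX, fun t a => ?_⟩
  exact (isGlobalField_of_contDiff hB1 hgB).unique (t₀ := 0) (T := |t|)
    (fun s _ => hX.hasDerivAt_X 0 s (Z 0 a)) (fun s _ => hasDerivAt_configuration hZ s a)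
    (hX.self_X 0 _) (by simp)

end MeanField

end Model

/-! ### Existence of a classical solution -/

/-- A compactly supported `C¹` initial datum. -/
structure InitialDatum (d : ℕ) where
  toFun : Phase d → ℝ
  contDiff : ContDiff ℝ 1 toFun
  hasCompactSupport : HasCompactSupport toFun

namespace InitialDatum

variable {d : ℕ} (D : InitialDatum d)

/-- The agents are labelled by their initial positions in the support of the datum. -/
abbrev Label : Type := tsupport D.toFun

instance : CompactSpace D.Label := isCompact_iff_compactSpace.1 D.hasCompactSupport

/-- Lebesgue measure on the labels. -/
noncomputable def labelMeasure : Measure D.Label := Measure.comap Subtype.val volume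

instance : IsFiniteMeasure D.labelMeasure := by
  refine ⟨?_⟩
  have h : MeasurableSet (tsupport D.toFun) := (isClosed_tsupport _).measurableSet
  rw [labelMeasure, comap_subtype_coe_apply h, image_univ, Subtype.range_coe]
  exact D.hasCompactSupport.measure_lt_top

/-- The initial density as a function of the label. -/
def weight : C(D.Label, ℝ) :=
  ⟨fun a => D.toFun a, D.contDiff.continuous.comp continuous_subtype_val⟩

/-- The initial positions. -/
def position : C(D.Label, Phase d) := ⟨fun a => a, continuous_subtype_val⟩

lemma integral_label {F : Type*} [NormedAddCommGroup F] [NormedSpace ℝ F] (h : Phase d → F) :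
    ∫ a, D.weight a • h a ∂D.labelMeasure = ∫ z, D.toFun z • h z := by
  have hm : MeasurableSet (tsupport D.toFun) := (isClosed_tsupport _).measurableSet
  have h1 := integral_subtype_comap (μ := volume) hm fun z => D.toFun z • h z
  refine h1.trans (setIntegral_eq_integral_of_forall_compl_eq_zero fun z hz => ?_)
  rw [image_eq_zero_of_notMem_tsupport hz, zero_smul]

end InitialDatum

/-- A density on phase space for all times which solves the kinetic equation and is carried by the
mean-field configuration `Z`. -/
structure IsLagrangianSolution {d : ℕ} (S : Model) (D : InitialDatum d) (f : Phase d × ℝ → ℝ)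
    (Z : ℝ → C(D.Label, Phase d)) : Prop where
  contDiff : ContDiff ℝ 1 f
  support : ∀ T : ℝ, ∃ ρ : ℝ, ∀ t z, |t| ≤ T → ρ < ‖z‖ → f (z, t) = 0
  initial : ∀ z, f (z, 0) = D.toFun z
  equation : ∀ t z, fderiv ℝ f (z, t) ((z.2, S.totalForce (fun z => f (z, t)) z), 1)
    = (d * S.drag (fun z => f (z, t)) z.1) * f (z, t)
  hasDerivAt : ∀ t, HasDerivAt Z (S.meanField D.labelMeasure D.weight (Z t)) t
  integral_smul : ∀ (F : Type) [NormedAddCommGroup F] [NormedSpace ℝ F] (h : Phase d → F),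
    ContDiff ℝ 1 h → ∀ t, ∫ z, f (z, t) • h z = ∫ a, D.weight a • h (Z t a) ∂D.labelMeasure

lemma hasMoments_of_support {d : ℕ} {g : Phase d → ℝ} (hg : Continuous g) {ρ : ℝ}
    (hρ : ∀ z, ρ < ‖z‖ → g z = 0) : HasMoments g := by
  have hcs : HasCompactSupport g :=
    HasCompactSupport.of_support_subset_isCompact (isCompact_closedBall (0 : Phase d) ρ)
      fun z hz => by
        by_contra h
        exact hz (hρ z (by simpa using h))
  exact (weight_contDiff.continuous.mul hg).integrable_of_hasCompactSupport hcs.mul_left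

/-- The configuration `Z` determines the coefficients of a linear transport equation; its solution
is the push-forward of the datum, so its own force has these coefficients. -/
theorem exists_isLagrangianSolution {d : ℕ} (S : Model) (D : InitialDatum d) :
    ∃ f Z, IsLagrangianSolution S D f Z := by
  obtain ⟨Z, hZ0, hZ⟩ := (Model.isGlobalField_meanField (S := S) (d := d)
    (ν := D.labelMeasure) (w := D.weight)).exists_solution 0 D.position
  obtain ⟨X, W, hX, hXZ⟩ := Model.exists_isTransportFlow_meanField hZ
  set A : ℝ → Vec d → Vec d := fun t x => S.meanForce D.labelMeasure D.weight (Z t) (x, 0) with hA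
  set r : ℝ → Vec d → ℝ := fun t x => S.meanDrag D.labelMeasure D.weight (Z t) x with hr
  have hAc : ∀ t, Continuous (A t) := fun t =>
    (Model.continuous_meanForce (Z t)).comp
      (by fun_prop : Continuous fun x : Vec d => (x, (0 : Vec d)))
  have hrc : ∀ t, Continuous (r t) := fun t => Model.continuous_meanDrag (Z t)
  set f := transported D.toFun X W with hf
  have hfc := transported_contDiff hX D.contDiff
  have hpush : ∀ (F : Type) [NormedAddCommGroup F] [NormedSpace ℝ F] (h : Phase d → F),
      ContDiff ℝ 1 h → ∀ t, ∫ z, f (z, t) • h z = ∫ a, D.weight a • h (Z t a) ∂D.labelMeasure := by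
    intro F _ _ h hh t
    rw [integral_transported_smul hX hAc hrc D.contDiff D.hasCompactSupport hh t,
      ← D.integral_label fun z => h (X 0 t z)]
    refine integral_congr_ae (Eventually.of_forall fun a => ?_)
    have := hXZ t a
    rw [hZ0] at this
    simp only [← this]
    rfl
  refine ⟨f, Z, hfc, fun T => exists_transported_eq_zero hX D.hasCompactSupport T,
    transported_zero hX, fun t z => ?_, hZ, hpush⟩
  have hk : ContDiff ℝ 1 fun z' : Phase d => S.kernel z z' := by
    have h1 := S.kernel_contDiff (d := d)
    have h2 : ContDiff ℝ 1 fun z' : Phase d => (z, z') := by fun_prop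
    have h3 := h1.comp h2
    exact h3
  have hφ : ContDiff ℝ 1 fun z' : Phase d => S.lamV * S.φ ‖z.1 - z'.1‖ := by
    have h1 := S.rate_contDiff (d := d)
    have h2 : ContDiff ℝ 1 fun z' : Phase d => (z, z') := by fun_prop
    have h3 := h1.comp h2
    exact contDiff_const.mul h3
  have hforce : S.totalForce (fun z => f (z, t)) z = A t z.1 - r t z.1 • z.2 := by
    have h1 : S.totalForce (fun z => f (z, t)) z = S.meanForce D.labelMeasure D.weight (Z t) z :=
      hpush (Vec d) (fun z' => S.kernel z z') hk t
    rw [h1]; exact Model.meanForce_eq (Z t) z.1 z.2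
  have hdrag : S.drag (fun z => f (z, t)) z.1 = r t z.1 :=
    hpush ℝ (fun z' => S.lamV * S.φ ‖z.1 - z'.1‖) hφ t
  have h1 := fderiv_transported_smul hX D.contDiff (h := fun _ : Phase d => (1 : ℝ))
    contDiff_const 0 t z
  simp only [smul_eq_mul, mul_one] at h1
  rw [hforce, hdrag]
  exact h1

section TimeInterval

variable {T : EReal}

lemma mem_timeInterval_of_le {s t : ℝ} (hs : 0 ≤ s) (hst : s ≤ t) (ht : t ∈ timeInterval T) :
    s ∈ timeInterval T :=
  ⟨hs, lt_of_le_of_lt (EReal.coe_le_coe_iff.2 hst) ht.2⟩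

lemma exists_gt_mem_timeInterval {t : ℝ} (ht : t ∈ timeInterval T) :
    ∃ b ∈ timeInterval T, t < b := by
  obtain ⟨b, hb1, hb2⟩ := EReal.lt_iff_exists_real_btwn.1 ht.2
  have h := EReal.coe_lt_coe_iff.1 hb1
  exact ⟨b, ⟨ht.1.trans h.le, hb2⟩, h⟩

lemma zero_mem_timeInterval (hT : 0 < T) : (0 : ℝ) ∈ timeInterval T := ⟨le_rfl, by simpa using hT⟩

lemma Ioo_subset_interior_timeInterval {b : ℝ} (hb : b ∈ timeInterval T) :
    Ioo 0 b ⊆ interior (timeInterval T) :=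
  interior_maximal (fun _ hs => mem_timeInterval_of_le hs.1.le hs.2.le hb) isOpen_Ioo

lemma uniqueDiffOn_timeInterval (hT : 0 < T) : UniqueDiffOn ℝ (timeInterval T) := by
  have hc : OrdConnected (timeInterval T) :=
    ⟨fun s hs t ht u hu => mem_timeInterval_of_le (hs.1.trans hu.1) hu.2 ht⟩
  refine uniqueDiffOn_convex hc.convex ?_
  obtain ⟨b, hb, h0⟩ := exists_gt_mem_timeInterval (zero_mem_timeInterval hT)
  exact ⟨b / 2, Ioo_subset_interior_timeInterval hb ⟨by linarith, by linarith⟩⟩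

end TimeInterval

lemma IsLagrangianSolution.hasMoments {d : ℕ} {S : Model} {D : InitialDatum d}
    {f : Phase d × ℝ → ℝ} {Z : ℝ → C(D.Label, Phase d)} (h : IsLagrangianSolution S D f Z) (t : ℝ) :
    HasMoments fun z => f (z, t) := by
  obtain ⟨ρ, hρ⟩ := h.support |t|
  have := h.contDiff.continuous
  exact hasMoments_of_support (by fun_prop) fun z hz => hρ t z le_rfl hz

theorem IsLagrangianSolution.isClassicalSolution {d : ℕ} {S : Model} {D : InitialDatum d}
    {f : Phase d × ℝ → ℝ} {Z : ℝ → C(D.Label, Phase d)} (h : IsLagrangianSolution S D f Z)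
    {T : EReal} (hT : 0 < T) :
    IsClassicalSolution S.lamX S.lamV S.lamW S.φ (fun x v => D.toFun (x, v)) T
      (fun x v t => f ((x, v), t)) where
  contDiffOn := h.contDiff.contDiffOn
  integrable t _ := h.hasMoments t
  moments_bounded b hb := by
    obtain ⟨ρ, hρ⟩ := h.support b
    have hfc := h.contDiff.continuous
    obtain ⟨M, hM⟩ := ((isCompact_closedBall (0 : Phase d) ρ).prod
      (isCompact_Icc (a := 0) (b := b))).exists_bound_of_continuousOn
      (f := fun p => weight p.1 * |f p|)
      ((weight_contDiff.continuous.comp continuous_fst).mul hfc.abs).continuousOn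
    refine ⟨∫ z, (closedBall (0 : Phase d) ρ).indicator (fun _ => M) z, fun t ht htb => ?_⟩
    have ht' : |t| ≤ b := by rw [abs_of_nonneg ht.1]; exact htb
    refine integral_mono_of_nonneg (Eventually.of_forall fun z => by positivity) ?_
      (Eventually.of_forall fun z => ?_)
    · rw [integrable_indicator_iff measurableSet_closedBall]
      exact integrableOn_const measure_closedBall_lt_top.ne
    · by_cases hz : z ∈ closedBall (0 : Phase d) ρ
      · rw [indicator_of_mem hz]
        exact (le_abs_self _).trans (hM (z, t) ⟨hz, ht.1, htb⟩)
      · have : f (z, t) = 0 := hρ t z ht' (by simpa using hz)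
        simp [indicator_of_notMem hz, this]
  equation t ht x v := by
    have hm := h.hasMoments t
    have hQ : ∀ w, force S.lamX S.lamV S.lamW S.φ (fun y u => f ((y, u), t)) x w
        = S.totalForce (fun z => f (z, t)) (x, 0) - S.drag (fun z => f (z, t)) x • w := fun w => by
      rw [S.force_eq_totalForce (g := fun y u => f ((y, u), t)) hm, S.totalForce_eq hm]
    have h1 := kinetic_terms_eq (g := fun x v t => f ((x, v), t)) (x := x) (v := v)
      (uniqueDiffOn_timeInterval hT t ht)
      (h.contDiff.differentiable one_ne_zero ((x, v), t)) hQ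
    rw [h1]
    have h2 := h.equation t (x, v)
    rw [S.totalForce_eq hm] at h2
    exact sub_eq_zero.2 h2
  initial x v := h.initial (x, v)

/-! ### Uniqueness of classical solutions -/

/-- Grönwall's inequality for a real function with a constant `K` of either sign. -/
lemma le_mul_exp_of_deriv_le {J J' : ℝ → ℝ} {b K : ℝ} (hc : ContinuousOn J (Icc 0 b))
    (hd : ∀ t ∈ Ioo 0 b, HasDerivAt J (J' t) t) (hJ : ∀ t ∈ Ioo 0 b, J' t ≤ K * J t)
    {t : ℝ} (ht : t ∈ Icc 0 b) : J t ≤ J 0 * Real.exp (K * t) := by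
  have hd' : ∀ s ∈ Ioo 0 b, HasDerivAt (fun s => J s * Real.exp (-(K * s)))
      (J' s * Real.exp (-(K * s)) + J s * (Real.exp (-(K * s)) * -K)) s := fun s hs =>
    (hd s hs).mul (((hasDerivAt_id s).const_mul K).neg.exp.congr_deriv (by simp))
  have hanti : AntitoneOn (fun s => J s * Real.exp (-(K * s))) (Icc 0 b) := by
    refine antitoneOn_of_deriv_nonpos (convex_Icc 0 b)
      (hc.mul (by fun_prop)) ?_ ?_
    · rw [interior_Icc]
      exact fun s hs => (hd' s hs).differentiableAt.differentiableWithinAt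
    · rw [interior_Icc]
      intro s hs
      rw [(hd' s hs).deriv]
      nlinarith [Real.exp_pos (-(K * s)), hJ s hs]
  have h1 := hanti (left_mem_Icc.2 (ht.1.trans ht.2)) ht ht.1
  simp only [mul_zero, neg_zero, Real.exp_zero, mul_one] at h1
  have h2 : Real.exp (-(K * t)) * Real.exp (K * t) = 1 := by rw [← Real.exp_add]; simp
  calc J t = J t * Real.exp (-(K * t)) * Real.exp (K * t) := by rw [mul_assoc, h2, mul_one]
    _ ≤ J 0 * Real.exp (K * t) := by gcongr

section Uniqueness

variable {d : ℕ} {T : EReal}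

lemma hasCompactSupport_of_norm {F : Type*} [Zero F] {g : Phase d → F} {ρ : ℝ}
    (hρ : ∀ z, ρ < ‖z‖ → g z = 0) : HasCompactSupport g :=
  HasCompactSupport.of_support_subset_isCompact (isCompact_closedBall (0 : Phase d) ρ)
    fun z hz => by
      by_contra h
      exact hz (hρ z (by simpa using h))

/-- A nonnegative density that vanishes initially and whose mass production along the
characteristics is controlled by its mass vanishes at all times. -/
lemma eq_zero_of_transport_le {G : Phase d × ℝ → ℝ}
    (hG : ContDiffOn ℝ 1 G (univ ×ˢ timeInterval T)) {b : ℝ} (hb : b ∈ timeInterval T) {ρ K : ℝ}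
    (hs : ∀ t ∈ Icc 0 b, ∀ z, ρ < ‖z‖ → G (z, t) = 0) (h0 : ∀ p, 0 ≤ G p)
    (hi : ∀ z, G (z, 0) = 0) {A : ℝ → Vec d → Vec d} {r : ℝ → Vec d → ℝ}
    (hA : ∀ t ∈ Ioo 0 b, Continuous (A t)) (hr : ∀ t ∈ Ioo 0 b, Continuous (r t))
    (hle : ∀ t ∈ Ioo 0 b, ∫ z, (fderiv ℝ G (z, t) ((z.2, A t z.1 - r t z.1 • z.2), 1)
        - ((d : ℝ) * r t z.1) • G (z, t)) ≤ K * ∫ z, G (z, t)) :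
    ∀ t ∈ Icc 0 b, ∀ z, G (z, t) = 0 := by
  intro t ht z
  have hsub : Icc 0 b ⊆ timeInterval T := fun s hs => mem_timeInterval_of_le hs.1 hs.2 hb
  have hGc : ContinuousOn G (univ ×ˢ timeInterval T) := hG.continuousOn
  have hJc : ContinuousOn (fun t => ∫ z, G (z, t)) (Icc 0 b) := by
    refine continuousOn_integral_of_compact_support (f := fun t z => G (z, t))
      (isCompact_closedBall (0 : Phase d) ρ) ?_ fun s z hs' hz => hs s hs' z (by simpa using hz)
    exact hGc.comp (by fun_prop) fun p hp => ⟨mem_univ _, hsub hp.1⟩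
  have h1 := le_mul_exp_of_deriv_le hJc (fun s hs' => hasDerivAt_integral_transport isOpen_Ioo
    (hG.mono (prod_mono_right (Ioo_subset_Icc_self.trans hsub)))
    (fun s hs' => hs s (Ioo_subset_Icc_self hs')) hs' (hA s hs') (hr s hs')) hle ht
  simp only [hi, integral_zero, zero_mul] at h1
  have hslice : Continuous fun z => G (z, t) :=
    hGc.comp_continuous (by fun_prop) fun z => ⟨mem_univ _, hsub ht⟩
  by_contra hz
  have := hslice.integral_pos_of_hasCompactSupport_nonneg_nonzero (μ := volume)
    (hasCompactSupport_of_norm (hs t ht)) (fun z => h0 _) hz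
  linarith

/-- A density which satisfies the kinetic equation along the field of its own force. -/
structure IsDensitySolution (S : Model) (T : EReal) (u : Phase d × ℝ → ℝ) : Prop where
  contDiffOn : ContDiffOn ℝ 1 u (univ ×ˢ timeInterval T)
  hasMoments : ∀ t ∈ timeInterval T, HasMoments fun z => u (z, t)
  bounded : ∀ b ∈ timeInterval T, ∃ B : ℝ, ∀ t ∈ timeInterval T, t ≤ b →
    ∫ z, weight z * |u (z, t)| ≤ B
  equation : ∀ t ∈ interior (timeInterval T), ∀ z,
    fderiv ℝ u (z, t) ((z.2, S.totalForce (fun z => u (z, t)) (z.1, 0)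
      - S.drag (fun z => u (z, t)) z.1 • z.2), 1)
      = (d * S.drag (fun z => u (z, t)) z.1) * u (z, t)

/-- The Cauchy–Schwarz inequality. -/
lemma sq_integral_mul_le {α : Type*} [MeasurableSpace α] {μ : Measure α} {p q : α → ℝ}
    (hp : Integrable (fun a => p a ^ 2) μ) (hq : Integrable (fun a => q a ^ 2) μ)
    (hpq : Integrable (fun a => p a * q a) μ) :
    (∫ a, p a * q a ∂μ) ^ 2 ≤ (∫ a, p a ^ 2 ∂μ) * ∫ a, q a ^ 2 ∂μ := by
  have h := discrim_le_zero (a := ∫ a, p a ^ 2 ∂μ) (b := 2 * ∫ a, p a * q a ∂μ)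
    (c := ∫ a, q a ^ 2 ∂μ) fun s => by
      have h1 : ∫ a, (s * p a + q a) ^ 2 ∂μ = (∫ a, p a ^ 2 ∂μ) * (s * s)
          + 2 * (∫ a, p a * q a ∂μ) * s + ∫ a, q a ^ 2 ∂μ := by
        have h2 : ∀ a, (s * p a + q a) ^ 2 = s * s * p a ^ 2 + 2 * s * (p a * q a) + q a ^ 2 :=
          fun a => by ring
        simp_rw [h2]
        rw [integral_add (f := fun a => s * s * p a ^ 2 + 2 * s * (p a * q a))
            ((hp.const_mul _).add (hpq.const_mul _)) hq,
          integral_add (hp.const_mul _) (hpq.const_mul _), integral_const_mul, integral_const_mul]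
        ring
      rw [← h1]
      exact integral_nonneg fun a => sq_nonneg _
  rw [discrim] at h
  nlinarith

lemma Model.drag_sub (S : Model) {g f : Phase d → ℝ} (hg : HasMoments g) (hf : HasMoments f)
    (x : Vec d) : S.drag g x - S.drag f x = S.drag (fun z => g z - f z) x := by
  unfold Model.drag
  rw [← integral_sub (S.integrable_drag hg x) (S.integrable_drag hf x)]
  simp_rw [sub_smul]

lemma Model.totalForce_sub (S : Model) {g f : Phase d → ℝ} (hg : HasMoments g)
    (hf : HasMoments f) (z : Phase d) :
    S.totalForce g z - S.totalForce f z = S.totalForce (fun z => g z - f z) z := by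
  unfold Model.totalForce
  rw [← integral_sub (S.integrable_kernel hg z) (S.integrable_kernel hf z)]
  simp_rw [sub_smul]

/-- The one-sided derivatives and the divergence in the kinetic equation combine to a derivative
along the characteristics, up to the divergence of the field. -/
lemma IsClassicalSolution.isDensitySolution {S : Model} {f₀ : Vec d → Vec d → ℝ}
    {g : Vec d → Vec d → ℝ → ℝ} (hT : 0 < T)
    (hg : IsClassicalSolution S.lamX S.lamV S.lamW S.φ f₀ T g) :
    IsDensitySolution S T fun p : Phase d × ℝ => g p.1.1 p.1.2 p.2 where
  contDiffOn := hg.contDiffOn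
  hasMoments := hg.integrable
  bounded := hg.moments_bounded
  equation t ht z := by
    have htI := interior_subset ht
    have hm : HasMoments fun z : Phase d => g z.1 z.2 t := hg.integrable t htI
    have hQ : ∀ w, force S.lamX S.lamV S.lamW S.φ (fun y u => g y u t) z.1 w
        = S.totalForce (fun z => g z.1 z.2 t) (z.1, 0)
          - S.drag (fun z => g z.1 z.2 t) z.1 • w := fun w => by
      rw [S.force_eq_totalForce (g := fun y u => g y u t) hm, S.totalForce_eq hm]
    have hd : DifferentiableAt ℝ (fun p : Phase d × ℝ => g p.1.1 p.1.2 p.2) ((z.1, z.2), t) :=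
      (hg.contDiffOn.differentiableOn one_ne_zero).differentiableAt
        (prod_mem_nhds univ_mem (mem_interior_iff_mem_nhds.1 ht))
    have h1 := kinetic_terms_eq (uniqueDiffOn_timeInterval hT t htI) hd hQ
    rw [hg.equation t htI z.1 z.2] at h1
    exact (sub_eq_zero.1 h1.symm)

variable {S : Model} {u : Phase d × ℝ → ℝ}

/-- The derivative of the weight in the direction `(y, q)`. -/
lemma hasDerivAt_weight_line (x v y q : Vec d) :
    HasDerivAt (fun s : ℝ => weight ((x, v) + s • (y, q)))
      (2 * inner ℝ x y + 2 * inner ℝ v q) 0 := by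
  have h1 : ∀ a b : Vec d, HasDerivAt (fun s : ℝ => ‖a + s • b‖ ^ 2) (2 * inner ℝ a b) 0 := by
    intro a b
    have h2 : HasDerivAt (fun s : ℝ => a + s • b) b 0 := by
      simpa using ((hasDerivAt_id (0 : ℝ)).smul_const b).const_add a
    simpa using h2.norm_sq
  exact ((h1 x y).const_add 1).add (h1 v q)

/-- A field of linear growth changes the logarithm of the weight at a bounded rate. -/
lemma abs_weight_rate_le {z : Phase d} {q : Vec d} {C : ℝ} (hC : 0 ≤ C)
    (hq : ‖q‖ ≤ C * (1 + ‖z‖)) :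
    |2 * inner ℝ z.1 z.2 + 2 * inner ℝ z.2 q| ≤ (2 + 4 * C) * weight z := by
  have h1 := abs_real_inner_le_norm z.1 z.2
  have h2 := abs_real_inner_le_norm z.2 q
  have h3 : |2 * inner ℝ z.1 z.2 + 2 * inner ℝ z.2 q|
      ≤ 2 * |inner ℝ z.1 z.2| + 2 * |inner ℝ z.2 q| := by
    refine (abs_add_le _ _).trans ?_
    rw [abs_mul, abs_mul, abs_two]
  have h4 : ‖z.1‖ * ‖z.2‖ ≤ weight z := by
    unfold weight
    nlinarith [sq_nonneg (‖z.1‖ - ‖z.2‖), sq_nonneg ‖z.1‖, sq_nonneg ‖z.2‖]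
  have hz2 := norm_snd_le z
  have h5 : ‖z‖ ^ 2 ≤ weight z := by
    unfold weight
    rcases max_choice ‖z.1‖ ‖z.2‖ with h | h <;> rw [Prod.norm_def, h] <;>
    nlinarith [sq_nonneg ‖z.1‖, sq_nonneg ‖z.2‖]
  have h6 : ‖z.2‖ * ‖q‖ ≤ 2 * C * weight z := by
    calc ‖z.2‖ * ‖q‖ ≤ ‖z‖ * (C * (1 + ‖z‖)) :=
          mul_le_mul hz2 hq (norm_nonneg _) (norm_nonneg _)
      _ = C * (‖z‖ + ‖z‖ ^ 2) := by ring
      _ ≤ C * (weight z + weight z) := by gcongr; exact norm_le_weight z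
      _ = 2 * C * weight z := by ring
  linarith

/-- The support of a classical solution with compactly supported initial datum stays bounded on
compact time intervals. The squared density is tested against a cutoff which is nonincreasing
along the characteristics and lives in an annulus; letting the outer radius grow shows that the
density vanishes where the weight is large. -/
theorem IsDensitySolution.exists_eq_zero (hu : IsDensitySolution S T u)
    {ρ₀ : ℝ} (hρ₀ : ∀ z, ρ₀ < weight z → u (z, 0) = 0) {b : ℝ} (hb : b ∈ timeInterval T) :
    ∃ ρ : ℝ, ∀ t ∈ Icc 0 b, ∀ z, ρ < ‖z‖ → u (z, t) = 0 := by
  obtain ⟨B, hB⟩ := hu.bounded b hb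
  have hB0 : 0 ≤ B := (integral_nonneg fun z =>
    mul_nonneg (weight_pos z).le (abs_nonneg _)).trans (hB b hb le_rfl)
  have hsub : Icc 0 b ⊆ timeInterval T := fun s hs => mem_timeInterval_of_le hs.1 hs.2 hb
  set C := 2 + 4 * (S.growth * B) with hC
  have hgr := S.growth_nonneg
  have hC0 : 0 ≤ C := by positivity
  set η := expNegInvGlue with hη
  have hηc : ContDiff ℝ 1 η := expNegInvGlue.contDiff (n := 1)
  have hηd : ∀ s, HasDerivAt η (deriv η s) s := fun s =>
    (hηc.differentiable one_ne_zero s).hasDerivAt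
  have hηd0 : ∀ s, 0 ≤ deriv η s := fun s => expNegInvGlue.monotone.deriv_nonneg
  have hη0 : ∀ s, 0 ≤ η s := expNegInvGlue.nonneg
  refine ⟨ρ₀ * Real.exp (C * b) ⊔ 0, fun t₁ ht₁ z₁ hz₁ => ?_⟩
  -- the outer radius is chosen so that the point under consideration lies inside
  set R := weight z₁ * Real.exp (C * t₁) + 1 with hR
  set ψ : Phase d × ℝ → ℝ := fun p => η (weight p.1 * Real.exp (-(C * p.2)) - ρ₀)
    * η (R - weight p.1 * Real.exp (C * p.2)) with hψ
  have hψc : ContDiff ℝ 1 ψ := by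
    have hw : ContDiff ℝ 1 fun p : Phase d × ℝ => weight p.1 := weight_contDiff.comp contDiff_fst
    have he : ∀ c : ℝ, ContDiff ℝ 1 fun p : Phase d × ℝ => Real.exp (c * p.2) := fun c =>
      Real.contDiff_exp.comp (contDiff_const.mul contDiff_snd)
    have he' := he (-C)
    simp only [neg_mul] at he'
    exact (hηc.comp ((hw.mul he').sub contDiff_const)).mul
      (hηc.comp (contDiff_const.sub (hw.mul (he C))))
  have hψ0 : ∀ p, 0 ≤ ψ p := fun p => mul_nonneg (hη0 _) (hη0 _)
  set G : Phase d × ℝ → ℝ := fun p => u p ^ 2 * ψ p with hG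
  have hzero := eq_zero_of_transport_le (G := G) (T := T) (b := b) (ρ := R)
    (K := d * (S.lamV * S.φ 0 * B))
    (A := fun t x => S.totalForce (fun z => u (z, t)) (x, 0))
    (r := fun t x => S.drag (fun z => u (z, t)) x)
    ((hu.contDiffOn.pow 2).mul hψc.contDiffOn) hb ?_ ?_ ?_ ?_ ?_ ?_ t₁ ht₁ z₁
  · -- at the chosen point the cutoff is positive
    have h1 : 0 < η (R - weight z₁ * Real.exp (C * t₁)) := expNegInvGlue.pos_of_pos (by simp [hR])
    have h2 : 0 < η (weight z₁ * Real.exp (-(C * t₁)) - ρ₀) := by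
      refine expNegInvGlue.pos_of_pos ?_
      have h3 : ρ₀ * Real.exp (C * b) < weight z₁ :=
        ((le_max_left _ _).trans_lt hz₁).trans_le (norm_le_weight z₁)
      have h4 : Real.exp (C * t₁) ≤ Real.exp (C * b) :=
        Real.exp_le_exp.2 (mul_le_mul_of_nonneg_left ht₁.2 hC0)
      have h5 : Real.exp (-(C * t₁)) * Real.exp (C * t₁) = 1 := by rw [← Real.exp_add]; simp
      have h6 : ρ₀ * Real.exp (C * t₁) < weight z₁ := by
        rcases le_total 0 ρ₀ with h | h
        · exact (mul_le_mul_of_nonneg_left h4 h).trans_lt h3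
        · exact (mul_nonpos_of_nonpos_of_nonneg h (Real.exp_pos _).le).trans_lt (weight_pos z₁)
      have h7 := mul_lt_mul_of_pos_right h6 (Real.exp_pos (-(C * t₁)))
      rw [mul_assoc, mul_comm (Real.exp (C * t₁)), h5, mul_one] at h7
      exact sub_pos.2 h7
    have h3 : u (z₁, t₁) ^ 2 * ψ (z₁, t₁) = 0 := hzero
    rcases mul_eq_zero.1 h3 with h | h
    · exact pow_eq_zero_iff two_ne_zero |>.1 h
    · exact absurd h (mul_pos h2 h1).ne'
  · intro t ht z hz
    have h1 : R - weight z * Real.exp (C * t) ≤ 0 := by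
      have h2 := norm_le_weight z
      have h3 : 1 ≤ Real.exp (C * t) := Real.one_le_exp (mul_nonneg hC0 ht.1)
      nlinarith [weight_pos z]
    simp [hG, hψ, hη, expNegInvGlue.zero_of_nonpos h1]
  · exact fun p => mul_nonneg (sq_nonneg _) (hψ0 p)
  · intro z
    by_cases hz : ρ₀ < weight z
    · simp [hG, hρ₀ z hz]
    · have h1 : weight z - ρ₀ ≤ 0 := by linarith
      simp [hG, hψ, hη, expNegInvGlue.zero_of_nonpos h1]
  · exact fun t ht => (S.continuous_totalForce
      (hu.hasMoments t (hsub (Ioo_subset_Icc_self ht)))).comp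
      (by fun_prop : Continuous fun x : Vec d => (x, (0 : Vec d)))
  · exact fun t ht => S.continuous_drag (hu.hasMoments t (hsub (Ioo_subset_Icc_self ht)))
  · intro t ht
    have htI := hsub (Ioo_subset_Icc_self ht)
    have hm := hu.hasMoments t htI
    have hBt := hB t htI ht.2.le
    have hint := Ioo_subset_interior_timeInterval hb ht
    have hslice : ContDiff ℝ 1 fun z => G (z, t) := by
      rw [← contDiffOn_univ]
      exact ((hu.contDiffOn.pow 2).mul hψc.contDiffOn).comp
        (contDiff_prodMk_left t).contDiffOn fun z _ => ⟨mem_univ _, htI⟩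
    have hcs : HasCompactSupport fun z => G (z, t) :=
      hasCompactSupport_of_norm (ρ := R) fun z hz => by
        have h1 : R - weight z * Real.exp (C * t) ≤ 0 := by
          have h2 := norm_le_weight z
          have h3 : 1 ≤ Real.exp (C * t) := Real.one_le_exp (mul_nonneg hC0 ht.1.le)
          nlinarith [weight_pos z]
        simp [hG, hψ, hη, expNegInvGlue.zero_of_nonpos h1]
    have hGi : Integrable fun z => G (z, t) :=
      hslice.continuous.integrable_of_hasCompactSupport hcs
    have hpt : ∀ z : Phase d, fderiv ℝ G (z, t) ((z.2, S.totalForce (fun z => u (z, t)) (z.1, 0)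
        - S.drag (fun z => u (z, t)) z.1 • z.2), 1)
        - ((d : ℝ) * S.drag (fun z => u (z, t)) z.1) • G (z, t)
        ≤ d * (S.lamV * S.φ 0 * B) * G (z, t) := by
      intro z
      set q := S.totalForce (fun z => u (z, t)) (z.1, 0)
        - S.drag (fun z => u (z, t)) z.1 • z.2 with hq
      set r := S.drag (fun z => u (z, t)) z.1 with hr
      have hqn : ‖q‖ ≤ S.growth * B * (1 + ‖z‖) := by
        rw [hq, ← S.totalForce_eq hm]
        refine (S.norm_totalForce_le hm z).trans ?_
        calc S.growth * (1 + ‖z‖) * ∫ z', weight z' * |u (z', t)|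
            ≤ S.growth * (1 + ‖z‖) * B := by gcongr
          _ = S.growth * B * (1 + ‖z‖) := by ring
      have hrate := abs_weight_rate_le (by positivity) hqn
      rw [← hC, abs_le] at hrate
      have hrB : r ≤ S.lamV * S.φ 0 * B := by
        have h1 := (le_abs_self _).trans (S.abs_drag_le hm z.1)
        have h2 : 0 ≤ S.lamV * S.φ 0 := mul_nonneg S.lamV_pos.le (S.rate.nonneg 0)
        exact h1.trans (mul_le_mul_of_nonneg_left hBt h2)
      -- differentiate along a line with the direction of the field
      have hline : HasDerivAt (fun s : ℝ => (z + s • ((z.2, q) : Phase d), t + s)) ((z.2, q), 1)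
          0 := by
        refine HasDerivAt.prodMk ?_ ?_
        · simpa using ((hasDerivAt_id (0 : ℝ)).smul_const ((z.2, q) : Phase d)).const_add z
        · simpa using (hasDerivAt_id (0 : ℝ)).const_add t
      have hO : univ ×ˢ timeInterval T ∈ 𝓝 (z, t) :=
        prod_mem_nhds univ_mem (mem_interior_iff_mem_nhds.1 hint)
      have hu1 : HasFDerivAt u (fderiv ℝ u (z, t)) (z + (0 : ℝ) • ((z.2, q) : Phase d), t + 0) := by
        simpa using ((hu.contDiffOn.differentiableOn one_ne_zero).differentiableAt hO).hasFDerivAt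
      have hG1 : HasFDerivAt G (fderiv ℝ G (z, t)) (z + (0 : ℝ) • ((z.2, q) : Phase d), t + 0) := by
        simpa using ((((hu.contDiffOn.pow 2).mul hψc.contDiffOn).differentiableOn
          one_ne_zero).differentiableAt hO).hasFDerivAt
      have hu2 := HasFDerivAt.comp_hasDerivAt (f := fun s : ℝ =>
        (z + s • ((z.2, q) : Phase d), t + s)) 0 hu1 hline
      have hG2 := HasFDerivAt.comp_hasDerivAt (f := fun s : ℝ =>
        (z + s • ((z.2, q) : Phase d), t + s)) 0 hG1 hline
      have hw2 := hasDerivAt_weight_line z.1 z.2 z.2 q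
      set w' := 2 * inner ℝ z.1 z.2 + 2 * inner ℝ z.2 q with hw'
      have he : ∀ c : ℝ, HasDerivAt (fun s : ℝ => Real.exp (c * (t + s)))
          (Real.exp (c * (t + 0)) * (c * 1)) 0 := fun c =>
        (((hasDerivAt_id (0 : ℝ)).const_add t).const_mul c).exp
      have he1 := (hw2.mul (he (-C))).sub_const ρ₀
      have he2 := (hw2.mul (he C)).const_sub R
      have hψ1 := (HasDerivAt.comp (0 : ℝ) (hηd _) he1).mul (HasDerivAt.comp (0 : ℝ) (hηd _) he2)
      have hG3 := (hu2.pow 2).mul hψ1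
      have hG4 := hG3.congr_of_eventuallyEq
        (f₁ := G ∘ fun s : ℝ => (z + s • ((z.2, q) : Phase d), t + s))
        (Eventually.of_forall fun s => by simp [hG, hψ])
      rw [hG2.unique hG4, hu.equation t hint z]
      simp only [Function.comp, zero_smul, add_zero, Pi.mul_apply, Pi.pow_apply, smul_eq_mul,
        mul_one, neg_mul, Prod.mk.eta]
      set a1 := η (weight z * Real.exp (-(C * t)) - ρ₀) with ha1
      set a2 := η (R - weight z * Real.exp (C * t)) with ha2
      set b1 := deriv η (weight z * Real.exp (-(C * t)) - ρ₀) with hb1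
      set b2 := deriv η (R - weight z * Real.exp (C * t)) with hb2
      have hGv : G (z, t) = u (z, t) ^ 2 * (a1 * a2) := rfl
      have k1 : 0 ≤ a1 := hη0 _
      have k2 : 0 ≤ a2 := hη0 _
      have k3 : 0 ≤ b1 := hηd0 _
      have k4 : 0 ≤ b2 := hηd0 _
      have k5 := (Real.exp_pos (-(C * t))).le
      have k6 := (Real.exp_pos (C * t)).le
      have m1 : 0 ≤ u (z, t) ^ 2 * (b1 * a2 * (Real.exp (-(C * t)) * (C * weight z - w'))) := by
        have : 0 ≤ C * weight z - w' := by linarith [hrate.2]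
        positivity
      have m2 : 0 ≤ u (z, t) ^ 2 * (a1 * b2 * (Real.exp (C * t) * (C * weight z + w'))) := by
        have : 0 ≤ C * weight z + w' := by linarith [hrate.1]
        positivity
      have m3 : d * r * (u (z, t) ^ 2 * (a1 * a2))
          ≤ d * (S.lamV * S.φ 0 * B) * (u (z, t) ^ 2 * (a1 * a2)) := by
        gcongr
      rw [hGv]
      push_cast
      linarith
    by_cases hfi : Integrable fun z : Phase d => fderiv ℝ G (z, t)
        ((z.2, S.totalForce (fun z => u (z, t)) (z.1, 0)
        - S.drag (fun z => u (z, t)) z.1 • z.2), 1)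
        - ((d : ℝ) * S.drag (fun z => u (z, t)) z.1) • G (z, t)
    · rw [← integral_const_mul]
      exact integral_mono hfi (hGi.const_mul _) hpt
    · rw [integral_undef hfi]
      have h1 : 0 ≤ S.lamV * S.φ 0 := mul_nonneg S.lamV_pos.le (S.rate.nonneg 0)
      have h2 : 0 ≤ ∫ z, G (z, t) := integral_nonneg fun z => mul_nonneg (sq_nonneg _) (hψ0 _)
      positivity

/-- Two densities which solve the kinetic equation, one of them with global regularity, and which
agree initially, agree. The derivative of the `L²` distance is controlled by a Grönwall estimate:
on the common compact support, the difference of the forces is bounded by that distance. -/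
theorem IsDensitySolution.eq_of_initial {g f : Phase d × ℝ → ℝ} (hg : IsDensitySolution S T g)
    (hf : IsDensitySolution S T f) (hfc : ContDiff ℝ 1 f) {ρ₀ : ℝ}
    (hρ₀ : ∀ z, ρ₀ < weight z → f (z, 0) = 0) (hi : ∀ z, g (z, 0) = f (z, 0)) {b : ℝ}
    (hb : b ∈ timeInterval T) (z : Phase d) : g (z, b) = f (z, b) := by
  obtain ⟨ρ₁, hρ₁⟩ := hg.exists_eq_zero (ρ₀ := ρ₀) (fun z hz => by rw [hi, hρ₀ z hz]) hb
  obtain ⟨ρ₂, hρ₂⟩ := hf.exists_eq_zero hρ₀ hb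
  obtain ⟨B, hB⟩ := hg.bounded b hb
  have hB0 : 0 ≤ B := (integral_nonneg fun z =>
    mul_nonneg (weight_pos z).le (abs_nonneg _)).trans (hB b hb le_rfl)
  have hsub : Icc 0 b ⊆ timeInterval T := fun s hs => mem_timeInterval_of_le hs.1 hs.2 hb
  set ρ := max (max ρ₁ ρ₂) 0 with hρ
  have hρ0 : 0 ≤ ρ := le_max_right _ _
  set D : Phase d × ℝ → ℝ := fun p => g p - f p with hD
  have hDs : ∀ t ∈ Icc 0 b, ∀ z, ρ < ‖z‖ → D (z, t) = 0 := fun t ht z hz => by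
    have h1 : max ρ₁ ρ₂ < ‖z‖ := (le_max_left _ _).trans_lt hz
    simp only [hD]
    rw [hρ₁ t ht z ((le_max_left _ _).trans_lt h1), hρ₂ t ht z ((le_max_right _ _).trans_lt h1),
      sub_zero]
  have hDc : ContDiffOn ℝ 1 D (univ ×ˢ timeInterval T) := hg.contDiffOn.sub hfc.contDiffOn
  have hK := (isCompact_closedBall (0 : Phase d) ρ).prod (isCompact_Icc (a := (0 : ℝ)) (b := b))
  obtain ⟨M₁, hM₁⟩ := hK.exists_bound_of_continuousOn hfc.continuous.continuousOn
  obtain ⟨M₂, hM₂⟩ := hK.exists_bound_of_continuousOn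
    (hfc.continuous_fderiv one_ne_zero).continuousOn
  set M := max (max M₁ M₂) 0 with hM
  have hM0 : 0 ≤ M := le_max_right _ _
  have hφ0 : 0 ≤ S.lamV * S.φ 0 := mul_nonneg S.lamV_pos.le (S.rate.nonneg 0)
  have hgr := S.growth_nonneg
  set w : Phase d → ℝ := (closedBall (0 : Phase d) ρ).indicator weight with hw
  have hw2 : Integrable fun z => w z ^ 2 := by
    have h1 : (fun z => w z ^ 2)
        = (closedBall (0 : Phase d) ρ).indicator fun z => weight z ^ 2 := by
      funext z
      by_cases hz : z ∈ closedBall (0 : Phase d) ρ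
      · simp only [hw, indicator_of_mem hz]
      · simp only [hw, indicator_of_notMem hz]; norm_num
    rw [h1, integrable_indicator_iff measurableSet_closedBall]
    exact ((weight_contDiff (d := d)).continuous.pow 2).continuousOn.integrableOn_compact
      (isCompact_closedBall _ _)
  set K₁ := d * (S.lamV * S.φ 0 * B) with hK₁
  set K₂ := 2 * (d * (S.lamV * S.φ 0) * M + M * (S.growth * (1 + ρ))) with hK₂
  have hK₂0 : 0 ≤ K₂ := by positivity
  have hzero := eq_zero_of_transport_le (G := fun p => D p ^ 2) (T := T) (b := b) (ρ := ρ)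
    (K := K₁ + K₂ * ∫ z, w z ^ 2)
    (A := fun t x => S.totalForce (fun z => g (z, t)) (x, 0))
    (r := fun t x => S.drag (fun z => g (z, t)) x)
    (hDc.pow 2) hb (fun t ht z hz => by simp only [hDs t ht z hz]; norm_num)
    (fun p => sq_nonneg _) (fun z => by simp [hD, hi]) ?_ ?_ ?_ b ⟨hb.1, le_rfl⟩ z
  · exact sub_eq_zero.1 ((pow_eq_zero_iff two_ne_zero).1 hzero)
  · exact fun t ht => (S.continuous_totalForce
      (hg.hasMoments t (hsub (Ioo_subset_Icc_self ht)))).comp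
      (by fun_prop : Continuous fun x : Vec d => (x, (0 : Vec d)))
  · exact fun t ht => S.continuous_drag (hg.hasMoments t (hsub (Ioo_subset_Icc_self ht)))
  intro t ht
  have htc := Ioo_subset_Icc_self ht
  have htI := hsub htc
  have hmg := hg.hasMoments t htI
  have hmf := hf.hasMoments t htI
  have hBt := hB t htI ht.2.le
  have hint := Ioo_subset_interior_timeInterval hb ht
  have hmD : HasMoments fun z => g (z, t) - f (z, t) :=
    (Integrable.sub hmg hmf).congr (Eventually.of_forall fun z => by simp [mul_sub])
  have hslice : Continuous fun z => D (z, t) :=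
    hDc.continuousOn.comp_continuous (by fun_prop) fun z => ⟨mem_univ _, htI⟩
  have hcs : HasCompactSupport fun z => D (z, t) := hasCompactSupport_of_norm (hDs t htc)
  have hD2i : Integrable fun z => D (z, t) ^ 2 :=
    (hslice.pow 2).integrable_of_hasCompactSupport
      (hasCompactSupport_of_norm (ρ := ρ) fun z hz => by
        rw [Pi.pow_apply, hDs t htc z hz]; norm_num)
  have hD1i : Integrable fun z => |D (z, t)| := (hslice.integrable_of_hasCompactSupport hcs).abs
  set N := ∫ z, weight z * |g (z, t) - f (z, t)| with hN
  have hN0 : 0 ≤ N := integral_nonneg fun z => mul_nonneg (weight_pos z).le (abs_nonneg _)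
  have hNi : Integrable fun z => weight z * |D (z, t)| :=
    (weight_contDiff.continuous.mul hslice.abs).integrable_of_hasCompactSupport
      (hasCompactSupport_of_norm (ρ := ρ) fun z hz => by
        rw [Pi.mul_apply, hDs t htc z hz, abs_zero, mul_zero])
  have hDN : ∫ z, |D (z, t)| ≤ N := integral_mono hD1i hNi fun z =>
    le_mul_of_one_le_left (abs_nonneg _) (one_le_weight z)
  have hweq : ∀ z, w z * |D (z, t)| = weight z * |D (z, t)| := fun z => by
    by_cases hz : z ∈ closedBall (0 : Phase d) ρ
    · simp only [hw, indicator_of_mem hz]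
    · rw [hDs t htc z (by simpa using hz)]; simp
  have hN2 : N ^ 2 ≤ (∫ z, w z ^ 2) * ∫ z, D (z, t) ^ 2 := by
    have h1 := sq_integral_mul_le (p := w) (q := fun z => |D (z, t)|) (μ := volume) hw2
      (by simpa only [sq_abs] using hD2i) (by simpa only [hweq] using hNi)
    simpa only [hweq, sq_abs] using h1
  have hpt : ∀ z : Phase d, fderiv ℝ (fun p => D p ^ 2) (z, t)
      ((z.2, S.totalForce (fun z => g (z, t)) (z.1, 0)
      - S.drag (fun z => g (z, t)) z.1 • z.2), 1)
      - ((d : ℝ) * S.drag (fun z => g (z, t)) z.1) • D (z, t) ^ 2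
      ≤ K₁ * D (z, t) ^ 2 + K₂ * N * |D (z, t)| := by
    intro z
    have hO : univ ×ˢ timeInterval T ∈ 𝓝 (z, t) :=
      prod_mem_nhds univ_mem (mem_interior_iff_mem_nhds.1 hint)
    have hg1 := ((hg.contDiffOn.differentiableOn one_ne_zero).differentiableAt hO).hasFDerivAt
    have hf1 := (hfc.differentiable one_ne_zero (z, t)).hasFDerivAt
    have heg := hg.equation t hint z
    have hef := hf.equation t hint z
    have hFr := S.drag_sub hmg hmf z.1
    have hFq := S.totalForce_sub hmg hmf z
    have hqg := S.totalForce_eq hmg z.1 z.2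
    have hqf := S.totalForce_eq hmf z.1 z.2
    simp only [Prod.mk.eta] at hqg hqf
    rw [← hqg] at heg ⊢
    rw [← hqf] at hef
    have hr1 := S.abs_drag_le hmg z.1
    have hr2 := S.abs_drag_le hmD z.1
    have hq2 := S.norm_totalForce_le hmD z
    rw [← hFr] at hr2
    rw [← hFq] at hq2
    set qg := S.totalForce (fun z => g (z, t)) z
    set qf := S.totalForce (fun z => f (z, t)) z
    set rg := S.drag (fun z => g (z, t)) z.1
    set rf := S.drag (fun z => f (z, t)) z.1
    have hsplit : (((z.2, qg), 1) : Phase d × ℝ)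
        = ((z.2, qf), 1) + (((0 : Vec d), qg - qf), 0) := by
      simp
    have hDd : fderiv ℝ (fun p => D p ^ 2) (z, t) ((z.2, qg), 1)
        = 2 * D (z, t) * (d * rg * g (z, t) - (d * rf * f (z, t)
          + fderiv ℝ f (z, t) (((0 : Vec d), qg - qf), 0))) := by
      have h1 := ((hg1.sub hf1).pow 2).fderiv
      have h2 : fderiv ℝ (fun p => D p ^ 2) (z, t) = _ := h1
      rw [h2]
      simp only [_root_.smul_apply, _root_.sub_apply, smul_eq_mul]
      rw [heg, hsplit, map_add, hef]
      simp [hD]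
    rw [hDd]
    by_cases hz : ρ < ‖z‖
    · rw [hDs t htc z hz]; simp
    push Not at hz
    have hmem : (z, t) ∈ closedBall (0 : Phase d) ρ ×ˢ Icc 0 b := ⟨by simpa using hz, htc⟩
    have hfM : |f (z, t)| ≤ M := (hM₁ _ hmem).trans ((le_max_left _ _).trans (le_max_left _ _))
    have hdM : ‖fderiv ℝ f (z, t)‖ ≤ M :=
      (hM₂ _ hmem).trans ((le_max_right _ _).trans (le_max_left _ _))
    have h1 : |fderiv ℝ f (z, t) (((0 : Vec d), qg - qf), 0)| ≤ M * (S.growth * (1 + ρ) * N) := by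
      rw [← Real.norm_eq_abs]
      refine (ContinuousLinearMap.le_opNorm _ _).trans ?_
      have h2 : ‖(((0 : Vec d), qg - qf), (0 : ℝ))‖ = ‖qg - qf‖ := by
        simp [Prod.norm_def]
      rw [h2]
      refine mul_le_mul hdM (hq2.trans ?_) (norm_nonneg _) hM0
      gcongr
    have h2 : |(d : ℝ) * (rg - rf) * f (z, t)| ≤ d * (S.lamV * S.φ 0 * N) * M := by
      rw [abs_mul, abs_mul, Nat.abs_cast]
      gcongr
    have h3 : rg ≤ S.lamV * S.φ 0 * B :=
      (le_abs_self _).trans (hr1.trans (mul_le_mul_of_nonneg_left hBt hφ0))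
    have h4 : d * rg * D (z, t) ^ 2 ≤ K₁ * D (z, t) ^ 2 := by
      rw [hK₁]; gcongr
    have h5 : 2 * D (z, t) * ((d : ℝ) * (rg - rf) * f (z, t)
        - fderiv ℝ f (z, t) (((0 : Vec d), qg - qf), 0)) ≤ K₂ * N * |D (z, t)| := by
      refine (le_abs_self _).trans ?_
      rw [abs_mul, abs_mul, abs_two]
      calc 2 * |D (z, t)| * |(d : ℝ) * (rg - rf) * f (z, t)
          - fderiv ℝ f (z, t) (((0 : Vec d), qg - qf), 0)|
          ≤ 2 * |D (z, t)| * (d * (S.lamV * S.φ 0 * N) * M + M * (S.growth * (1 + ρ) * N)) := by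
            gcongr
            exact (abs_sub _ _).trans (add_le_add h2 h1)
        _ = K₂ * N * |D (z, t)| := by rw [hK₂]; ring
    have h6 : g (z, t) = D (z, t) + f (z, t) := by simp [hD]
    rw [h6, smul_eq_mul]
    linarith
  have hW0 : 0 ≤ ∫ z, w z ^ 2 := integral_nonneg fun z => sq_nonneg _
  have hJ0 : 0 ≤ ∫ z, D (z, t) ^ 2 := integral_nonneg fun z => sq_nonneg _
  have hK₁0 : 0 ≤ K₁ := by positivity
  by_cases hfi : Integrable fun z : Phase d => fderiv ℝ (fun p => D p ^ 2) (z, t)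
      ((z.2, S.totalForce (fun z => g (z, t)) (z.1, 0)
      - S.drag (fun z => g (z, t)) z.1 • z.2), 1)
      - ((d : ℝ) * S.drag (fun z => g (z, t)) z.1) • D (z, t) ^ 2
  · refine (integral_mono hfi ((hD2i.const_mul _).add (hD1i.const_mul _)) hpt).trans ?_
    simp only [Pi.add_apply]
    rw [integral_add (hD2i.const_mul _) (hD1i.const_mul _), integral_const_mul, integral_const_mul]
    have h1 : K₂ * N * ∫ z, |D (z, t)| ≤ K₂ * N * N := by gcongr
    have h2 : K₂ * N ^ 2 ≤ K₂ * ((∫ z, w z ^ 2) * ∫ z, D (z, t) ^ 2) := by gcongr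
    linarith
  · rw [integral_undef hfi]
    positivity

end Uniqueness

/-! ### Decay of the energy functionals -/

/-- The balance equations and inequalities between the functionals of a solution: the spreads `X`
and `V` of position and velocity, their covariance `P`, the quadratic forms `a`, `b`, `c` of the
relative positions and velocities weighted with the communication rate, and the potential
energy `M`. -/
structure EnergyBalance (lamX lamV lamW : ℝ) (X V P a b c M : ℝ → ℝ) : Prop where
  hasDerivAt_X : ∀ t, HasDerivAt X (2 * P t) t
  hasDerivAt_V : ∀ t, HasDerivAt V (-2 * lamW * P t - lamX * b t - lamV * c t) t
  hasDerivAt_P : ∀ t, HasDerivAt P (V t - lamW * X t - lamX / 2 * a t - lamV / 2 * b t) t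
  hasDerivAt_M : ∀ t, HasDerivAt M (b t) t
  X_nonneg : ∀ t, 0 ≤ X t
  V_nonneg : ∀ t, 0 ≤ V t
  a_nonneg : ∀ t, 0 ≤ a t
  c_nonneg : ∀ t, 0 ≤ c t
  M_nonneg : ∀ t, 0 ≤ M t
  sq_P_le : ∀ t, P t ^ 2 ≤ X t * V t
  sq_b_le : ∀ t, b t ^ 2 ≤ a t * c t

/-- The comparison of the functionals if the communication rate takes values in `[φm, φM]`. -/
structure EnergyBounds (φm φM : ℝ) (X V a c M : ℝ → ℝ) : Prop where
  a_le : ∀ t, a t ≤ 2 * φM * X t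
  le_c : ∀ t, 2 * φm * V t ≤ c t
  c_le : ∀ t, c t ≤ 2 * φM * V t
  M_le : ∀ t, M t ≤ φM * X t

/-- The inequality between the arithmetic and the geometric mean, in the form used to absorb
mixed terms. -/
lemma abs_le_of_sq_le_mul {p x y z w : ℝ} (hp : p ^ 2 ≤ x * y) (hx : 0 ≤ x) (hy : 0 ≤ y)
    (hz : 0 < z) (hw : 0 < w) (hzw : 1 ≤ 4 * (z * w)) : |p| ≤ z * x + w * y := by
  refine abs_le_of_sq_le_sq ?_ (by positivity)
  nlinarith [sq_nonneg (z * x - w * y), mul_nonneg hx hy]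

section Decay

variable {lamX lamV lamW φm φM : ℝ} {X V P a b c M : ℝ → ℝ}

namespace EnergyBalance

/-- The herding energy is dissipated at the rate `λ_v c`. -/
lemma hasDerivAt_energy (h : EnergyBalance lamX lamV lamW X V P a b c M) (t : ℝ) :
    HasDerivAt (fun t => lamW * X t + V t + lamX * M t) (-(lamV * c t)) t :=
  ((((h.hasDerivAt_X t).const_mul lamW).add (h.hasDerivAt_V t)).add
    ((h.hasDerivAt_M t).const_mul lamX)).congr_deriv (by ring)

lemma energy_le (h : EnergyBalance lamX lamV lamW X V P a b c M) (hV : 0 < lamV) {t : ℝ}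
    (ht : 0 ≤ t) : lamW * X t + V t + lamX * M t ≤ lamW * X 0 + V 0 + lamX * M 0 := by
  refine antitone_of_deriv_nonpos (f := fun t => lamW * X t + V t + lamX * M t)
    (fun s => (h.hasDerivAt_energy s).differentiableAt) (fun s => ?_) ht
  rw [(h.hasDerivAt_energy s).deriv]
  have := mul_nonneg hV.le (h.c_nonneg s)
  linarith

lemma b_bound (h : EnergyBalance lamX lamV lamW X V P a b c M)
    (hb : EnergyBounds φm φM X V a c M) (t : ℝ) : b t ^ 2 ≤ (2 * φM * X t) * (2 * φM * V t) :=
  (h.sq_b_le t).trans (mul_le_mul (hb.a_le t) (hb.c_le t) (h.c_nonneg t)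
    ((h.a_nonneg t).trans (hb.a_le t)))

end EnergyBalance

/-- The energy, perturbed by a small multiple of the covariance, decays exponentially. -/
theorem exists_rate_of_bounds (hX : 0 < lamX) (hV : 0 < lamV) (hW : 0 < lamW) (hm : 0 < φm)
    (hM : 0 < φM) : ∃ κ : ℝ, 0 < κ ∧ ∀ X V P a b c M : ℝ → ℝ,
      EnergyBalance lamX lamV lamW X V P a b c M → EnergyBounds φm φM X V a c M →
      ∀ t, 0 ≤ t → lamW * X t + V t
        ≤ (3 * (lamW * X 0 + V 0) + 2 * (lamX * φM) * X 0) * Real.exp (-(κ * t)) := by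
  set G := 1 + lamV ^ 2 * φM ^ 2 / (2 * lamW) with hG
  have hG0 : 0 < G := by positivity
  -- `ε` is small enough for the mixed terms to be absorbed and for equivalence with the energy
  set ε := min (lamV * φm / G) (Real.sqrt lamW) with hε
  have hε0 : 0 < ε := by
    refine lt_min (by positivity) (Real.sqrt_pos.2 hW)
  have hε1 : ε * G ≤ lamV * φm := by
    rw [← le_div_iff₀ hG0]; exact min_le_left _ _
  have hε2 : ε ^ 2 ≤ lamW := by
    have h1 : ε ≤ Real.sqrt lamW := min_le_right _ _
    have h2 := Real.sq_sqrt hW.le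
    nlinarith [Real.sqrt_nonneg lamW]
  set Λ := 3 * lamW + 2 * (lamX * φM) + 3 with hΛ
  have hΛ0 : 0 < Λ := by positivity
  set m := min (ε * lamW) (2 * (lamV * φm)) with hmdef
  have hm0 : 0 < m := lt_min (by positivity) (by positivity)
  refine ⟨m / Λ, by positivity, fun X V P a b c M h hb t ht => ?_⟩
  have hPb : ∀ s, ε * |P s| ≤ (lamW * X s + V s) / 2 := fun s => by
    have h1 : (ε * P s) ^ 2 ≤ (lamW * X s) * V s := by
      have h2 := h.sq_P_le s
      have h3 := mul_nonneg (h.X_nonneg s) (h.V_nonneg s)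
      calc (ε * P s) ^ 2 = ε ^ 2 * P s ^ 2 := by ring
        _ ≤ lamW * (X s * V s) := mul_le_mul hε2 h2 (sq_nonneg _) hW.le
        _ = _ := by ring
    have h4 := abs_le_of_sq_le_mul h1 (mul_nonneg hW.le (h.X_nonneg s)) (h.V_nonneg s)
      (z := 1 / 2) (w := 1 / 2) (by norm_num) (by norm_num) (by norm_num)
    rw [abs_mul, abs_of_pos hε0] at h4
    linarith
  have hLlow : ∀ s, (lamW * X s + V s) / 2 ≤ lamW * X s + V s + lamX * M s + ε * P s := fun s => by
    have h1 := hPb s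
    have h2 := mul_le_mul_of_nonneg_left (neg_abs_le (P s)) hε0.le
    have h3 := mul_nonneg hX.le (h.M_nonneg s)
    linarith
  have hLup : ∀ s, lamW * X s + V s + lamX * M s + ε * P s
      ≤ 3 / 2 * (lamW * X s + V s) + lamX * φM * X s := fun s => by
    have h1 := hPb s
    have h2 := mul_le_mul_of_nonneg_left (le_abs_self (P s)) hε0.le
    have h3 := mul_le_mul_of_nonneg_left (hb.M_le s) hX.le
    linarith
  have hd : ∀ s, HasDerivAt (fun s => lamW * X s + V s + lamX * M s + ε * P s)
      (-(lamV * c s) + ε * (V s - lamW * X s - lamX / 2 * a s - lamV / 2 * b s)) s := fun s =>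
    (h.hasDerivAt_energy s).add ((h.hasDerivAt_P s).const_mul ε)
  have hle : ∀ s, -(lamV * c s) + ε * (V s - lamW * X s - lamX / 2 * a s - lamV / 2 * b s)
      ≤ -(m / Λ) * (lamW * X s + V s + lamX * M s + ε * P s) := fun s => by
    have hX0 := h.X_nonneg s
    have hV0 := h.V_nonneg s
    have hbb : lamV / 2 * |b s| ≤ lamW / 2 * X s + lamV ^ 2 * φM ^ 2 / (2 * lamW) * V s := by
      have h1 : (lamV / 2 * b s) ^ 2 ≤ X s * (lamV ^ 2 * φM ^ 2 * V s) := by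
        have h2 := mul_le_mul_of_nonneg_left (h.b_bound hb s) (by positivity : 0 ≤ (lamV / 2) ^ 2)
        nlinarith [h2]
      have h4 := abs_le_of_sq_le_mul h1 hX0 (by positivity) (z := lamW / 2)
        (w := 1 / (2 * lamW)) (by positivity) (by positivity) (by field_simp; norm_num)
      rw [abs_mul, abs_of_pos (by positivity : 0 < lamV / 2)] at h4
      refine h4.trans (le_of_eq ?_)
      ring
    have h1 : -(lamV * c s) ≤ -(2 * (lamV * φm) * V s) := by
      have := mul_le_mul_of_nonneg_left (hb.le_c s) hV.le
      linarith
    have h2 : ε * (V s - lamW * X s - lamX / 2 * a s - lamV / 2 * b s)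
        ≤ ε * (G * V s - lamW / 2 * X s) := by
      refine mul_le_mul_of_nonneg_left ?_ hε0.le
      have h3 := mul_le_mul_of_nonneg_left (neg_abs_le (b s)) (by positivity : 0 ≤ lamV / 2)
      have h4 : 0 ≤ lamX / 2 * a s := mul_nonneg (by positivity) (h.a_nonneg s)
      rw [hG, add_mul]
      linarith
    have h3 : ε * G * V s ≤ lamV * φm * V s := mul_le_mul_of_nonneg_right hε1 hV0
    have h4 : m * X s ≤ ε * lamW * X s := mul_le_mul_of_nonneg_right (min_le_left _ _) hX0
    have h5 : m * V s ≤ 2 * (lamV * φm) * V s :=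
      mul_le_mul_of_nonneg_right (min_le_right _ _) hV0
    have h6 : m / Λ * (lamW * X s + V s + lamX * M s + ε * P s) ≤ m / 2 * (X s + V s) := by
      have h7 : lamW * X s + V s + lamX * M s + ε * P s ≤ Λ / 2 * (X s + V s) := by
        refine (hLup s).trans ?_
        rw [hΛ]
        have h8 := mul_nonneg hW.le hV0
        have h9 := mul_nonneg (mul_nonneg hX.le hM.le) hV0
        nlinarith
      calc m / Λ * (lamW * X s + V s + lamX * M s + ε * P s)
          ≤ m / Λ * (Λ / 2 * (X s + V s)) := by gcongr
        _ = m / 2 * (X s + V s) := by field_simp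
    linarith
  have hfin := le_mul_exp_of_deriv_le (b := t) (fun s _ => (hd s).continuousAt.continuousWithinAt)
    (fun s _ => hd s) (fun s _ => hle s) (t := t) ⟨ht, le_rfl⟩
  have h1 := hLlow t
  have h2 := mul_le_mul_of_nonneg_right (hLup 0) (Real.exp_pos (-(m / Λ) * t)).le
  rw [← neg_mul]
  linarith

/-- For large `φM` the energy without the potential part, perturbed by the covariance with the
coefficient `2 λ_x / λ_v`, decays exponentially. With this coefficient the terms in `a`, `b`, `c`
form a perfect square. -/
theorem exists_rate_of_parameterCondition (hX : 0 < lamX) (hV : 0 < lamV) (hW : 0 < lamW)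
    (hm : 0 < φm) (hmM : φm ≤ φM) (hq : lamW ≤ lamX * φM)
    (hpc : φM * lamX ^ 2 / (φm * lamW * lamV ^ 2) < 1 / 2) :
    ∃ κ : ℝ, 0 < κ ∧ ∀ X V P a b c M : ℝ → ℝ,
      EnergyBalance lamX lamV lamW X V P a b c M → EnergyBounds φm φM X V a c M →
      ∀ t, 0 ≤ t → lamW * X t + V t ≤ 8 * (lamW * X 0 + V 0) * Real.exp (-(κ * t)) := by
  have hM : 0 < φM := hm.trans_le hmM
  rw [div_lt_iff₀ (by positivity)] at hpc
  -- `s` is the weight in Young's inequality for the mixed term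
  obtain ⟨s, hs0, hs1, hs2, hs3⟩ : ∃ s : ℝ, 0 < s ∧ s < 1 ∧ lamX < (1 - s) * (lamV ^ 2 * φm) ∧
      (1 - s) * (lamX * φM) < s * lamW := by
    have hden : 0 < lamX * φM + lamW := by positivity
    have h1 : lamX / (lamV ^ 2 * φm) < lamW / (lamX * φM + lamW) := by
      rw [div_lt_div_iff₀ (by positivity) hden]
      nlinarith [mul_pos hX hX]
    obtain ⟨y, hy1, hy2⟩ := exists_between h1
    have hy0 : 0 < y := lt_of_le_of_lt (by positivity) hy1
    rw [div_lt_iff₀ (by positivity)] at hy1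
    rw [lt_div_iff₀ hden] at hy2
    have hy3 : y < 1 := by
      by_contra hcon
      push Not at hcon
      nlinarith [mul_pos hX hM]
    refine ⟨1 - y, by linarith, by linarith, by linarith, ?_⟩
    linarith
  set μ := lamX / lamV with hμ
  have hμ0 : 0 < μ := by positivity
  have hμ2 : μ ^ 2 ≤ lamW / 2 := by
    rw [hμ, div_pow, div_le_iff₀ (by positivity)]
    have h1 : φm * lamX ^ 2 ≤ φM * lamX ^ 2 := by gcongr
    have h2 : φm * lamX ^ 2 < φm * (lamW / 2 * lamV ^ 2) := by linarith
    exact (lt_of_mul_lt_mul_left h2 hm.le).le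
  set kX := 2 * (lamX / lamV) * (lamW - (1 / s - 1) * (lamX * φM)) with hkX
  set kV := 2 * ((1 - s) * (lamV * φm) - lamX / lamV) with hkV
  have hkX0 : 0 < kX := by
    have h1 : (1 / s - 1) * (lamX * φM) < lamW := by
      have h2 : (1 / s - 1) * (lamX * φM) = (1 - s) * (lamX * φM) / s := by field_simp
      rw [h2, div_lt_iff₀ hs0]; linarith
    have : 0 < lamW - (1 / s - 1) * (lamX * φM) := by linarith
    positivity
  have hkV0 : 0 < kV := by
    have h1 : lamX / lamV < (1 - s) * (lamV * φm) := by
      rw [div_lt_iff₀ hV]; linarith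
    linarith
  set m := min kX kV with hmdef
  have hm0 : 0 < m := lt_min hkX0 hkV0
  set Λ := 2 * lamW + 2 with hΛ
  have hΛ0 : 0 < Λ := by positivity
  refine ⟨m / Λ, by positivity, fun X V P a b c M h hb t ht => ?_⟩
  have hPb : ∀ s, 2 * μ * |P s| ≤ 3 / 4 * (lamW * X s + V s) := fun s => by
    have h1 : (2 * μ * P s) ^ 2 ≤ (2 * (lamW * X s)) * V s := by
      have h2 := h.sq_P_le s
      calc (2 * μ * P s) ^ 2 = 4 * (μ ^ 2 * P s ^ 2) := by ring
        _ ≤ 4 * (lamW / 2 * (X s * V s)) := by gcongr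
        _ = _ := by ring
    have h4 := abs_le_of_sq_le_mul h1 (mul_nonneg zero_le_two (mul_nonneg hW.le (h.X_nonneg s)))
      (h.V_nonneg s) (z := 3 / 8) (w := 3 / 4) (by norm_num) (by norm_num) (by norm_num)
    rw [abs_mul, abs_of_pos (by positivity : 0 < 2 * μ)] at h4
    linarith
  have hLlow : ∀ s, (lamW * X s + V s) / 4 ≤ lamW * X s + V s + 2 * μ * P s := fun s => by
    have h1 := hPb s
    have h2 := mul_le_mul_of_nonneg_left (neg_abs_le (P s)) (by positivity : 0 ≤ 2 * μ)
    linarith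
  have hLup : ∀ s, lamW * X s + V s + 2 * μ * P s ≤ 2 * (lamW * X s + V s) := fun s => by
    have h1 := hPb s
    have h2 := mul_le_mul_of_nonneg_left (le_abs_self (P s)) (by positivity : 0 ≤ 2 * μ)
    have h3 := mul_nonneg hW.le (h.X_nonneg s)
    have h4 := h.V_nonneg s
    linarith
  have hd : ∀ s, HasDerivAt (fun s => lamW * X s + V s + 2 * μ * P s)
      (2 * μ * V s - 2 * μ * lamW * X s
        - (lamV * c s + 2 * lamX * b s + lamX * μ * a s)) s := fun s => by
    refine ((((h.hasDerivAt_X s).const_mul lamW).add (h.hasDerivAt_V s)).add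
      ((h.hasDerivAt_P s).const_mul (2 * μ))).congr_deriv ?_
    have : μ * lamV = lamX := div_mul_cancel₀ _ hV.ne'
    linear_combination (-b s) * this
  have hle : ∀ s', 2 * μ * V s' - 2 * μ * lamW * X s'
        - (lamV * c s' + 2 * lamX * b s' + lamX * μ * a s')
      ≤ -(m / Λ) * (lamW * X s' + V s' + 2 * μ * P s') := fun s' => by
    have hX0 := h.X_nonneg s'
    have hV0 := h.V_nonneg s'
    have hbb : 2 * lamX * |b s'| ≤ 1 / s * (lamX * μ) * a s' + s * lamV * c s' := by
      have h1 : (2 * lamX * b s') ^ 2 ≤ (2 * (lamX * μ) * a s') * (2 * lamV * c s') := by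
        have h2 := mul_le_mul_of_nonneg_left (h.sq_b_le s') (by positivity : 0 ≤ 4 * lamX ^ 2)
        have h3 : μ * lamV = lamX := div_mul_cancel₀ _ hV.ne'
        calc (2 * lamX * b s') ^ 2 = 4 * lamX ^ 2 * b s' ^ 2 := by ring
          _ ≤ 4 * lamX ^ 2 * (a s' * c s') := h2
          _ = 4 * lamX * (μ * lamV) * (a s' * c s') := by rw [h3]; ring
          _ = _ := by ring
      have h4 := abs_le_of_sq_le_mul h1 (mul_nonneg (by positivity) (h.a_nonneg s'))
        (mul_nonneg (by positivity) (h.c_nonneg s')) (z := 1 / (2 * s)) (w := s / 2)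
        (by positivity) (by positivity) (by field_simp; norm_num)
      rw [abs_mul, abs_of_pos (by positivity : 0 < 2 * lamX)] at h4
      refine h4.trans (le_of_eq ?_)
      field_simp
    have h1 := mul_le_mul_of_nonneg_left (neg_abs_le (b s')) (by positivity : 0 ≤ 2 * lamX)
    have h2 : (1 - s) * lamV * (2 * φm * V s') ≤ (1 - s) * lamV * c s' :=
      mul_le_mul_of_nonneg_left (hb.le_c s') (mul_nonneg (by linarith) hV.le)
    have hs4 : 0 ≤ 1 / s - 1 := by
      have := one_lt_one_div hs0 hs1
      linarith
    have h3 : (1 / s - 1) * (lamX * μ) * a s' ≤ (1 / s - 1) * (lamX * μ) * (2 * φM * X s') :=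
      mul_le_mul_of_nonneg_left (hb.a_le s') (by positivity)
    have h4 : m * X s' ≤ kX * X s' := mul_le_mul_of_nonneg_right (min_le_left _ _) hX0
    have h5 : m * V s' ≤ kV * V s' := mul_le_mul_of_nonneg_right (min_le_right _ _) hV0
    have h6 : m / Λ * (lamW * X s' + V s' + 2 * μ * P s') ≤ m * (X s' + V s') := by
      have h7 : lamW * X s' + V s' + 2 * μ * P s' ≤ Λ * (X s' + V s') := by
        refine (hLup s').trans ?_
        rw [hΛ]
        nlinarith [mul_nonneg hW.le hV0]
      calc m / Λ * (lamW * X s' + V s' + 2 * μ * P s')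
          ≤ m / Λ * (Λ * (X s' + V s')) := by gcongr
        _ = m * (X s' + V s') := by field_simp
    have h8 : kX * X s' = 2 * μ * lamW * X s' - (1 / s - 1) * (lamX * μ) * (2 * φM * X s') := by
      rw [hkX, ← hμ]; ring
    have h9 : kV * V s' = (1 - s) * lamV * (2 * φm * V s') - 2 * μ * V s' := by
      rw [hkV, ← hμ]; ring
    linarith
  have hfin := le_mul_exp_of_deriv_le (b := t) (fun s _ => (hd s).continuousAt.continuousWithinAt)
    (fun s _ => hd s) (fun s _ => hle s) (t := t) ⟨ht, le_rfl⟩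
  have h1 := hLlow t
  have h2 := mul_le_mul_of_nonneg_right (hLup 0) (Real.exp_pos (-(m / Λ) * t)).le
  rw [← neg_mul]
  linarith

/-- Under the condition on the parameters, the constant in front of the exponential depends on
the initial values only. -/
theorem exists_uniform_rate (hX : 0 < lamX) (hV : 0 < lamV) (hW : 0 < lamW) (hm : 0 < φm)
    (hmM : φm ≤ φM) (hpc : ParameterCondition lamX lamV lamW φm φM) :
    ∃ κ : ℝ, 0 < κ ∧ ∀ X V P a b c M : ℝ → ℝ,
      EnergyBalance lamX lamV lamW X V P a b c M → EnergyBounds φm φM X V a c M →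
      ∀ t, 0 ≤ t → lamW * X t + V t ≤ 8 * (lamW * X 0 + V 0) * Real.exp (-(κ * t)) := by
  rcases le_total lamW (lamX * φM) with hq | hq
  · exact exists_rate_of_parameterCondition hX hV hW hm hmM hq
      (hpc.trans_le (by linarith [min_le_left 1 φM]))
  · obtain ⟨κ, hκ, h⟩ := exists_rate_of_bounds hX hV hW hm (hm.trans_le hmM)
    refine ⟨κ, hκ, fun X V P a b c M hE hB t ht => (h X V P a b c M hE hB t ht).trans ?_⟩
    gcongr
    have h1 := mul_le_mul_of_nonneg_right hq (hE.X_nonneg 0)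
    have h2 := hE.V_nonneg 0
    have h3 := mul_nonneg hW.le (hE.X_nonneg 0)
    linarith

end Decay

/-! ### The balance equations of the mean-field system -/

section PairFunctionals

set_option linter.unusedSectionVars false

variable {d : ℕ} {Ω : Type*} [TopologicalSpace Ω] [CompactSpace Ω] [T2Space Ω]
  [SecondCountableTopology Ω] [MeasurableSpace Ω] [OpensMeasurableSpace Ω] {ν : Measure Ω}
  [IsProbabilityMeasure ν]

/-- The integral of the inner product of the differences of two functions. -/
lemma integral_inner_sub_sub {p q : Ω → Vec d} (hp : Continuous p) (hq : Continuous q) :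
    ∫ y, inner ℝ (p y.1 - p y.2) (q y.1 - q y.2) ∂(ν.prod ν)
      = 2 * (∫ a, inner ℝ (p a) (q a) ∂ν - inner ℝ (∫ a, p a ∂ν) (∫ a, q a ∂ν)) := by
  have hpi : Integrable p ν := integrable_of_continuous hp
  have hqi : Integrable q ν := integrable_of_continuous hq
  have hmix : ∀ (p q : Ω → Vec d), Continuous p → Continuous q →
      ∫ y, inner ℝ (p y.1) (q y.2) ∂(ν.prod ν) = inner ℝ (∫ a, p a ∂ν) (∫ a, q a ∂ν) := by
    intro p q hp hq
    have hi : Integrable (fun y : Ω × Ω => (inner ℝ (p y.1) (q y.2) : ℝ)) (ν.prod ν) :=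
      integrable_of_continuous (by fun_prop)
    have hpi : Integrable p ν := integrable_of_continuous hp
    have hqi : Integrable q ν := integrable_of_continuous hq
    rw [integral_prod _ hi]
    simp only
    simp_rw [integral_inner hqi, real_inner_comm _ (p _)]
    rw [integral_inner hpi, real_inner_comm]
  have h1 : ∀ y : Ω × Ω, (inner ℝ (p y.1 - p y.2) (q y.1 - q y.2) : ℝ)
      = inner ℝ (p y.1) (q y.1) + inner ℝ (p y.2) (q y.2)
        - (inner ℝ (p y.1) (q y.2) + inner ℝ (q y.1) (p y.2)) := fun y => by
    simp only [inner_sub_left, inner_sub_right, real_inner_comm (p y.2)]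
    ring
  have hc : ∀ f : Ω × Ω → ℝ, Continuous f → Integrable f (ν.prod ν) := fun f hf =>
    integrable_of_continuous hf
  simp_rw [h1]
  rw [integral_sub (hc _ (by fun_prop)) (hc _ (by fun_prop)),
    integral_add (hc _ (by fun_prop)) (hc _ (by fun_prop)),
    integral_add (hc _ (by fun_prop)) (hc _ (by fun_prop)), hmix p q hp hq, hmix q p hq hp,
    integral_fun_fst (fun a => (inner ℝ (p a) (q a) : ℝ)),
    integral_fun_snd (fun a => (inner ℝ (p a) (q a) : ℝ)), real_inner_comm (∫ a, p a ∂ν)]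
  simp
  ring

/-- For an antisymmetric interaction, differences of the mean forces may be replaced by the
interaction itself. -/
lemma integral_inner_sub_force {q : Ω → Vec d} (hq : Continuous q) {k : Ω → Ω → Vec d}
    (hk : Continuous fun y : Ω × Ω => k y.1 y.2) (hanti : ∀ a a', k a a' = - k a' a) :
    ∫ y, inner ℝ (q y.1 - q y.2) ((∫ a', k y.1 a' ∂ν) - ∫ a', k y.2 a' ∂ν) ∂(ν.prod ν)
      = ∫ y, inner ℝ (q y.1 - q y.2) (k y.1 y.2) ∂(ν.prod ν) := by
  have hF : Continuous fun a => ∫ a', k a a' ∂ν := continuous_integral_of_compactSpace hk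
  have hki : Integrable (fun y : Ω × Ω => k y.1 y.2) (ν.prod ν) := integrable_of_continuous hk
  have hF0 : ∫ a, ∫ a', k a a' ∂ν ∂ν = 0 := by
    have h1 : ∫ a, ∫ a', k a a' ∂ν ∂ν = -∫ a, ∫ a', k a a' ∂ν ∂ν := by
      conv_lhs => rw [integral_integral_swap hki]
      rw [← integral_neg]
      congr 1; funext a
      rw [← integral_neg]
      congr 1; funext a'
      exact hanti a' a
    have h2 : (2 : ℝ) • ∫ a, ∫ a', k a a' ∂ν ∂ν = 0 := by
      rw [two_smul]; nth_rewrite 1 [h1]; simp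
    exact (smul_eq_zero.1 h2).resolve_left two_ne_zero
  have h1 : ∫ y, inner ℝ (q y.1) (k y.1 y.2) ∂(ν.prod ν)
      = ∫ a, inner ℝ (q a) (∫ a', k a a' ∂ν) ∂ν := by
    have hi : Integrable (fun y : Ω × Ω => (inner ℝ (q y.1) (k y.1 y.2) : ℝ)) (ν.prod ν) :=
      integrable_of_continuous (by fun_prop)
    rw [integral_prod _ hi]
    congr 1; funext a
    have h2 : Integrable (fun a' => k a a') ν :=
      integrable_of_continuous (hk.comp (by fun_prop : Continuous fun a' : Ω => (a, a')))
    exact integral_inner h2 (q a)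
  have h2 : ∫ y, inner ℝ (q y.2) (k y.1 y.2) ∂(ν.prod ν)
      = -∫ y, inner ℝ (q y.1) (k y.1 y.2) ∂(ν.prod ν) := by
    rw [← integral_neg, ← integral_prod_swap]
    congr 1; funext y
    simp only [Prod.fst_swap, Prod.snd_swap]
    rw [hanti y.2 y.1, inner_neg_right]
  rw [integral_inner_sub_sub hq hF, hF0, inner_zero_right, sub_zero]
  simp_rw [inner_sub_left]
  rw [integral_sub (integrable_of_continuous (by fun_prop))
    (integrable_of_continuous (by fun_prop)), h2, h1]
  ring

/-- The double average of a function of the relative phase space positions. -/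
noncomputable def pairIntegral (ν : Measure Ω) (Z : C(Ω, Phase d)) (h : Phase d → ℝ) : ℝ :=
  ∫ y, h (Z y.1 - Z y.2) ∂(ν.prod ν)

lemma pairIntegral_mono (Z : C(Ω, Phase d)) {h h' : Phase d → ℝ} (hh : Continuous h)
    (hh' : Continuous h') (hle : ∀ z, h z ≤ h' z) : pairIntegral ν Z h ≤ pairIntegral ν Z h' :=
  integral_mono (integrable_of_continuous (by fun_prop)) (integrable_of_continuous (by fun_prop))
    fun _ => hle _

lemma pairIntegral_nonneg (Z : C(Ω, Phase d)) {h : Phase d → ℝ} (hle : ∀ z, 0 ≤ h z) :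
    0 ≤ pairIntegral ν Z h :=
  integral_nonneg fun _ => hle _

lemma pairIntegral_const_mul (Z : C(Ω, Phase d)) (c : ℝ) (h : Phase d → ℝ) :
    pairIntegral ν Z (fun z => c * h z) = c * pairIntegral ν Z h :=
  integral_const_mul _ _

/-- The Cauchy–Schwarz inequality for double averages. -/
lemma sq_pairIntegral_le (Z : C(Ω, Phase d)) {h p q : Phase d → ℝ} (hh : Continuous h)
    (hp : Continuous p) (hq : Continuous q) (hle : ∀ z, |h z| ≤ p z * q z) :
    pairIntegral ν Z h ^ 2
      ≤ pairIntegral ν Z (fun z => p z ^ 2) * pairIntegral ν Z (fun z => q z ^ 2) := by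
  have h1 : |pairIntegral ν Z h| ≤ ∫ y, p (Z y.1 - Z y.2) * q (Z y.1 - Z y.2) ∂(ν.prod ν) :=
    (abs_integral_le_integral_abs).trans (integral_mono (integrable_of_continuous (by fun_prop))
      (integrable_of_continuous (by fun_prop)) fun _ => hle _)
  have h2 := sq_integral_mul_le (μ := ν.prod ν) (p := fun y : Ω × Ω => p (Z y.1 - Z y.2))
    (q := fun y => q (Z y.1 - Z y.2)) (integrable_of_continuous (by fun_prop))
    (integrable_of_continuous (by fun_prop)) (integrable_of_continuous (by fun_prop))
  rw [← sq_abs]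
  exact (pow_le_pow_left₀ (abs_nonneg _) h1 2).trans h2

variable {S : Model} {Z : ℝ → C(Ω, Phase d)}

/-- The interaction kernel in relative coordinates. -/
lemma Model.inner_kernel (S : Model) (q : Vec d) (z z' : Phase d) :
    inner ℝ q (S.kernel z z') = -(S.lamW * inner ℝ q (z - z').1
      + S.lamX * (S.φ ‖(z - z').1‖ * inner ℝ q (z - z').1)
      + S.lamV * (S.φ ‖(z - z').1‖ * inner ℝ q (z - z').2)) := by
  have h1 : S.kernel z z' = -(S.lamW • (z - z').1 + (S.lamX * S.φ ‖(z - z').1‖) • (z - z').1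
      + (S.lamV * S.φ ‖(z - z').1‖) • (z - z').2) := by
    simp only [Model.kernel, herdKernel, Prod.fst_sub, Prod.snd_sub, ← neg_sub z.1 z'.1,
      ← neg_sub z.2 z'.2, smul_neg]
    abel
  rw [h1, inner_neg_right, inner_add_right, inner_add_right, real_inner_smul_right,
    real_inner_smul_right, real_inner_smul_right]
  ring

/-- The mean-field system obeys the balance equations. The forces enter only through differences,
which the antisymmetry of the kernel turns into the kernel itself. -/
theorem energyBalance (hZ : ∀ t, HasDerivAt Z (S.meanField ν 1 (Z t)) t) :
    EnergyBalance S.lamX S.lamV S.lamW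
      (fun t => 1 / 2 * pairIntegral ν (Z t) fun z => ‖z.1‖ ^ 2)
      (fun t => 1 / 2 * pairIntegral ν (Z t) fun z => ‖z.2‖ ^ 2)
      (fun t => 1 / 2 * pairIntegral ν (Z t) fun z => inner ℝ z.1 z.2)
      (fun t => pairIntegral ν (Z t) fun z => S.φ ‖z.1‖ * ‖z.1‖ ^ 2)
      (fun t => pairIntegral ν (Z t) fun z => S.φ ‖z.1‖ * inner ℝ z.1 z.2)
      (fun t => pairIntegral ν (Z t) fun z => S.φ ‖z.1‖ * ‖z.2‖ ^ 2)
      (fun t => pairIntegral ν (Z t) fun z => potential S.φ ‖z.1‖) := by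
  have hφ := S.rate.continuous
  have hφ0 := S.rate.nonneg
  have hΦ := (contDiff_potential_norm S.rate (V := Vec d)).continuous
  have hZc := Model.continuous_eval_configuration hZ
  set F : ℝ → Ω → Vec d := fun t a => ∫ a', S.kernel (Z t a) (Z t a') ∂ν with hF
  have hFm : ∀ t a, S.meanForce ν 1 (Z t) (Z t a) = F t a := fun t a => by
    simp [Model.meanForce, hF]
  have hFc : Continuous fun q : ℝ × Ω => F q.1 q.2 := by
    have hk := (S.kernel_contDiff (d := d)).continuous
    exact continuous_integral_of_compactSpace (X := ℝ × Ω)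
      (h := fun q a' => S.kernel (Z q.1 q.2) (Z q.1 a')) (by fun_prop)
  have hd : ∀ t (y : Ω × Ω), HasDerivAt (fun t => Z t y.1 - Z t y.2)
      ((Z t y.1 - Z t y.2).2, F t y.1 - F t y.2) t := fun t y => by
    have h1 := (Model.hasDerivAt_configuration hZ t y.1).sub
      (Model.hasDerivAt_configuration hZ t y.2)
    rw [hFm, hFm] at h1
    exact h1
  have hd1 : ∀ t (y : Ω × Ω), HasDerivAt (fun t => (Z t y.1 - Z t y.2).1)
      (Z t y.1 - Z t y.2).2 t := fun t y =>
    (hasFDerivAt_fst (𝕜 := ℝ) (E := Vec d) (F := Vec d)).comp_hasDerivAt t (hd t y)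
  have hd2 : ∀ t (y : Ω × Ω), HasDerivAt (fun t => (Z t y.1 - Z t y.2).2)
      (F t y.1 - F t y.2) t := fun t y =>
    (hasFDerivAt_snd (𝕜 := ℝ) (E := Vec d) (F := Vec d)).comp_hasDerivAt t (hd t y)
  have hforce : ∀ t (q : Ω → Vec d), Continuous q →
      ∫ y, inner ℝ (q y.1 - q y.2) (F t y.1 - F t y.2) ∂(ν.prod ν)
        = -(S.lamW * ∫ y, inner ℝ (q y.1 - q y.2) (Z t y.1 - Z t y.2).1 ∂(ν.prod ν)
          + S.lamX * ∫ y, S.φ ‖(Z t y.1 - Z t y.2).1‖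
            * inner ℝ (q y.1 - q y.2) (Z t y.1 - Z t y.2).1 ∂(ν.prod ν)
          + S.lamV * ∫ y, S.φ ‖(Z t y.1 - Z t y.2).1‖
            * inner ℝ (q y.1 - q y.2) (Z t y.1 - Z t y.2).2 ∂(ν.prod ν)) := by
    intro t q hq
    have hk := (S.kernel_contDiff (d := d)).continuous
    have h1 := integral_inner_sub_force (ν := ν) hq (k := fun a a' => S.kernel (Z t a) (Z t a'))
      (by fun_prop) (fun a a' => herdKernel_antisymm _ _)
    refine h1.trans ?_
    simp_rw [S.inner_kernel]
    have hc : ∀ f : Ω × Ω → ℝ, Continuous f → Integrable f (ν.prod ν) := fun f hf =>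
      integrable_of_continuous hf
    rw [integral_neg, integral_add (hc _ (by fun_prop)) (hc _ (by fun_prop)),
      integral_add (hc _ (by fun_prop)) (hc _ (by fun_prop)), integral_const_mul,
      integral_const_mul, integral_const_mul]
  refine ⟨fun t => ?_, fun t => ?_, fun t => ?_, fun t => ?_, fun t => ?_, fun t => ?_, fun t => ?_,
    fun t => ?_, fun t => ?_, fun t => ?_, fun t => ?_⟩
  · have h1 := hasDerivAt_integral_of_compactSpace (ν := ν.prod ν)
      (h := fun t (y : Ω × Ω) => ‖(Z t y.1 - Z t y.2).1‖ ^ 2) (by fun_prop) (by fun_prop)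
      (fun t y => (hd1 t y).norm_sq) t
    refine (h1.const_mul (1 / 2)).congr_deriv ?_
    rw [integral_const_mul]
    simp only [pairIntegral]
    ring
  · have h1 := hasDerivAt_integral_of_compactSpace (ν := ν.prod ν)
      (h := fun t (y : Ω × Ω) => ‖(Z t y.1 - Z t y.2).2‖ ^ 2) (by fun_prop) (by fun_prop)
      (fun t y => (hd2 t y).norm_sq) t
    refine (h1.const_mul (1 / 2)).congr_deriv ?_
    have h2 := hforce t (fun a => (Z t a).2) (by fun_prop)
    simp only [← Prod.snd_sub, real_inner_self_eq_norm_sq] at h2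
    have h3 : ∀ y : Ω × Ω, (inner ℝ (Z t y.1 - Z t y.2).2 (Z t y.1 - Z t y.2).1 : ℝ)
        = inner ℝ (Z t y.1 - Z t y.2).1 (Z t y.1 - Z t y.2).2 := fun y => real_inner_comm _ _
    simp_rw [h3] at h2
    rw [integral_const_mul, h2]
    simp only [pairIntegral]
    ring
  · have h1 := hasDerivAt_integral_of_compactSpace (ν := ν.prod ν)
      (h := fun t (y : Ω × Ω) => (inner ℝ (Z t y.1 - Z t y.2).1 (Z t y.1 - Z t y.2).2 : ℝ))
      (by fun_prop) (by fun_prop) (fun t y => (hd1 t y).inner ℝ (hd2 t y)) t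
    refine (h1.const_mul (1 / 2)).congr_deriv ?_
    have h2 := hforce t (fun a => (Z t a).1) (by fun_prop)
    simp only [← Prod.fst_sub, real_inner_self_eq_norm_sq] at h2
    rw [integral_add (integrable_of_continuous (by fun_prop))
      (integrable_of_continuous (by fun_prop)), h2]
    simp only [pairIntegral, real_inner_self_eq_norm_sq]
    ring
  · have h1 := hasDerivAt_integral_of_compactSpace (ν := ν.prod ν)
      (h := fun t (y : Ω × Ω) => potential S.φ ‖(Z t y.1 - Z t y.2).1‖)
      (fun t => hΦ.comp (by fun_prop : Continuous fun y : Ω × Ω => (Z t y.1 - Z t y.2).1))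
      (h' := fun t (y : Ω × Ω) => S.φ ‖(Z t y.1 - Z t y.2).1‖
        * inner ℝ (Z t y.1 - Z t y.2).1 (Z t y.1 - Z t y.2).2) (by fun_prop)
      (fun t y => (hasFDerivAt_potential_norm S.rate _).comp_hasDerivAt t (hd1 t y)) t
    exact h1
  · exact mul_nonneg (by norm_num) (pairIntegral_nonneg _ fun z => sq_nonneg _)
  · exact mul_nonneg (by norm_num) (pairIntegral_nonneg _ fun z => sq_nonneg _)
  · exact pairIntegral_nonneg _ fun z => mul_nonneg (hφ0 _) (sq_nonneg _)
  · exact pairIntegral_nonneg _ fun z => mul_nonneg (hφ0 _) (sq_nonneg _)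
  · exact pairIntegral_nonneg _ fun z => potential_nonneg S.rate _
  · have h1 := sq_pairIntegral_le (ν := ν) (Z t) (h := fun z => inner ℝ z.1 z.2)
      (p := fun z => ‖z.1‖) (q := fun z => ‖z.2‖) (by fun_prop) (by fun_prop) (by fun_prop)
      fun z => abs_real_inner_le_norm _ _
    linarith
  · have h1 := sq_pairIntegral_le (ν := ν) (Z t) (h := fun z => S.φ ‖z.1‖ * inner ℝ z.1 z.2)
      (p := fun z => √(S.φ ‖z.1‖) * ‖z.1‖) (q := fun z => √(S.φ ‖z.1‖) * ‖z.2‖)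
      (by fun_prop) (by fun_prop) (by fun_prop) fun z => by
        rw [abs_mul, abs_of_nonneg (hφ0 _)]
        calc S.φ ‖z.1‖ * |inner ℝ z.1 z.2| ≤ S.φ ‖z.1‖ * (‖z.1‖ * ‖z.2‖) := by
              gcongr
              · exact hφ0 _
              · exact abs_real_inner_le_norm _ _
          _ = √(S.φ ‖z.1‖) * √(S.φ ‖z.1‖) * (‖z.1‖ * ‖z.2‖) := by
              rw [Real.mul_self_sqrt (hφ0 _)]
          _ = _ := by ring
    simpa only [mul_pow, Real.sq_sqrt (hφ0 _)] using h1

theorem energyBounds {φm φM : ℝ} (hb : ∀ r, φm ≤ S.φ r ∧ S.φ r ≤ φM) :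
    EnergyBounds φm φM
      (fun t => 1 / 2 * pairIntegral ν (Z t) fun z => ‖z.1‖ ^ 2)
      (fun t => 1 / 2 * pairIntegral ν (Z t) fun z => ‖z.2‖ ^ 2)
      (fun t => pairIntegral ν (Z t) fun z => S.φ ‖z.1‖ * ‖z.1‖ ^ 2)
      (fun t => pairIntegral ν (Z t) fun z => S.φ ‖z.1‖ * ‖z.2‖ ^ 2)
      (fun t => pairIntegral ν (Z t) fun z => potential S.φ ‖z.1‖) := by
  have hφ := S.rate.continuous
  have hΦ := (contDiff_potential_norm S.rate (V := Vec d)).continuous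
  have hlow : ∀ t (p : Phase d → ℝ), Continuous p → φm * pairIntegral ν (Z t) (fun z => p z ^ 2)
      ≤ pairIntegral ν (Z t) fun z => S.φ ‖z.1‖ * p z ^ 2 := fun t p hp => by
    rw [← pairIntegral_const_mul]
    exact pairIntegral_mono _ (by fun_prop) (by fun_prop) fun z =>
      mul_le_mul_of_nonneg_right (hb _).1 (sq_nonneg _)
  have hup : ∀ t (p : Phase d → ℝ), Continuous p →
      pairIntegral ν (Z t) (fun z => S.φ ‖z.1‖ * p z ^ 2)
        ≤ φM * pairIntegral ν (Z t) fun z => p z ^ 2 := fun t p hp => by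
    rw [← pairIntegral_const_mul]
    exact pairIntegral_mono _ (by fun_prop) (by fun_prop) fun z =>
      mul_le_mul_of_nonneg_right (hb _).2 (sq_nonneg _)
  refine ⟨fun t => ?_, fun t => ?_, fun t => ?_, fun t => ?_⟩
  · linarith [hup t (fun z => ‖z.1‖) (by fun_prop)]
  · linarith [hlow t (fun z => ‖z.2‖) (by fun_prop)]
  · linarith [hup t (fun z => ‖z.2‖) (by fun_prop)]
  · rw [← mul_assoc, ← pairIntegral_const_mul]
    refine pairIntegral_mono _ (hΦ.comp continuous_fst) (by fun_prop) fun z => ?_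
    exact (potential_le S.rate (fun r => (hb r).2) _).trans (le_of_eq (by ring))

end PairFunctionals

/-! ### The functionals of a density carried by a configuration -/

section CarriedDensity

set_option linter.unusedSectionVars false

variable {d : ℕ} {Ω : Type*} [TopologicalSpace Ω] [CompactSpace Ω] [T2Space Ω]
  [SecondCountableTopology Ω] [MeasurableSpace Ω] [OpensMeasurableSpace Ω] {ν : Measure Ω}
  [IsProbabilityMeasure ν] {g : Phase d → ℝ} {Y : C(Ω, Phase d)}

/-- The variance is half the mean square of the differences. -/
lemma integral_norm_sub_sq {p : Ω → Vec d} (hp : Continuous p) :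
    ∫ a, ‖p a - ∫ a', p a' ∂ν‖ ^ 2 ∂ν = 1 / 2 * ∫ y, ‖p y.1 - p y.2‖ ^ 2 ∂(ν.prod ν) := by
  have hpi : Integrable p ν := integrable_of_continuous hp
  set m := ∫ a', p a' ∂ν with hm
  have h1 := integral_inner_sub_sub (ν := ν) hp hp
  simp only [real_inner_self_eq_norm_sq] at h1
  rw [h1]
  have h2 : ∀ a, ‖p a - m‖ ^ 2 = ‖p a‖ ^ 2 - 2 * inner ℝ m (p a) + ‖m‖ ^ 2 := fun a => by
    rw [norm_sub_sq_real, real_inner_comm]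
  simp_rw [h2]
  have hc : ∀ f : Ω → ℝ, Continuous f → Integrable f ν := fun f hf => integrable_of_continuous hf
  rw [integral_add (hc _ (by fun_prop)) (hc _ (by fun_prop)),
    integral_sub (hc _ (by fun_prop)) (hc _ (by fun_prop)), integral_const_mul,
    integral_inner hpi, ← hm, real_inner_self_eq_norm_sq]
  simp
  ring

/-- The density `g` is the distribution of the configuration `Y`. -/
def IsCarriedBy (g : Phase d → ℝ) (ν : Measure Ω) (Y : C(Ω, Phase d)) : Prop :=
  ∀ (F : Type) [NormedAddCommGroup F] [NormedSpace ℝ F] (h : Phase d → F),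
    ContDiff ℝ 1 h → ∫ z, g z • h z = ∫ a, h (Y a) ∂ν

lemma IsCarriedBy.varX_eq (hg : IsCarriedBy g ν Y) :
    varX (fun x v => g (x, v)) = 1 / 2 * pairIntegral ν Y fun z => ‖z.1‖ ^ 2 := by
  have h1 : meanX (fun x v => g (x, v)) = ∫ a, (Y a).1 ∂ν := hg (Vec d) Prod.fst contDiff_fst
  unfold varX
  rw [h1]
  have h2 := hg ℝ (fun z => ‖z.1 - ∫ a, (Y a).1 ∂ν‖ ^ 2)
    ((contDiff_fst.sub contDiff_const).norm_sq ℝ)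
  simp only [smul_eq_mul] at h2
  simp_rw [mul_comm _ (g _)]
  exact h2.trans (integral_norm_sub_sq (ν := ν) (p := fun a => (Y a).1) (by fun_prop))

lemma IsCarriedBy.varV_eq (hg : IsCarriedBy g ν Y) :
    varV (fun x v => g (x, v)) = 1 / 2 * pairIntegral ν Y fun z => ‖z.2‖ ^ 2 := by
  have h1 : meanV (fun x v => g (x, v)) = ∫ a, (Y a).2 ∂ν := hg (Vec d) Prod.snd contDiff_snd
  unfold varV
  rw [h1]
  have h2 := hg ℝ (fun z => ‖z.2 - ∫ a, (Y a).2 ∂ν‖ ^ 2)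
    ((contDiff_snd.sub contDiff_const).norm_sq ℝ)
  simp only [smul_eq_mul] at h2
  simp_rw [mul_comm _ (g _)]
  exact h2.trans (integral_norm_sub_sq (ν := ν) (p := fun a => (Y a).2) (by fun_prop))

/-- The push-forward identity is applied in each of the two variables. It is available for `C¹` test
functions, and the potential of the configuration is one. -/
lemma IsCarriedBy.potentialEnergy_eq (hg : IsCarriedBy g ν Y) {φ : ℝ → ℝ}
    (hφ : IsCommunicationRate φ) (hc : Continuous g) (hs : HasCompactSupport g) :
    potentialEnergy φ (fun x v => g (x, v)) = pairIntegral ν Y fun z => potential φ ‖z.1‖ := by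
  have hΦ := contDiff_potential_norm hφ (V := Vec d)
  have hΦc := hΦ.continuous
  have hinner : ∀ z : Phase d, ∫ z', g z' • potential φ ‖z.1 - z'.1‖
      = ∫ a, potential φ ‖z.1 - (Y a).1‖ ∂ν := fun z => by
    refine hg ℝ (fun z' => potential φ ‖z.1 - z'.1‖) ?_
    have h1 := hΦ.comp (by fun_prop : ContDiff ℝ 1 fun z' : Phase d => z.1 - z'.1)
    exact h1
  have hH : ContDiff ℝ 1 fun z : Phase d => ∫ a, potential φ ‖z.1 - (Y a).1‖ ∂ν := by
    refine contDiff_integral_of_compactSpace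
      (h' := fun z a => (φ ‖z.1 - (Y a).1‖ • innerSL ℝ (z.1 - (Y a).1)).comp
        (ContinuousLinearMap.fst ℝ (Vec d) (Vec d)))
      (fun z => hΦc.comp (by fun_prop : Continuous fun a => z.1 - (Y a).1)) ?_ fun z a => ?_
    · have := hφ.continuous
      fun_prop
    · have h1 : HasFDerivAt (fun z : Phase d => z.1 - (Y a).1)
          (ContinuousLinearMap.fst ℝ (Vec d) (Vec d)) z := hasFDerivAt_fst.sub_const _
      exact HasFDerivAt.comp (f := fun z : Phase d => z.1 - (Y a).1) z
        (hasFDerivAt_potential_norm hφ _) h1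
  have hint : Integrable fun p : Phase d × Phase d =>
      potential φ ‖p.1.1 - p.2.1‖ * g p.1 * g p.2 := by
    have h1 : Continuous fun p : Phase d × Phase d => potential φ ‖p.1.1 - p.2.1‖ :=
      hΦc.comp (by fun_prop : Continuous fun p : Phase d × Phase d => p.1.1 - p.2.1)
    refine Continuous.integrable_of_hasCompactSupport (by fun_prop)
      (HasCompactSupport.of_support_subset_isCompact (hs.isCompact.prod hs.isCompact)
        fun p hp => ?_)
    exact ⟨subset_tsupport _ fun h => hp (by simp [h]), subset_tsupport _ fun h => hp (by simp [h])⟩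
  have h1 : potentialEnergy φ (fun x v => g (x, v))
      = ∫ z, g z • ∫ z', g z' • potential φ ‖z.1 - z'.1‖ := by
    have h2 := integral_prod _ hint
    refine h2.trans (integral_congr_ae (Eventually.of_forall fun z => ?_))
    simp only [smul_eq_mul]
    rw [← integral_const_mul]
    congr 1; funext z'
    ring
  rw [h1]
  simp_rw [hinner]
  rw [hg ℝ _ hH]
  have h3 : Integrable (fun y : Ω × Ω => potential φ ‖(Y y.1 - Y y.2).1‖) (ν.prod ν) :=
    integrable_of_continuous
      (hΦc.comp (by fun_prop : Continuous fun y : Ω × Ω => (Y y.1 - Y y.2).1))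
  exact (integral_prod _ h3).symm

end CarriedDensity

namespace InitialDatum

variable {d : ℕ} (D : InitialDatum d)

/-- The initial distribution of the labels. -/
noncomputable def agentMeasure : Measure D.Label :=
  D.labelMeasure.withDensity fun a => ((D.weight a).toNNReal : ENNReal)

variable {D}

/-- For a nonnegative datum the weights may be absorbed into the measure. -/
lemma integral_agentMeasure (h0 : ∀ z, 0 ≤ D.toFun z) {F : Type*} [NormedAddCommGroup F]
    [NormedSpace ℝ F] (h : D.Label → F) :
    ∫ a, h a ∂D.agentMeasure = ∫ a, D.weight a • h a ∂D.labelMeasure := by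
  rw [agentMeasure, integral_withDensity_eq_integral_smul
    (D.weight.continuous.measurable.real_toNNReal)]
  congr 1; funext a
  rw [NNReal.smul_def, Real.coe_toNNReal (D.weight a) (h0 a)]

lemma isProbabilityMeasure_agentMeasure (h0 : ∀ z, 0 ≤ D.toFun z) (h1 : ∫ z, D.toFun z = 1) :
    IsProbabilityMeasure D.agentMeasure := by
  have hi : Integrable D.weight D.labelMeasure := integrable_of_continuous D.weight.continuous
  have hf : IsFiniteMeasure D.agentMeasure := isFiniteMeasure_withDensity_ofReal hi.2
  have h2 := integral_agentMeasure h0 fun _ => (1 : ℝ)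
  rw [D.integral_label fun _ => (1 : ℝ)] at h2
  simp only [smul_eq_mul, mul_one, h1, integral_const] at h2
  exact ⟨by rw [← ENNReal.toReal_eq_one_iff]; exact h2⟩

end InitialDatum

/-- The functionals of a Lagrangian solution whose initial datum is a probability density obey
the balance equations. -/
theorem IsLagrangianSolution.exists_energyBalance {d : ℕ} {S : Model} {D : InitialDatum d}
    {f : Phase d × ℝ → ℝ} {Z : ℝ → C(D.Label, Phase d)} (h : IsLagrangianSolution S D f Z)
    (h0 : ∀ z, 0 ≤ D.toFun z) (h1 : ∫ z, D.toFun z = 1) :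
    ∃ X V P a b c M : ℝ → ℝ, EnergyBalance S.lamX S.lamV S.lamW X V P a b c M ∧
      (∀ φm φM, (∀ r, φm ≤ S.φ r ∧ S.φ r ≤ φM) → EnergyBounds φm φM X V a c M) ∧
      ∀ t, varX (fun x v => f ((x, v), t)) = X t ∧ varV (fun x v => f ((x, v), t)) = V t ∧
        potentialEnergy S.φ (fun x v => f ((x, v), t)) = M t := by
  have := D.isProbabilityMeasure_agentMeasure h0 h1
  have hZ : ∀ t, HasDerivAt Z (S.meanField D.agentMeasure 1 (Z t)) t := fun t => by
    have h2 : S.meanField D.agentMeasure 1 (Z t) = S.meanField D.labelMeasure D.weight (Z t) := by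
      ext1 a
      simp only [Model.meanField_apply, Model.meanForce]
      rw [D.integral_agentMeasure h0]
      simp
    rw [h2]
    exact h.hasDerivAt t
  have hc : ∀ t, IsCarriedBy (fun z => f (z, t)) D.agentMeasure (Z t) := fun t F _ _ k hk => by
    rw [D.integral_agentMeasure h0]
    exact h.integral_smul F k hk t
  refine ⟨_, _, _, _, _, _, _, energyBalance hZ, fun φm φM hb => energyBounds hb,
    fun t => ⟨(hc t).varX_eq, (hc t).varV_eq, ?_⟩⟩
  obtain ⟨ρ, hρ⟩ := h.support |t|
  have hfc := h.contDiff.continuous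
  exact (hc t).potentialEnergy_eq S.rate (by fun_prop)
    (hasCompactSupport_of_norm fun z hz => hρ t z le_rfl hz)

/-! ### Herding of classical solutions -/

/-- A classical solution agrees with the Lagrangian solution of the same initial datum. -/
lemma IsLagrangianSolution.eq_of_isClassicalSolution {d : ℕ} {S : Model} {D : InitialDatum d}
    {f : Phase d × ℝ → ℝ} {Z : ℝ → C(D.Label, Phase d)} (h : IsLagrangianSolution S D f Z)
    {T : EReal} (hT : 0 < T) {g : Vec d → Vec d → ℝ → ℝ}
    (hg : IsClassicalSolution S.lamX S.lamV S.lamW S.φ (fun x v => D.toFun (x, v)) T g)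
    {t : ℝ} (ht : t ∈ timeInterval T) (x v : Vec d) : g x v t = f ((x, v), t) := by
  obtain ⟨ρ, hρ⟩ := D.hasCompactSupport.exists_bound_of_continuousOn
    (weight_contDiff (d := d)).continuous.continuousOn
  refine IsDensitySolution.eq_of_initial (ρ₀ := ρ) (hg.isDensitySolution hT)
    ((h.isClassicalSolution hT).isDensitySolution hT) h.contDiff (fun z hz => ?_)
    (fun z => ?_) ht (x, v)
  · have h1 : f (z, 0) = 0 := by
      rw [h.initial]
      by_contra hne
      have h2 := (le_abs_self _).trans (hρ z (subset_tsupport _ hne))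
      linarith
    exact h1
  · have h1 : g z.1 z.2 0 = f (z, 0) := by rw [hg.initial, h.initial]
    exact h1

/-- The functionals of the global classical solution obey the balance equations for nonnegative
times; their initial values are those of the initial datum. -/
theorem IsClassicalSolution.exists_energyBalance {d : ℕ} {S : Model} {f₀ : Vec d → Vec d → ℝ}
    (h1 : ContDiff ℝ 1 fun z : Phase d => f₀ z.1 z.2)
    (h2 : HasCompactSupport fun z : Phase d => f₀ z.1 z.2) (h3 : IsProbDensity f₀)
    {g : Vec d → Vec d → ℝ → ℝ} (hg : IsClassicalSolution S.lamX S.lamV S.lamW S.φ f₀ ⊤ g) :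
    ∃ X V P a b c M : ℝ → ℝ, EnergyBalance S.lamX S.lamV S.lamW X V P a b c M ∧
      (∀ φm φM, (∀ r, φm ≤ S.φ r ∧ S.φ r ≤ φM) → EnergyBounds φm φM X V a c M) ∧
      X 0 = varX f₀ ∧ V 0 = varV f₀ ∧
      ∀ t, 0 ≤ t → varX (fun x v => g x v t) = X t ∧ varV (fun x v => g x v t) = V t := by
  obtain ⟨f, Z, hf⟩ := exists_isLagrangianSolution S ⟨_, h1, h2⟩
  obtain ⟨X, V, P, a, b, c, M, hE, hB, heq⟩ := hf.exists_energyBalance (fun z => h3.1 _ _) h3.2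
  have hgf : ∀ t, 0 ≤ t → (fun x v => g x v t) = fun x v => f ((x, v), t) := fun t ht => by
    funext x v
    exact hf.eq_of_isClassicalSolution EReal.zero_lt_top hg ⟨ht, EReal.coe_lt_top t⟩ x v
  have hg0 : (fun x v => f ((x, v), 0)) = f₀ := by
    funext x v
    exact hf.initial (x, v)
  refine ⟨X, V, P, a, b, c, M, hE, hB, ?_, ?_, fun t ht => ?_⟩
  · rw [← (heq 0).1, hg0]
  · rw [← (heq 0).2.1, hg0]
  · rw [hgf t ht]
    exact ⟨(heq t).1, (heq t).2.1⟩

lemma add_le_of_weighted {w x y : ℝ} (hw : 0 < w) (hx : 0 ≤ x) (hy : 0 ≤ y) :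
    x + y ≤ (1 / w + 1) * (w * x + y) := by
  have h1 : (1 / w + 1) * (w * x + y) = x + y + (w * x + y / w) := by field_simp; ring
  have h2 : 0 ≤ w * x + y / w := by positivity
  linarith

end Herding

theorem theorem5p1 (lamX lamV lamW : ℝ) (hX : 0 < lamX) (hV : 0 < lamV) (hW : 0 < lamW) :
    -- (1) existence, uniqueness and energy estimate
    (∀ (d : ℕ) (φ : ℝ → ℝ), Herding.IsCommunicationRate φ →
      ∀ f₀ : Herding.Vec d → Herding.Vec d → ℝ,
      ContDiff ℝ 1 (fun z : Herding.Vec d × Herding.Vec d => f₀ z.1 z.2) →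
      HasCompactSupport (fun z : Herding.Vec d × Herding.Vec d => f₀ z.1 z.2) →
      ∀ T : EReal, 0 < T →
        ∃ f : Herding.Vec d → Herding.Vec d → ℝ → ℝ,
          Herding.IsClassicalSolution lamX lamV lamW φ f₀ T f ∧
          (∀ g : Herding.Vec d → Herding.Vec d → ℝ → ℝ,
            Herding.IsClassicalSolution lamX lamV lamW φ f₀ T g →
            ∀ x v, ∀ t ∈ Herding.timeInterval T, g x v t = f x v t) ∧
          (Herding.IsProbDensity f₀ → ∀ t ∈ Herding.timeInterval T,
            Herding.herdingEnergy lamX lamW φ (fun x v => f x v t) ≤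
              Herding.herdingEnergy lamX lamW φ (fun x v => f x v 0))) ∧
    -- (2) herding of the global solution
    (∀ (d : ℕ) (φ : ℝ → ℝ), Herding.IsCommunicationRate φ →
      ∀ φm φM : ℝ, 0 < φm → (∀ r, φm ≤ φ r ∧ φ r ≤ φM) →
      ∀ f₀ : Herding.Vec d → Herding.Vec d → ℝ,
      ContDiff ℝ 1 (fun z : Herding.Vec d × Herding.Vec d => f₀ z.1 z.2) →
      HasCompactSupport (fun z : Herding.Vec d × Herding.Vec d => f₀ z.1 z.2) →
      Herding.IsProbDensity f₀ →
      ∀ f : Herding.Vec d → Herding.Vec d → ℝ → ℝ,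
        Herding.IsClassicalSolution lamX lamV lamW φ f₀ ⊤ f →
        Tendsto (fun t => Herding.varX (fun x v => f x v t) + Herding.varV (fun x v => f x v t))
          atTop (𝓝 0)) ∧
    -- (3) exponential herding; the rate depends only on the `λ`'s, `φm`, `φM`,
    -- and the constant `C` only on the `λ`'s and `f₀`
    (∃ β : ℝ → ℝ → ℝ,
      (∀ φm φM : ℝ, 0 < φm → φm ≤ φM →
        Herding.ParameterCondition lamX lamV lamW φm φM → 0 < β φm φM) ∧
      ∀ (d : ℕ) (f₀ : Herding.Vec d → Herding.Vec d → ℝ),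
      ContDiff ℝ 1 (fun z : Herding.Vec d × Herding.Vec d => f₀ z.1 z.2) →
      HasCompactSupport (fun z : Herding.Vec d × Herding.Vec d => f₀ z.1 z.2) →
      Herding.IsProbDensity f₀ →
      ∃ C : ℝ, 0 < C ∧
        ∀ φm φM : ℝ, 0 < φm → Herding.ParameterCondition lamX lamV lamW φm φM →
        ∀ φ : ℝ → ℝ, Herding.IsCommunicationRate φ → (∀ r, φm ≤ φ r ∧ φ r ≤ φM) →
        ∀ f : Herding.Vec d → Herding.Vec d → ℝ → ℝ,
          Herding.IsClassicalSolution lamX lamV lamW φ f₀ ⊤ f →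
          ∀ t : ℝ, 0 ≤ t →
            Herding.varX (fun x v => f x v t) + Herding.varV (fun x v => f x v t) ≤
              C * Real.exp (-(β φm φM / 2) * t)) := by
  refine ⟨fun d φ hφ f₀ h1 h2 T hT => ?_, fun d φ hφ φm φM hm hb f₀ h1 h2 h3 g hg => ?_, ?_⟩
  · obtain ⟨f, Z, hf⟩ := Herding.exists_isLagrangianSolution
      ⟨lamX, lamV, lamW, φ, hX, hV, hW, hφ⟩ ⟨_, h1, h2⟩
    refine ⟨fun x v t => f ((x, v), t), hf.isClassicalSolution hT,
      fun g hg x v t ht => hf.eq_of_isClassicalSolution hT hg ht x v, fun h3 t ht => ?_⟩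
    obtain ⟨X, V, P, a, b, c, M, hE, -, heq⟩ :=
      hf.exists_energyBalance (fun z => h3.1 _ _) h3.2
    have h4 := hE.energy_le hV ht.1
    rw [← (heq t).1, ← (heq t).2.1, ← (heq t).2.2, ← (heq 0).1, ← (heq 0).2.1,
      ← (heq 0).2.2] at h4
    exact h4
  · obtain ⟨X, V, P, a, b, c, M, hE, hB, -, -, heq⟩ :=
      Herding.IsClassicalSolution.exists_energyBalance
        (S := ⟨lamX, lamV, lamW, φ, hX, hV, hW, hφ⟩) h1 h2 h3 hg
    obtain ⟨κ, hκ, hdecay⟩ := Herding.exists_rate_of_bounds hX hV hW hm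
      (hm.trans_le ((hb 0).1.trans (hb 0).2))
    have h4 := hdecay X V P a b c M hE (hB φm φM hb)
    set K := 3 * (lamW * X 0 + V 0) + 2 * (lamX * φM) * X 0
    have hlim : Tendsto (fun t : ℝ => (1 / lamW + 1) * (K * Real.exp (-(κ * t)))) atTop (𝓝 0) := by
      have h5 : Tendsto (fun t : ℝ => Real.exp (-(κ * t))) atTop (𝓝 0) :=
        Real.tendsto_exp_neg_atTop_nhds_zero.comp (tendsto_id.const_mul_atTop hκ)
      simpa using (h5.const_mul K).const_mul (1 / lamW + 1)
    refine squeeze_zero' ?_ ?_ hlim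
    · filter_upwards [eventually_ge_atTop (0 : ℝ)] with t ht
      rw [(heq t ht).1, (heq t ht).2]
      exact add_nonneg (hE.X_nonneg t) (hE.V_nonneg t)
    · filter_upwards [eventually_ge_atTop (0 : ℝ)] with t ht
      rw [(heq t ht).1, (heq t ht).2]
      exact (Herding.add_le_of_weighted hW (hE.X_nonneg t) (hE.V_nonneg t)).trans
        (mul_le_mul_of_nonneg_left (h4 t ht) (by positivity))
  · have hrate : ∀ φm φM : ℝ, ∃ κ : ℝ, (0 < φm → φm ≤ φM →
        Herding.ParameterCondition lamX lamV lamW φm φM → 0 < κ ∧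
        ∀ X V P a b c M : ℝ → ℝ, Herding.EnergyBalance lamX lamV lamW X V P a b c M →
          Herding.EnergyBounds φm φM X V a c M → ∀ t, 0 ≤ t →
            lamW * X t + V t ≤ 8 * (lamW * X 0 + V 0) * Real.exp (-(κ * t))) := by
      intro φm φM
      by_cases h : 0 < φm ∧ φm ≤ φM ∧ Herding.ParameterCondition lamX lamV lamW φm φM
      · obtain ⟨κ, hκ⟩ := Herding.exists_uniform_rate hX hV hW h.1 h.2.1 h.2.2
        exact ⟨κ, fun _ _ _ => hκ⟩
      · exact ⟨1, fun h4 h5 h6 => (h ⟨h4, h5, h6⟩).elim⟩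
    choose κ hκ using hrate
    -- the exponent in the statement is `β / 2`
    refine ⟨fun φm φM => 2 * κ φm φM, fun φm φM hm hmM hp =>
      mul_pos two_pos (hκ φm φM hm hmM hp).1, fun d f₀ h1 h2 h3 => ?_⟩
    refine ⟨(1 / lamW + 1) * (8 * |lamW * Herding.varX f₀ + Herding.varV f₀|) + 1, by positivity,
      fun φm φM hm hp φ hφ hb g hg t ht => ?_⟩
    obtain ⟨X, V, P, a, b, c, M, hE, hB, hX0, hV0, heq⟩ :=
      Herding.IsClassicalSolution.exists_energyBalance
        (S := ⟨lamX, lamV, lamW, φ, hX, hV, hW, hφ⟩) h1 h2 h3 hg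
    have h4 := (hκ φm φM hm ((hb 0).1.trans (hb 0).2) hp).2 X V P a b c M hE (hB φm φM hb) t ht
    rw [(heq t ht).1, (heq t ht).2]
    have h5 : -(2 * κ φm φM / 2) * t = -(κ φm φM * t) := by ring
    rw [h5]
    calc X t + V t ≤ (1 / lamW + 1) * (lamW * X t + V t) :=
          Herding.add_le_of_weighted hW (hE.X_nonneg t) (hE.V_nonneg t)
      _ ≤ (1 / lamW + 1) * (8 * (lamW * X 0 + V 0) * Real.exp (-(κ φm φM * t))) := by gcongr
      _ = (1 / lamW + 1) * (8 * (lamW * Herding.varX f₀ + Herding.varV f₀))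
          * Real.exp (-(κ φm φM * t)) := by rw [hX0, hV0]; ring
      _ ≤ ((1 / lamW + 1) * (8 * |lamW * Herding.varX f₀ + Herding.varV f₀|) + 1)
          * Real.exp (-(κ φm φM * t)) := by
        refine mul_le_mul_of_nonneg_right ?_ (Real.exp_pos _).le
        have h6 : (1 / lamW + 1) * (8 * (lamW * Herding.varX f₀ + Herding.varV f₀))
            ≤ (1 / lamW + 1) * (8 * |lamW * Herding.varX f₀ + Herding.varV f₀|) := by
          gcongr
          exact le_abs_self _
        linarith
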